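/- **Setting.** In a digital-goods auction with $n$ bidders, bidder $i$ has a private value $v_i\ge 0$ and submits a bid $b_i\ge 0$; any set of bidders may be served. A deterministic auction decides from the bid vector $b$ who is served and what everybody pays; unserved bidders pay $0$, payments are nonnegative, and no bidder pays more than his bid. The utility of a bidder is his value minus his payment if he is served, and $0$ otherwise. The auction is truthful if bidding the true value is a dominant strategy for every bidder. A (universally) truthful randomized auction is a probability distribution over deterministic truthful auctions. It is $\lambda$-competitive ($\lambda>0$) against a benchmark $f$ if its expected revenue on every bid vector $b\in\mathbb R_{\ge0}^n$ is at least $f(b)/\lambda$. The optimal competitive ratio against $f$ is the least $\lambda$ for which a $\lambda$-competitive truthful auction exists. Write $b_{(1)}\ge b_{(2)}\ge\dots\ge b_{(n)}$ for the sorted bids. **Theorem.** For $n\ge 2$ let $f_n(b)=\max\bigl(4b_{(2)},3b_{(3)},4b_{(4)},\dots,n b_{(n)}\bigr)$. 1. For every $n\ge2$ the optimal competitive ratio $\rho_n$ against $f_n$ exists and satisfies $\rho_n\le 4.12$. Moreover $\rho_n=\frac1n\,\mathbb E[f_n(B)]$, where $B=(B_1,\dots,B_n)$ has independent coordinates with the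 equal-revenue distribution (density $1/x^2$ on $[1,\infty)$), and $f_n(B)$ is integrable. Explicitly, $\rho_2=\rho_3=4$, and for $n\ge4$ $$\rho_n=1-\sum_{i=2}^n\Bigl(\frac{-1}{n}\Bigr)^{i-1}\frac{i}{i-1}\binom{n-1}{i-1}+\frac{3n}{2(n-2)}\Bigl(\bigl(1-\tfrac2n\bigr)^{n-1}+1-\tfrac2n\Bigr)-\frac{11}{162}\Bigl(1+\bigl(5-\tfrac9n\bigr)\bigl(1-\tfrac3n\bigr)^{n-3}\Bigr).$$ 2. There is a single truthful randomized online auction which is $4.12$-competitive against $F^{(2)}(b)=\max_{2\le k\le n}k\,b_{(k)}$ for every number $n$ of bidders arriving in uniformly random order. Here an online auction does not know $n$; it decides irrevocably on each arriving bidder (service and payment, with the same conventions and the same notion of truthfulness as above) from his bid and the bids of the earlier arrivals only, and its expected revenue, over its own randomness and the arrival order, is at least $F^{(2)}(b)/4.12$ for all $n$ and all $b\in\mathbb R_{\ge 0}^n$. -/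

import Mathlib

open scoped NNReal
open MeasureTheory

noncomputable section

/-- The `k`-th entry, counted from `0`, of the bid vector `b` sorted in decreasing order;
so `sortedBid b 0` is the highest bid `b₍₁₎` and `sortedBid b 1` is `b₍₂₎`. -/
def sortedBid {n : ℕ} (b : Fin n → ℝ≥0) (k : Fin n) : ℝ≥0 :=
  b (Tuple.sort b (Fin.rev k))

/-- The benchmark `max (4 b₍₂₎, 3 b₍₃₎, 4 b₍₄₎, …, n b₍ₙ₎)`. -/
def plusTwoBenchmark {n : ℕ} (b : Fin n → ℝ≥0) : ℝ≥0 :=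
  (Finset.univ.filter fun k : Fin n => 1 ≤ k.val).sup fun k =>
    (if k.val = 1 then 4 else (k.val : ℝ≥0) + 1) * sortedBid b k

/-- The benchmark `F⁽²⁾(b) = max_{2 ≤ k ≤ n} k b₍ₖ₎` (which is `0` for fewer than two bidders). -/
def fixedPriceBenchmark {n : ℕ} (b : Fin n → ℝ≥0) : ℝ≥0 :=
  (Finset.univ.filter fun k : Fin n => 1 ≤ k.val).sup fun k =>
    ((k.val : ℝ≥0) + 1) * sortedBid b k

/-- A deterministic digital-goods auction with `n` bidders: any set of bidders may be served,
bidders who are not served pay nothing, and nobody is charged more than his bid. -/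
structure DetAuction (n : ℕ) where
  served : (Fin n → ℝ≥0) → Fin n → Prop
  pay : (Fin n → ℝ≥0) → Fin n → ℝ≥0
  pay_eq_zero : ∀ b i, ¬ served b i → pay b i = 0
  pay_le_bid : ∀ b i, pay b i ≤ b i

open Classical in
/-- The utility of bidder `i` with private value `v` when the submitted bid vector is `b`. -/
def DetAuction.utility {n : ℕ} (A : DetAuction n) (v : ℝ≥0) (b : Fin n → ℝ≥0) (i : Fin n) : ℝ :=
  if A.served b i then (v : ℝ) - A.pay b i else 0

/-- Bidding the private value is a dominant strategy for every bidder. -/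
def DetAuction.IsTruthful {n : ℕ} (A : DetAuction n) : Prop :=
  ∀ (i : Fin n) (v : ℝ≥0) (b : Fin n → ℝ≥0),
    A.utility v b i ≤ A.utility v (Function.update b i v) i

/-- A (universally) truthful randomized auction: a random deterministic truthful auction. -/
structure TruthfulAuction (n : ℕ) where
  Ω : Type
  mΩ : MeasurableSpace Ω
  μ : Measure Ω
  isProb : IsProbabilityMeasure μ
  det : Ω → DetAuction n
  truthful : ∀ ω, (det ω).IsTruthful
  measurable_pay : ∀ b i, Measurable fun ω => (det ω).pay b i

/-- The expected revenue on the bid vector `b`. -/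
def TruthfulAuction.expRevenue {n : ℕ} (A : TruthfulAuction n) (b : Fin n → ℝ≥0) : ℝ :=
  letI := A.mΩ
  ∫ ω, ∑ i, ((A.det ω).pay b i : ℝ) ∂A.μ

/-- The auction has competitive ratio `l` with respect to the benchmark `f`. -/
def TruthfulAuction.IsCompetitive {n : ℕ} (A : TruthfulAuction n)
    (f : (Fin n → ℝ≥0) → ℝ≥0) (l : ℝ) : Prop :=
  0 < l ∧ ∀ b, (f b : ℝ) / l ≤ A.expRevenue b

/-- `l` is the optimal competitive ratio of truthful auctions with respect to `f`. -/
def IsOptimalRatio {n : ℕ} (f : (Fin n → ℝ≥0) → ℝ≥0) (l : ℝ) : Prop :=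
  IsLeast {r : ℝ | ∃ A : TruthfulAuction n, A.IsCompetitive f r} l

/-- The equal revenue distribution: density `1 / x ^ 2` on `[1, ∞)`. -/
def equalRevenue : Measure ℝ≥0 :=
  ((volume.restrict (Set.Ici (1 : ℝ))).withDensity
    fun x => ENNReal.ofReal (1 / x ^ 2)).map Real.toNNReal

/-- The law of `n` independent bids drawn from the equal revenue distribution. -/
def equalRevenueBids (n : ℕ) : Measure (Fin n → ℝ≥0) :=
  Measure.pi fun _ => equalRevenue

/-- A deterministic online digital-goods auction. It decides on the arriving bidder from the list
`h` of the earlier bids, in order of arrival, and the arriving bid `x`; the total number of bidders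
is not known to it. -/
structure DetOnlineAuction where
  served : List ℝ≥0 → ℝ≥0 → Prop
  pay : List ℝ≥0 → ℝ≥0 → ℝ≥0
  pay_eq_zero : ∀ h x, ¬ served h x → pay h x = 0
  pay_le_bid : ∀ h x, pay h x ≤ x

open Classical in
/-- The utility of a bidder with private value `v` who bids `x` after the bids `h`. -/
def DetOnlineAuction.utility (A : DetOnlineAuction) (v : ℝ≥0) (h : List ℝ≥0) (x : ℝ≥0) : ℝ :=
  if A.served h x then (v : ℝ) - A.pay h x else 0

/-- Bidding the private value is a dominant strategy for every arriving bidder. -/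
def DetOnlineAuction.IsTruthful (A : DetOnlineAuction) : Prop :=
  ∀ (h : List ℝ≥0) (v x : ℝ≥0), A.utility v h x ≤ A.utility v h v

/-- The revenue when the bids arrive in the order `b 0, b 1, …`. -/
def DetOnlineAuction.revenue (A : DetOnlineAuction) {n : ℕ} (b : Fin n → ℝ≥0) : ℝ :=
  ∑ k : Fin n, (A.pay ((List.ofFn b).take k.val) (b k) : ℝ)

/-- A (universally) truthful randomized online auction. -/
structure TruthfulOnlineAuction where
  Ω : Type
  mΩ : MeasurableSpace Ω
  μ : Measure Ω
  isProb : IsProbabilityMeasure μ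
  det : Ω → DetOnlineAuction
  truthful : ∀ ω, (det ω).IsTruthful
  measurable_pay : ∀ h x, Measurable fun ω => (det ω).pay h x

/-- The expected revenue when the bidders arrive in a uniformly random order. -/
def TruthfulOnlineAuction.expRevenue (A : TruthfulOnlineAuction) {n : ℕ}
    (b : Fin n → ℝ≥0) : ℝ :=
  letI := A.mΩ
  (∑ σ : Equiv.Perm (Fin n), ∫ ω, (A.det ω).revenue (b ∘ σ) ∂A.μ) / (n.factorial : ℝ)

/-- The online auction has competitive ratio `l` against `F⁽²⁾`, for every number of bidders. -/
def TruthfulOnlineAuction.IsCompetitive (A : TruthfulOnlineAuction) (l : ℝ) : Prop :=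
  0 < l ∧ ∀ (n : ℕ) (b : Fin n → ℝ≥0), (fixedPriceBenchmark b : ℝ) / l ≤ A.expRevenue b

end

section Scaling

open Function Filter Topology

variable {ι κ : Type*} [Fintype ι] [Fintype κ] [DecidableEq κ]

/-- Iterative scaling: the shares `f c * a i c / ∑ j, a j c` of the value `f c` are scaled down
along every line on which they exceed the capacity one. -/
noncomputable def scaling (q : ι → ℝ) (f : (κ → ι) → ℝ) : ℕ → κ → (κ → ι) → ℝ
  | 0 => fun _ _ => 1
  | t + 1 => fun i c => (max 1 (∑ x, q x *
      (f (update c i x) / ∑ j, scaling q f t j (update c i x))))⁻¹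

variable {q : ι → ℝ} {f : (κ → ι) → ℝ}

lemma scaling_pos (t : ℕ) (i : κ) (c : κ → ι) : 0 < scaling q f t i c := by
  cases t with
  | zero => simp [scaling]
  | succ t => exact inv_pos.2 (lt_max_of_lt_left one_pos)

lemma scaling_update (t : ℕ) (i : κ) (c : κ → ι) (x : ι) :
    scaling q f t i (update c i x) = scaling q f t i c := by
  cases t <;> simp [scaling]

lemma scaling_succ (t : ℕ) (i : κ) (c : κ → ι) : scaling q f (t + 1) i c =
    (max 1 (∑ x, q x * (f (update c i x) / ∑ j, scaling q f t j (update c i x))))⁻¹ := rfl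

lemma scaling_succ_le (hq : ∀ x, 0 < q x) (hf : ∀ c, 0 ≤ f c) (t : ℕ) (i : κ) (c : κ → ι) :
    scaling q f (t + 1) i c ≤ scaling q f t i c := by
  have : Nonempty κ := ⟨i⟩
  induction t generalizing i c with
  | zero => exact inv_le_one_of_one_le₀ (le_max_left _ _)
  | succ t ih =>
    rw [scaling_succ (t + 1), scaling_succ t]
    refine inv_anti₀ (lt_max_of_lt_left one_pos) (max_le_max le_rfl ?_)
    refine Finset.sum_le_sum fun x _ => mul_le_mul_of_nonneg_left ?_ (hq x).le
    exact div_le_div_of_nonneg_left (hf _)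
      (Finset.sum_pos (fun j _ => scaling_pos _ _ _) Finset.univ_nonempty)
      (Finset.sum_le_sum fun j _ => ih j _)

lemma scaling_antitone [LinearOrder ι] (hq : ∀ x, 0 < q x) (hf : ∀ c, 0 ≤ f c)
    (hm : Monotone f) (t : ℕ) (i : κ) : Antitone (scaling q f t i) := by
  have : Nonempty κ := ⟨i⟩
  induction t generalizing i with
  | zero => exact fun _ _ _ => le_rfl
  | succ t ih =>
    intro c d hcd
    rw [scaling]
    refine inv_anti₀ (lt_max_of_lt_left one_pos) (max_le_max le_rfl ?_)
    refine Finset.sum_le_sum fun x _ => mul_le_mul_of_nonneg_left ?_ (hq x).le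
    have hu : update c i x ≤ update d i x := update_le_update_iff.2 ⟨le_rfl, fun j _ => hcd j⟩
    exact div_le_div₀ (hf _) (hm hu)
      (Finset.sum_pos (fun j _ => scaling_pos _ _ _) Finset.univ_nonempty)
      (Finset.sum_le_sum fun j _ => ih j hu)

lemma scaling_succ_mul_le (t : ℕ) (i : κ) (c : κ → ι) :
    scaling q f (t + 1) i c *
      ∑ x, q x * (f (update c i x) / ∑ j, scaling q f t j (update c i x)) ≤ 1 := by
  have h : (0 : ℝ) < max 1 (∑ x, q x *
      (f (update c i x) / ∑ j, scaling q f t j (update c i x))) := lt_max_of_lt_left one_pos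
  rw [scaling, inv_mul_le_iff₀ h, mul_one]
  exact le_max_right _ _

/-- Summation over all cells, and summation along the lines in direction `i`. -/
lemma sum_prod_mul_sum_update (q : ι → ℝ) (h : (κ → ι) → ℝ) (i : κ) :
    ∑ c, (∏ k, q (c k)) * ∑ x, q x * h (update c i x) =
      (∑ x, q x) * ∑ c, (∏ k, q (c k)) * h c := by
  have e : ∀ (c : κ → ι) x, (∏ k, q (c k)) * q x = (∏ k, q (update c i x k)) * q (c i) := by
    intro c x
    rw [← Finset.mul_prod_erase _ _ (Finset.mem_univ i),
      ← Finset.mul_prod_erase _ (fun k => q (update c i x k)) (Finset.mem_univ i)]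
    have : ∏ k ∈ Finset.univ.erase i, q (update c i x k) = ∏ k ∈ Finset.univ.erase i, q (c k) :=
      Finset.prod_congr rfl fun k hk => by rw [update_of_ne (Finset.ne_of_mem_erase hk)]
    rw [this, update_self]
    ring
  let φ : (κ → ι) × ι ≃ (κ → ι) × ι :=
    { toFun := fun z => (update z.1 i z.2, z.1 i)
      invFun := fun z => (update z.1 i z.2, z.1 i)
      left_inv := fun z => by simp
      right_inv := fun z => by simp }
  calc ∑ c, (∏ k, q (c k)) * ∑ x, q x * h (update c i x)
      = ∑ z : (κ → ι) × ι, (∏ k, q (update z.1 i z.2 k)) * q (z.1 i) * h (update z.1 i z.2) := by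
        rw [Fintype.sum_prod_type]
        refine Finset.sum_congr rfl fun c _ => ?_
        rw [Finset.mul_sum]
        refine Finset.sum_congr rfl fun x _ => ?_
        rw [← mul_assoc, e]
    _ = ∑ z : (κ → ι) × ι, (∏ k, q (z.1 k)) * q z.2 * h z.1 :=
        Fintype.sum_equiv φ _ _ fun z => rfl
    _ = _ := by
        rw [Fintype.sum_prod_type, Finset.mul_sum]
        refine Finset.sum_congr rfl fun c _ => ?_
        rw [Finset.sum_mul]
        exact Finset.sum_congr rfl fun x _ => by ring

/-- A monotone function on a finite product of chains is a sum of functions, the `i`-th monotone in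
the `i`-th coordinate and of total mass at most one on every line in direction `i`, as soon as it
has small mass on upper sets. -/
theorem exists_monotone_decomposition [LinearOrder ι] [OrderTop ι] [Nonempty κ]
    (hq : ∀ x, 0 < q x) (hf : ∀ c, 0 ≤ f c) (hm : Monotone f)
    (hD : ∀ D : Set (κ → ι), IsUpperSet D → D.Nonempty →
      (∑ x, q x) * ∑ c, (∏ k, q (c k)) * D.indicator f c <
        ∑ i, ∑ c, (∏ k, q (c k)) * D.indicator 1 (update c i ⊤)) :
    ∃ R : κ → (κ → ι) → ℝ, (∀ i c, 0 ≤ R i c) ∧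
      (∀ i c x y, x ≤ y → R i (update c i x) ≤ R i (update c i y)) ∧
      (∀ c, ∑ i, R i c = f c) ∧ ∀ i c, ∑ x, q x * R i (update c i x) ≤ 1 := by
  classical
  set a := scaling q f with ha
  have hpos : ∀ t i c, 0 < a t i c := fun t i c => scaling_pos t i c
  have hanti : ∀ i c, Antitone fun t => a t i c := fun i c =>
    antitone_nat_of_succ_le fun t => scaling_succ_le hq hf t i c
  have hspos : ∀ t c, 0 < ∑ j, a t j c := fun t c =>
    Finset.sum_pos (fun j _ => hpos t j c) Finset.univ_nonempty
  choose A hA using fun i c => (⟨_, tendsto_atTop_ciInf (hanti i c)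
    ⟨0, by rintro _ ⟨t, rfl⟩; exact (hpos t i c).le⟩⟩ : ∃ l, Tendsto (fun t => a t i c) atTop (𝓝 l))
  have hA0 : ∀ i c, 0 ≤ A i c := fun i c => ge_of_tendsto' (hA i c) fun t => (hpos t i c).le
  have hAle : ∀ t i c, A i c ≤ a t i c := fun t i c => (hanti i c).le_of_tendsto (hA i c) t
  have hAanti : ∀ i, Antitone (A i) := fun i c d h =>
    le_of_tendsto_of_tendsto' (hA i d) (hA i c) fun t => scaling_antitone hq hf hm t i h
  have hAup : ∀ i c x, A i (update c i x) = A i c := fun i c x =>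
    tendsto_nhds_unique (hA i _) (by simpa only [ha, scaling_update] using hA i c)
  let D : Set (κ → ι) := {c | 0 < f c ∧ ∀ j, A j c = 0}
  have hDup : IsUpperSet D := fun c d hcd hc => ⟨hc.1.trans_le (hm hcd), fun j =>
    le_antisymm ((hAanti j hcd).trans (hc.2 j).le) (hA0 j d)⟩
  by_cases hne : D.Nonempty
  · exfalso
    have hlt := hD D hDup hne
    let M : ℕ → (κ → ι) → ℝ := fun t c => f c / ∑ j, a t j c
    have hM0 : ∀ t c, 0 ≤ M t c := fun t c => div_nonneg (hf c) (hspos t c).le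
    let e : ℕ → κ → (κ → ι) → ℝ := fun t i c =>
      a t i c * ∑ x, q x * Dᶜ.indicator (M t) (update c i x)
    have hMb : ∀ c ∉ D, ∃ B, ∀ t, M t c ≤ B := by
      intro c hc
      by_cases h0 : f c = 0
      · exact ⟨0, fun t => by simp [M, h0]⟩
      · have : ∃ j, A j c ≠ 0 := by
          by_contra! h
          exact hc ⟨lt_of_le_of_ne (hf c) (Ne.symm h0), h⟩
        obtain ⟨j, hj⟩ := this
        have hj' : 0 < A j c := lt_of_le_of_ne (hA0 j c) (Ne.symm hj)
        refine ⟨f c / A j c, fun t => div_le_div_of_nonneg_left (hf c) hj' ?_⟩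
        exact (hAle t j c).trans
          (Finset.single_le_sum (f := fun j => a t j c) (fun k _ => (hpos t k c).le)
            (Finset.mem_univ j))
    have hMb' : ∀ c, ∃ B, ∀ t, Dᶜ.indicator (M t) c ≤ B := by
      intro c
      by_cases hc : c ∈ D
      · exact ⟨0, fun t => by simp [hc]⟩
      · obtain ⟨B, hB⟩ := hMb c hc
        exact ⟨B, fun t => by simpa [hc] using hB t⟩
    choose B hB using hMb'
    have he0 : ∀ t i c, 0 ≤ e t i c := fun t i c => mul_nonneg (hpos t i c).le
      (Finset.sum_nonneg fun x _ => mul_nonneg (hq x).le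
        (Set.indicator_nonneg (fun c _ => hM0 t c) _))
    have he : ∀ i c, update c i ⊤ ∈ D → Tendsto (fun t => e t i c) atTop (𝓝 0) := by
      intro i c hc
      have h0 : A i c = 0 := by rw [← hAup i c ⊤]; exact hc.2 i
      have h1 : Tendsto (fun t => a t i c * ∑ x, q x * B (update c i x)) atTop (𝓝 0) := by
        have := (hA i c).mul_const (∑ x, q x * B (update c i x))
        rwa [h0, zero_mul] at this
      refine squeeze_zero (fun t => he0 t i c) (fun t => ?_) h1
      exact mul_le_mul_of_nonneg_left (Finset.sum_le_sum fun x _ =>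
        mul_le_mul_of_nonneg_left (hB _ t) (hq x).le) (hpos t i c).le
    have hev : ∀ i c, update c i ⊤ ∈ D → ∀ᶠ t in atTop,
        1 - e t i c ≤ a t i c * ∑ x, q x * D.indicator (M t) (update c i x) := by
      intro i c hc
      have h0 : A i c = 0 := by rw [← hAup i c ⊤]; exact hc.2 i
      have h1 : ∀ᶠ t in atTop, a (t + 1) i c < 1 :=
        ((hA i c).comp (tendsto_add_atTop_nat 1)).eventually_lt_const (by rw [h0]; exact one_pos)
      filter_upwards [h1] with t ht
      have hS : (1 : ℝ) ≤ a t i c * ∑ x, q x * M t (update c i x) := by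
        have h2 : a (t + 1) i c = (max 1 (∑ x, q x * M t (update c i x)))⁻¹ := rfl
        have h3 : 1 < ∑ x, q x * M t (update c i x) := by
          by_contra! h
          rw [h2, max_eq_left h, inv_one] at ht
          exact lt_irrefl _ ht
        rw [max_eq_right h3.le] at h2
        have h4 : a (t + 1) i c ≤ a t i c := hanti i c (Nat.le_succ t)
        rw [h2, inv_le_iff_one_le_mul₀ (one_pos.trans h3)] at h4
        exact h4
      have hsplit : ∑ x, q x * M t (update c i x) =
          ∑ x, q x * D.indicator (M t) (update c i x) +
            ∑ x, q x * Dᶜ.indicator (M t) (update c i x) := by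
        rw [← Finset.sum_add_distrib]
        refine Finset.sum_congr rfl fun x _ => ?_
        rw [← mul_add, ← Pi.add_apply (D.indicator (M t)), Set.indicator_self_add_compl]
      rw [hsplit, mul_add] at hS
      simp only [e]
      linarith
    have hp : ∀ c : κ → ι, 0 < ∏ k, q (c k) := fun c => Finset.prod_pos fun k _ => hq _
    have hkey : ∀ t, (∑ x, q x) * ∑ c, (∏ k, q (c k)) * D.indicator f c =
        ∑ i, ∑ c, (∏ k, q (c k)) *
          (a t i c * ∑ x, q x * D.indicator (M t) (update c i x)) := by
      intro t
      have h1 : ∀ c, D.indicator f c = ∑ i, a t i c * D.indicator (M t) c := by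
        intro c
        rw [← Finset.sum_mul]
        by_cases hc : c ∈ D
        · simp only [hc, Set.indicator_of_mem, M]
          rw [mul_div_cancel₀ _ (hspos t c).ne']
        · simp [hc]
      simp_rw [h1, Finset.mul_sum (s := Finset.univ (α := κ))]
      rw [Finset.sum_comm, Finset.mul_sum]
      refine Finset.sum_congr rfl fun i _ => ?_
      rw [← sum_prod_mul_sum_update q (fun c => a t i c * D.indicator (M t) c) i]
      refine Finset.sum_congr rfl fun c _ => ?_
      rw [Finset.mul_sum (a := a t i c)]
      congr 1
      refine Finset.sum_congr rfl fun x _ => ?_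
      rw [show a t i (update c i x) = a t i c from scaling_update t i c x]
      ring
    have hlim : Tendsto (fun t => ∑ i, ∑ c, (∏ k, q (c k)) *
        (D.indicator 1 (update c i ⊤) * (1 - e t i c))) atTop
        (𝓝 (∑ i, ∑ c, (∏ k, q (c k)) * D.indicator 1 (update c i ⊤))) := by
      refine tendsto_finsetSum _ fun i _ => tendsto_finsetSum _ fun c _ =>
        Tendsto.const_mul _ ?_
      by_cases hc : update c i ⊤ ∈ D
      · simpa [hc] using (he i c hc).const_sub 1
      · simp [hc]
    refine absurd hlt (not_lt.2 (le_of_tendsto hlim ?_))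
    have hall : ∀ᶠ t in atTop, ∀ i c, update c i ⊤ ∈ D →
        1 - e t i c ≤ a t i c * ∑ x, q x * D.indicator (M t) (update c i x) := by
      rw [eventually_all]
      intro i
      rw [eventually_all]
      intro c
      by_cases hc : update c i ⊤ ∈ D
      · filter_upwards [hev i c hc] with t ht _ using ht
      · exact Eventually.of_forall fun t h => absurd h hc
    filter_upwards [hall] with t ht
    rw [hkey t]
    refine Finset.sum_le_sum fun i _ => Finset.sum_le_sum fun c _ =>
      mul_le_mul_of_nonneg_left ?_ (hp c).le
    by_cases hc : update c i ⊤ ∈ D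
    · simpa [hc] using ht i c hc
    · simp only [hc, not_false_eq_true, Set.indicator_of_notMem, zero_mul]
      exact mul_nonneg (hpos t i c).le (Finset.sum_nonneg fun x _ => mul_nonneg (hq x).le
        (Set.indicator_nonneg (fun c _ => hM0 t c) _))
  · have hsum : ∀ c, f c = 0 ∨ 0 < ∑ j, A j c := by
      intro c
      by_contra! h
      have h2 : ∑ j, A j c = 0 := le_antisymm h.2 (Finset.sum_nonneg fun j _ => hA0 j c)
      rw [Finset.sum_eq_zero_iff_of_nonneg fun j _ => hA0 j c] at h2
      exact hne ⟨c, lt_of_le_of_ne (hf c) (Ne.symm h.1), fun j => h2 j (Finset.mem_univ j)⟩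
    have hlimM : ∀ c, Tendsto (fun t => f c / ∑ j, a t j c) atTop (𝓝 (f c / ∑ j, A j c)) := by
      intro c
      rcases hsum c with h | h
      · simp [h]
      · exact Tendsto.div tendsto_const_nhds (tendsto_finsetSum _ fun j _ => hA j c) h.ne'
    have hmono : ∀ c d, c ≤ d → f c / ∑ j, A j c ≤ f d / ∑ j, A j d := fun c d hcd =>
      le_of_tendsto_of_tendsto' (hlimM c) (hlimM d) fun t =>
        div_le_div₀ (hf d) (hm hcd) (hspos t d)
          (Finset.sum_le_sum fun j _ => scaling_antitone hq hf hm t j hcd)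
    refine ⟨fun i c => A i c * (f c / ∑ j, A j c), fun i c => mul_nonneg (hA0 i c)
      (div_nonneg (hf c) (Finset.sum_nonneg fun j _ => hA0 j c)), fun i c x y hxy => ?_,
      fun c => ?_, fun i c => ?_⟩
    · simp only [hAup]
      exact mul_le_mul_of_nonneg_left
        (hmono _ _ (update_le_update_iff.2 ⟨hxy, fun j _ => le_rfl⟩)) (hA0 i c)
    · rw [← Finset.sum_mul]
      rcases hsum c with h | h
      · simp [h]
      · rw [mul_div_cancel₀ _ h.ne']
    · have h1 : Tendsto (fun t => a (t + 1) i c *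
          ∑ x, q x * (f (update c i x) / ∑ j, a t j (update c i x))) atTop
          (𝓝 (A i c * ∑ x, q x * (f (update c i x) / ∑ j, A j (update c i x)))) :=
        ((hA i c).comp (tendsto_add_atTop_nat 1)).mul
          (tendsto_finsetSum _ fun x _ => (hlimM _).const_mul _)
      have h2 := le_of_tendsto' h1 fun t => scaling_succ_mul_le t i c
      refine le_of_eq_of_le ?_ h2
      rw [Finset.mul_sum]
      exact Finset.sum_congr rfl fun x _ => by simp only [hAup]; ring

end Scaling

section Cube

open Set Function
open scoped ENNReal

/-- The half-open cube `(0, t]ⁿ`. -/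
def cube (n : ℕ) (t : ℝ) : Set (Fin n → ℝ) := Set.pi univ fun _ => Ioc 0 t

lemma mem_cube {n : ℕ} {t : ℝ} {y : Fin n → ℝ} : y ∈ cube n t ↔ ∀ i, 0 < y i ∧ y i ≤ t := by
  simp [cube]

lemma measurableSet_cube (n : ℕ) (t : ℝ) : MeasurableSet (cube n t) :=
  MeasurableSet.univ_pi fun _ => measurableSet_Ioc

lemma volume_cube (n : ℕ) (t : ℝ) : volume (cube n t) = ENNReal.ofReal t ^ n := by
  simp [cube, volume_pi_pi]

lemma insertNth_mem_cube {n : ℕ} {t s : ℝ} {v : Fin n → ℝ} (i : Fin (n + 1)) :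
    i.insertNth s v ∈ cube (n + 1) t ↔ s ∈ Ioc 0 t ∧ v ∈ cube n t := by
  rw [mem_cube, mem_cube, Fin.forall_iff_succAbove i]
  simp

lemma volume_coord_eq {n : ℕ} {i j : Fin n} (h : i ≠ j) :
    volume {y : Fin n → ℝ | y i = y j} = 0 := by
  let L : (Fin n → ℝ) →ₗ[ℝ] ℝ := LinearMap.proj (R := ℝ) (φ := fun _ => ℝ) i - LinearMap.proj j
  have hL : {y : Fin n → ℝ | y i = y j} = (LinearMap.ker L : Set (Fin n → ℝ)) := by
    ext y
    simp [L, sub_eq_zero]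
  rw [hL]
  refine Measure.addHaar_submodule _ _ fun h1 => ?_
  have h2 : Pi.single i (1 : ℝ) ∈ LinearMap.ker L := h1 ▸ Submodule.mem_top
  simp [L, h.symm] at h2

lemma ae_injective (n : ℕ) : ∀ᵐ y : Fin n → ℝ, Injective y := by
  have : ∀ᵐ y : Fin n → ℝ, ∀ i j, i ≠ j → y i ≠ y j := by
    simp_rw [ae_all_iff]
    exact fun i j hij => measure_eq_zero_iff_ae_notMem.1 (volume_coord_eq hij)
  filter_upwards [this] with y hy i j hij
  by_contra h
  exact hy i j h hij

lemma indicator_eq_indicator_of_iff {α β : Type*} {A : Set α} {B : Set β} {F : α → ℝ≥0∞}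
    {G : β → ℝ≥0∞} {x : α} {y : β} (h : x ∈ A ↔ y ∈ B) (hF : F x = G y) :
    A.indicator F x = B.indicator G y := by
  by_cases hx : x ∈ A
  · rw [indicator_of_mem hx, indicator_of_mem (h.1 hx), hF]
  · rw [indicator_of_notMem hx, indicator_of_notMem (fun hy => hx (h.2 hy))]

/-- Splitting an integral over `ℝⁿ` according to the position of the largest coordinate, or of the
smallest one. -/
lemma lintegral_eq_sum_indicator {n : ℕ} (S : Fin (n + 1) → Set (Fin (n + 1) → ℝ))
    (hS : ∀ i, MeasurableSet (S i)) (hex : ∀ y, Injective y → ∃! i, y ∈ S i)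
    {F : (Fin (n + 1) → ℝ) → ℝ≥0∞} (hF : Measurable F) :
    ∫⁻ y, F y = ∑ i, ∫⁻ y, (S i).indicator F y := by
  rw [← lintegral_finsetSum _ fun i _ => hF.indicator (hS i)]
  refine lintegral_congr_ae ?_
  filter_upwards [ae_injective (n + 1)] with y hy
  obtain ⟨i, hi, hu⟩ := hex y hy
  rw [Finset.sum_eq_single i]
  · simp [hi]
  · intro j _ hj
    exact indicator_of_notMem (fun h => hj (hu j h)) _
  · simp

lemma lintegral_eq_insertNth {n : ℕ} (i : Fin (n + 1)) {F : (Fin (n + 1) → ℝ) → ℝ≥0∞}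
    (hF : Measurable F) : ∫⁻ y, F y = ∫⁻ s, ∫⁻ v, F (i.insertNth s v) := by
  have h := (volume_preserving_piFinSuccAbove (fun _ : Fin (n + 1) => ℝ) i).symm
  rw [← h.lintegral_comp hF, Measure.volume_eq_prod, lintegral_prod]
  · rfl
  · exact (hF.comp (MeasurableEquiv.measurable _)).aemeasurable

lemma measurable_insertNth {n : ℕ} (i : Fin (n + 1)) :
    Measurable fun z : ℝ × (Fin n → ℝ) => (i.insertNth z.1 z.2 : Fin (n + 1) → ℝ) :=
  (MeasurableEquiv.piFinSuccAbove (fun _ : Fin (n + 1) => ℝ) i).symm.measurable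

lemma lintegral_cube_max {n : ℕ} (t : ℝ) {F : (Fin (n + 1) → ℝ) → ℝ≥0∞} (hF : Measurable F) :
    ∫⁻ y in cube (n + 1) t, F y =
      ∑ i : Fin (n + 1), ∫⁻ s in Ioc 0 t, ∫⁻ v in cube n s, F (i.insertNth s v) := by
  rw [← lintegral_indicator (measurableSet_cube _ _),
    lintegral_eq_sum_indicator (fun i => {y | ∀ j, y j ≤ y i}) (fun i => ?_) (fun y hy => ?_)
      (hF.indicator (measurableSet_cube _ _))]
  · refine Finset.sum_congr rfl fun i _ => ?_
    rw [lintegral_eq_insertNth i]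
    · rw [← lintegral_indicator measurableSet_Ioc]
      refine lintegral_congr fun s => ?_
      by_cases hs : s ∈ Ioc 0 t
      · rw [indicator_of_mem hs, ← lintegral_indicator (measurableSet_cube _ _)]
        refine lintegral_congr fun v => ?_
        rw [indicator_indicator]
        refine indicator_eq_indicator_of_iff ?_ rfl
        rw [mem_inter_iff, mem_ofPred_eq, insertNth_mem_cube, Fin.forall_iff_succAbove i]
        simp only [Fin.insertNth_apply_same, Fin.insertNth_apply_succAbove, le_refl, true_and,
          mem_cube]
        exact ⟨fun h j => ⟨(h.2.2 j).1, h.1 j⟩, fun h =>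
          ⟨fun j => (h j).2, hs, fun j => ⟨(h j).1, (h j).2.trans hs.2⟩⟩⟩
      · simp [hs, indicator_apply, insertNth_mem_cube]
    · refine (hF.indicator (measurableSet_cube _ _)).indicator ?_
      simp only [ofPred_forall]
      exact MeasurableSet.iInter fun j =>
        measurableSet_le (measurable_pi_apply j) (measurable_pi_apply i)
  · simp only [ofPred_forall]
    exact MeasurableSet.iInter fun j =>
      measurableSet_le (measurable_pi_apply j) (measurable_pi_apply i)
  · obtain ⟨i, hi⟩ := Finite.exists_max y
    exact ⟨i, hi, fun j hj => hy (le_antisymm (hi j) (hj i))⟩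

lemma lintegral_cube_min {n : ℕ} {F : (Fin (n + 1) → ℝ) → ℝ≥0∞} (hF : Measurable F) :
    ∫⁻ y in cube (n + 1) 1, F y =
      ∑ i : Fin (n + 1), ∫⁻ v in cube n 1, ∫⁻ s in {s | s ∈ Ioc 0 1 ∧ ∀ j, s ≤ v j},
        F (i.insertNth s v) := by
  rw [← lintegral_indicator (measurableSet_cube _ _),
    lintegral_eq_sum_indicator (fun i => {y | ∀ j, y i ≤ y j}) (fun i => ?_) (fun y hy => ?_)
      (hF.indicator (measurableSet_cube _ _))]
  · refine Finset.sum_congr rfl fun i _ => ?_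
    have hm : Measurable ({y : Fin (n + 1) → ℝ | ∀ j, y i ≤ y j}.indicator
        ((cube (n + 1) 1).indicator F)) := by
      refine (hF.indicator (measurableSet_cube _ _)).indicator ?_
      simp only [ofPred_forall]
      exact MeasurableSet.iInter fun j =>
        measurableSet_le (measurable_pi_apply i) (measurable_pi_apply j)
    rw [lintegral_eq_insertNth i hm, lintegral_lintegral_swap]
    · rw [← lintegral_indicator (measurableSet_cube _ _)]
      refine lintegral_congr fun v => ?_
      by_cases hv : v ∈ cube n 1
      · have hms : MeasurableSet {s | s ∈ Ioc (0 : ℝ) 1 ∧ ∀ j, s ≤ v j} := by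
          have : {s | s ∈ Ioc (0 : ℝ) 1 ∧ ∀ j, s ≤ v j} = Ioc 0 1 ∩ ⋂ j, Iic (v j) := by
            ext s
            simp
          rw [this]
          exact measurableSet_Ioc.inter (MeasurableSet.iInter fun j => measurableSet_Iic)
        rw [indicator_of_mem hv, ← lintegral_indicator hms]
        refine lintegral_congr fun s => ?_
        rw [indicator_indicator]
        refine indicator_eq_indicator_of_iff ?_ rfl
        rw [mem_inter_iff, mem_ofPred_eq, insertNth_mem_cube, Fin.forall_iff_succAbove i]
        simp only [Fin.insertNth_apply_same, Fin.insertNth_apply_succAbove, le_refl, true_and,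
          mem_ofPred_eq, hv, and_true]
        exact and_comm
      · simp [hv, indicator_apply, insertNth_mem_cube]
    · exact (hm.comp (measurable_insertNth i)).aemeasurable
  · simp only [ofPred_forall]
    exact MeasurableSet.iInter fun j =>
      measurableSet_le (measurable_pi_apply i) (measurable_pi_apply j)
  · obtain ⟨i, hi⟩ := Finite.exists_min y
    exact ⟨i, hi, fun j hj => hy (le_antisymm (hj i) (hi j))⟩

lemma lintegral_cube_smul {n : ℕ} {s : ℝ} (hs : 0 < s) (F : (Fin n → ℝ) → ℝ≥0∞) :
    ∫⁻ v in cube n s, F v = ENNReal.ofReal (s ^ n) * ∫⁻ v in cube n 1, F (s • v) := by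
  have h := Measure.map_addHaar_smul (volume : Measure (Fin n → ℝ)) hs.ne'
  have he : MeasurableEmbedding fun v : Fin n → ℝ => s • v :=
    (Homeomorph.smulOfNeZero s hs.ne').measurableEmbedding
  have h1 : ∫⁻ v in cube n 1, F (s • v) =
      ∫⁻ v, (cube n s).indicator F v ∂(Measure.map (s • ·) volume) := by
    rw [he.lintegral_map, ← lintegral_indicator (measurableSet_cube _ _)]
    refine lintegral_congr fun v => ?_
    refine indicator_eq_indicator_of_iff ?_ rfl
    simp only [mem_cube, Pi.smul_apply, smul_eq_mul]
    refine forall_congr' fun i => and_congr ?_ ?_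
    · rw [mul_pos_iff_of_pos_left hs]
    · rw [mul_le_iff_le_one_right hs]
  rw [h1, h, lintegral_smul_measure, lintegral_indicator (measurableSet_cube _ _)]
  have hp : 0 < s ^ n := pow_pos hs n
  rw [Module.finrank_fin_fun, abs_of_pos (inv_pos.2 hp), smul_eq_mul, ← mul_assoc,
    ← ENNReal.ofReal_mul hp.le, mul_inv_cancel₀ hp.ne', ENNReal.ofReal_one, one_mul]

lemma ENNReal.mul_add_mul_le_of_le {a b c d : ℝ≥0∞} (hab : a ≤ b) (hcd : c ≤ d) :
    a * d + b * c ≤ a * c + b * d := by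
  obtain ⟨e, rfl⟩ := exists_add_of_le hcd
  rw [mul_add, mul_add, add_assoc, add_comm (a * e), ← add_assoc, ← add_assoc]
  gcongr

/-- Chebyshev's integral inequality. -/
lemma lintegral_mul_le_of_monotoneOn_of_antitoneOn {μ : Measure ℝ} [SFinite μ] {S : Set ℝ}
    {W Φ : ℝ → ℝ≥0∞} (hS : ∀ᵐ s ∂μ, s ∈ S) (hWm : Measurable W) (hΦm : Measurable Φ)
    (hW : MonotoneOn W S) (hΦ : AntitoneOn Φ S) :
    μ univ * ∫⁻ s, W s * Φ s ∂μ ≤ (∫⁻ s, W s ∂μ) * ∫⁻ s, Φ s ∂μ := by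
  have h : ∫⁻ s, ∫⁻ t, (W s * Φ s + W t * Φ t) ∂μ ∂μ ≤
      ∫⁻ s, ∫⁻ t, (W s * Φ t + W t * Φ s) ∂μ ∂μ := by
    refine lintegral_mono_ae ?_
    filter_upwards [hS] with s hs
    refine lintegral_mono_ae ?_
    filter_upwards [hS] with t ht
    rcases le_total s t with hst | hst
    · exact ENNReal.mul_add_mul_le_of_le (hW hs ht hst) (hΦ hs ht hst)
    · rw [add_comm, add_comm (W s * Φ t)]
      exact ENNReal.mul_add_mul_le_of_le (hW ht hs hst) (hΦ ht hs hst)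
  have hWΦ : Measurable fun s => W s * Φ s := hWm.mul hΦm
  have h1 : ∀ s, ∫⁻ t, (W s * Φ s + W t * Φ t) ∂μ =
      W s * Φ s * μ univ + ∫⁻ t, W t * Φ t ∂μ := fun s => by
    rw [lintegral_add_left measurable_const, lintegral_const]
  have h2 : ∀ s, ∫⁻ t, (W s * Φ t + W t * Φ s) ∂μ =
      W s * ∫⁻ t, Φ t ∂μ + (∫⁻ t, W t ∂μ) * Φ s := fun s => by
    rw [lintegral_add_left (hΦm.const_mul _), lintegral_const_mul _ hΦm,
      lintegral_mul_const _ hWm]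
  simp only [h1, h2] at h
  rw [lintegral_add_left (hWΦ.mul_const _), lintegral_mul_const _ hWΦ,
    lintegral_const, lintegral_add_left (hWm.mul_const _), lintegral_mul_const _ hWm,
    lintegral_const_mul _ hΦm, mul_comm _ (μ univ), ← two_mul, ← two_mul] at h
  exact (ENNReal.mul_le_mul_iff_right two_ne_zero ENNReal.ofNat_ne_top).1 h

/-- A function on `(0, 1]ⁿ` is ratio monotone if it does not decrease when all coordinates grow,
the smaller ones by the larger factors, as long as their order is kept. -/
def RatioMonotone {n : ℕ} (w : (Fin n → ℝ) → ℝ≥0∞) : Prop :=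
  ∀ y y' : Fin n → ℝ, (∀ i, 0 < y i) → y ≤ y' → (∀ i, y' i ≤ 1) →
    (∀ i j, y i ≤ y j → y' i ≤ y' j ∧ y' j * y i ≤ y' i * y j) → w y ≤ w y'

lemma RatioMonotone.lintegral_cons {n : ℕ} {w : (Fin (n + 1) → ℝ) → ℝ≥0∞} (hw : RatioMonotone w) :
    MonotoneOn (fun s => ∫⁻ v in cube n 1, w (Fin.cons s (s • v))) (Ioc 0 1) := by
  intro s hs s' hs' hss
  refine setLIntegral_mono' (measurableSet_cube _ _) fun v hv => ?_
  rw [mem_cube] at hv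
  have e : ∀ r : ℝ, (Fin.cons r (r • v) : Fin (n + 1) → ℝ) =
      fun i => r * (Fin.cons 1 v : Fin (n + 1) → ℝ) i := by
    intro r
    funext i
    refine Fin.cases ?_ (fun j => ?_) i <;> simp
  have hp : ∀ i, 0 < (Fin.cons 1 v : Fin (n + 1) → ℝ) i ∧ (Fin.cons 1 v : Fin (n + 1) → ℝ) i ≤ 1 :=
    fun i => by
      refine Fin.cases ?_ (fun j => ?_) i
      · simp
      · simpa using hv j
  rw [e, e]
  refine hw _ _ (fun i => mul_pos hs.1 (hp i).1) (fun i => mul_le_mul_of_nonneg_right hss (hp i).1.le)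
    (fun i => mul_le_one₀ hs'.2 (hp i).1.le (hp i).2) fun i j hij => ?_
  have hij' := le_of_mul_le_mul_left hij hs.1
  exact ⟨mul_le_mul_of_nonneg_left hij' hs'.1.le, le_of_eq (by ring)⟩

lemma RatioMonotone.cons {n : ℕ} {w : (Fin (n + 1) → ℝ) → ℝ≥0∞} (hw : RatioMonotone w) {s : ℝ}
    (hs : s ∈ Ioc 0 1) : RatioMonotone fun v : Fin n → ℝ => w (Fin.cons s (s • v)) := by
  intro v v' hv hvv hv' h
  have hs0 := hs.1
  refine hw _ _ (fun i => ?_) (fun i => ?_) (fun i => ?_) fun i j => ?_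
  · refine Fin.cases ?_ (fun j => ?_) i
    · simpa using hs0
    · simpa using mul_pos hs0 (hv j)
  · refine Fin.cases ?_ (fun j => ?_) i
    · simp
    · simpa using mul_le_mul_of_nonneg_left (hvv j) hs0.le
  · refine Fin.cases ?_ (fun j => ?_) i
    · simpa using hs.2
    · simpa using mul_le_one₀ hs.2 ((hv j).le.trans (hvv j)) (hv' j)
  · refine Fin.cases ?_ (fun i => ?_) i <;> refine Fin.cases ?_ (fun j => ?_) j
    · simp
    · simp only [Fin.cons_zero, Fin.cons_succ, Pi.smul_apply, smul_eq_mul]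
      intro h1
      have h2 : 1 ≤ v j := by
        by_contra! h2
        nlinarith
      have h3 : v' j = 1 := le_antisymm (hv' j) (h2.trans (hvv j))
      rw [h3]
      constructor
      · simp
      · nlinarith [mul_pos hs0 hs0]
    · simp only [Fin.cons_zero, Fin.cons_succ, Pi.smul_apply, smul_eq_mul]
      intro _
      constructor
      · nlinarith [hv' i]
      · nlinarith [mul_pos hs0 hs0, hvv i]
    · simp only [Fin.cons_succ, Pi.smul_apply, smul_eq_mul]
      intro h1
      obtain ⟨h2, h3⟩ := h i j (le_of_mul_le_mul_left h1 hs0)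
      exact ⟨mul_le_mul_of_nonneg_left h2 hs0.le, by nlinarith [mul_pos hs0 hs0]⟩

lemma cons_comp_perm {n : ℕ} {α : Type*} (s : α) (v : Fin n → α) (σ : Equiv.Perm (Fin n)) :
    (Fin.cons s (v ∘ σ) : Fin (n + 1) → α) =
      (Fin.cons s v : Fin (n + 1) → α) ∘ Equiv.Perm.decomposeFin.symm (0, σ) := by
  funext i
  refine Fin.cases ?_ (fun j => ?_) i <;> simp

lemma lintegral_pow_Ioc (n : ℕ) :
    ∫⁻ s in Ioc (0 : ℝ) 1, ENNReal.ofReal (s ^ n) = ((n : ℝ≥0∞) + 1)⁻¹ := by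
  rw [← ofReal_integral_eq_lintegral_ofReal, ← intervalIntegral.integral_of_le zero_le_one,
    integral_pow]
  · rw [show ((1 : ℝ) ^ (n + 1) - 0 ^ (n + 1)) / ((n : ℝ) + 1) = ((n + 1 : ℕ) : ℝ)⁻¹ by simp,
      ENNReal.ofReal_inv_of_pos (by positivity), ENNReal.ofReal_natCast]
    simp
  · exact (((continuous_pow n).intervalIntegrable 0 1).1)
  · filter_upwards [ae_restrict_mem measurableSet_Ioc] with s hs using pow_nonneg hs.1.le n

/-- Harris' inequality in ratio coordinates: on the unit cube a symmetric ratio monotone function and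
an antitone function are negatively correlated. -/
theorem lintegral_cube_mul_le {n : ℕ} {w φ : (Fin n → ℝ) → ℝ≥0∞} (hwm : Measurable w)
    (hφm : Measurable φ) (hsym : ∀ y (σ : Equiv.Perm (Fin n)), w (y ∘ σ) = w y)
    (hw : RatioMonotone w)
    (hφ : ∀ y y' : Fin n → ℝ, (∀ i, 0 < y i) → y ≤ y' → φ y' ≤ φ y) :
    ∫⁻ y in cube n 1, w y * φ y ≤ (∫⁻ y in cube n 1, w y) * ∫⁻ y in cube n 1, φ y := by
  induction n with
  | zero =>
    have h1 : volume (cube 0 1) = 1 := by rw [volume_cube]; simp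
    have h2 : ∀ F : (Fin 0 → ℝ) → ℝ≥0∞, ∫⁻ y in cube 0 1, F y = F 0 := by
      intro F
      rw [lintegral_congr fun y => congrArg F (Subsingleton.elim y 0), setLIntegral_const, h1,
        mul_one]
    rw [h2, h2, h2]
  | succ n ih =>
    have hins : ∀ (i : Fin (n + 1)) (s : ℝ) (v : Fin n → ℝ),
        w (i.insertNth s v) = w (Fin.cons s v) := by
      intro i s v
      rw [← Fin.cons_comp_cycleRange, hsym]
    let W : ℝ → ℝ≥0∞ := fun s => ∫⁻ v in cube n 1, w (Fin.cons s (s • v))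
    let Φ : Fin (n + 1) → ℝ → ℝ≥0∞ := fun i s => ∫⁻ v in cube n 1, φ (i.insertNth s (s • v))
    have hsm : Measurable fun z : ℝ × (Fin n → ℝ) => (z.1, z.1 • z.2) :=
      measurable_fst.prodMk (measurable_fst.smul measurable_snd)
    have hconsm : Measurable fun z : ℝ × (Fin n → ℝ) =>
        (Fin.cons z.1 (z.1 • z.2) : Fin (n + 1) → ℝ) := by
      have := (measurable_insertNth (0 : Fin (n + 1))).comp hsm
      simpa only [Fin.insertNth_zero', Function.comp_def] using this
    have hWm : Measurable W := Measurable.lintegral_prod_right' (f := fun z : ℝ × (Fin n → ℝ) =>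
      w (Fin.cons z.1 (z.1 • z.2))) (hwm.comp hconsm)
    have hΦm : ∀ i, Measurable (Φ i) := fun i =>
      Measurable.lintegral_prod_right' (f := fun z : ℝ × (Fin n → ℝ) =>
        φ (i.insertNth z.1 (z.1 • z.2))) (hφm.comp ((measurable_insertNth i).comp hsm))
    have hpow : Measurable fun s : ℝ => ENNReal.ofReal (s ^ n) := by fun_prop
    set μ : Measure ℝ :=
      (volume.restrict (Ioc (0 : ℝ) 1)).withDensity fun s => ENNReal.ofReal (s ^ n) with hμ
    have hμl : ∀ {G : ℝ → ℝ≥0∞}, Measurable G → ∫⁻ s, G s ∂μ =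
        ∫⁻ s in Ioc (0 : ℝ) 1, ENNReal.ofReal (s ^ n) * G s := fun hG => by
      rw [hμ, lintegral_withDensity_eq_lintegral_mul _ hpow hG]
      rfl
    have hμ1 : μ univ = ((n : ℝ≥0∞) + 1)⁻¹ := by
      rw [hμ, withDensity_apply _ MeasurableSet.univ, Measure.restrict_univ, lintegral_pow_Ioc]
    have hμS : ∀ᵐ s ∂μ, s ∈ Ioc (0 : ℝ) 1 :=
      (withDensity_absolutelyContinuous _ _).ae_le (ae_restrict_mem measurableSet_Ioc)
    have hI : ∀ F : (Fin (n + 1) → ℝ) → ℝ≥0∞, Measurable F → ∫⁻ y in cube (n + 1) 1, F y =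
        ∑ i : Fin (n + 1), ∫⁻ s in Ioc (0 : ℝ) 1, ENNReal.ofReal (s ^ n) *
          ∫⁻ v in cube n 1, F (i.insertNth s (s • v)) := by
      intro F hF
      rw [lintegral_cube_max 1 hF]
      refine Finset.sum_congr rfl fun i _ =>
        setLIntegral_congr_fun measurableSet_Ioc fun s hs => ?_
      exact lintegral_cube_smul hs.1 _
    have hIw : ∫⁻ y in cube (n + 1) 1, w y = ((n : ℝ≥0∞) + 1) * ∫⁻ s, W s ∂μ := by
      rw [hI w hwm, hμl hWm]
      simp only [hins]
      simp [W]
    have hIφ : ∫⁻ y in cube (n + 1) 1, φ y = ∑ i, ∫⁻ s, Φ i s ∂μ := by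
      rw [hI φ hφm]
      exact Finset.sum_congr rfl fun i _ => (hμl (hΦm i)).symm
    have hWmono : MonotoneOn W (Ioc 0 1) := hw.lintegral_cons
    have hΦanti : ∀ i, AntitoneOn (Φ i) (Ioc 0 1) := by
      intro i s hs s' hs' hss
      refine setLIntegral_mono' (measurableSet_cube _ _) fun v hv => ?_
      rw [mem_cube] at hv
      refine hφ _ _ (fun j => ?_) fun j => ?_
      · refine Fin.succAboveCases i ?_ (fun k => ?_) j
        · simpa using hs.1
        · simpa using mul_pos hs.1 (hv k).1
      · refine Fin.succAboveCases i ?_ (fun k => ?_) j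
        · simpa using hss
        · simpa using mul_le_mul_of_nonneg_right hss (hv k).1.le
    rw [hI (fun y => w y * φ y) (hwm.mul hφm), hIw, hIφ, Finset.mul_sum]
    refine Finset.sum_le_sum fun i _ => ?_
    calc ∫⁻ s in Ioc (0 : ℝ) 1, ENNReal.ofReal (s ^ n) *
          ∫⁻ v in cube n 1, w (i.insertNth s (s • v)) * φ (i.insertNth s (s • v))
        ≤ ∫⁻ s in Ioc (0 : ℝ) 1, ENNReal.ofReal (s ^ n) * (W s * Φ i s) := by
          refine setLIntegral_mono' measurableSet_Ioc fun s hs => mul_le_mul_right ?_ _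
          simp only [hins]
          refine ih (w := fun v => w (Fin.cons s (s • v)))
            (hwm.comp (hconsm.comp measurable_prodMk_left))
            (hφm.comp ((measurable_insertNth i).comp (hsm.comp measurable_prodMk_left)))
            (fun v σ => ?_) (hw.cons hs) fun v v' hv hvv => ?_
          · rw [show s • (v ∘ σ) = (s • v) ∘ σ from rfl, cons_comp_perm, hsym]
          · refine hφ _ _ (fun j => ?_) fun j => ?_
            · refine Fin.succAboveCases i ?_ (fun k => ?_) j
              · simpa using hs.1
              · simpa using mul_pos hs.1 (hv k)
            · refine Fin.succAboveCases i ?_ (fun k => ?_) j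
              · simp
              · simpa using mul_le_mul_of_nonneg_left (hvv k) hs.1.le
      _ = ∫⁻ s, W s * Φ i s ∂μ := (hμl (hWm.mul (hΦm i))).symm
      _ = ((n : ℝ≥0∞) + 1) * (μ univ * ∫⁻ s, W s * Φ i s ∂μ) := by
          rw [hμ1, ← mul_assoc, ENNReal.mul_inv_cancel (by simp) (by simp), one_mul]
      _ ≤ ((n : ℝ≥0∞) + 1) * ((∫⁻ s, W s ∂μ) * ∫⁻ s, Φ i s ∂μ) :=
          mul_le_mul_right (lintegral_mul_le_of_monotoneOn_of_antitoneOn hμS hWm (hΦm i) hWmono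
            (hΦanti i)) _
      _ = _ := (mul_assoc _ _ _).symm

end Cube

section Benchmark

open Set Function
open scoped ENNReal

/-- Monotone symmetric homogeneous benchmarks that do not depend on the value of the highest bid. -/
structure IsRegularBenchmark {n : ℕ} (f : (Fin n → ℝ≥0) → ℝ≥0) : Prop where
  mono : Monotone f
  symm : ∀ b (σ : Equiv.Perm (Fin n)), f (b ∘ σ) = f b
  smul : ∀ (t : ℝ≥0) b, f (t • b) = t * f b
  top : ∀ b i x y, (∀ j, j ≠ i → b j ≤ x) → (∀ j, j ≠ i → b j ≤ y) →
    f (update b i x) = f (update b i y)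
  meas : Measurable f

/-- The bids with reciprocals `y`. -/
noncomputable def invBids {n : ℕ} (y : Fin n → ℝ) : Fin n → ℝ≥0 := fun i => (y i)⁻¹.toNNReal

lemma measurable_invBids (n : ℕ) : Measurable (invBids (n := n)) :=
  measurable_pi_lambda _ fun i => (measurable_pi_apply i).inv.real_toNNReal

lemma invBids_cons {n : ℕ} (s : ℝ) (v : Fin n → ℝ) :
    invBids (Fin.cons s v : Fin (n + 1) → ℝ) = Fin.cons s⁻¹.toNNReal (invBids v) := by
  funext i
  refine Fin.cases ?_ (fun j => ?_) i <;> simp [invBids]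

/-- The smallest coordinate. -/
noncomputable def minCoord {n : ℕ} (v : Fin (n + 1) → ℝ) : ℝ :=
  Finset.univ.inf' Finset.univ_nonempty v

lemma le_minCoord {n : ℕ} {v : Fin (n + 1) → ℝ} {s : ℝ} : s ≤ minCoord v ↔ ∀ j, s ≤ v j := by
  simp [minCoord]

lemma minCoord_le {n : ℕ} (v : Fin (n + 1) → ℝ) (j : Fin (n + 1)) : minCoord v ≤ v j :=
  le_minCoord.1 le_rfl j

lemma exists_eq_minCoord {n : ℕ} (v : Fin (n + 1) → ℝ) : ∃ i, v i = minCoord v := by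
  obtain ⟨i, _, hi⟩ := Finset.exists_mem_eq_inf' Finset.univ_nonempty v
  exact ⟨i, hi.symm⟩

lemma minCoord_pos {n : ℕ} {v : Fin (n + 1) → ℝ} (hv : ∀ i, 0 < v i) : 0 < minCoord v := by
  obtain ⟨i, hi⟩ := exists_eq_minCoord v
  exact hi ▸ hv i

lemma minCoord_comp {n : ℕ} (v : Fin (n + 1) → ℝ) (σ : Equiv.Perm (Fin (n + 1))) :
    minCoord (v ∘ σ) = minCoord v :=
  le_antisymm (le_minCoord.2 fun j => by simpa using minCoord_le (v ∘ σ) (σ.symm j))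
    (le_minCoord.2 fun j => minCoord_le v (σ j))

lemma measurable_minCoord (n : ℕ) : Measurable (minCoord (n := n)) := by
  refine measurable_of_Ici fun s => ?_
  have h : minCoord (n := n) ⁻¹' Ici s = ⋂ j, {v | s ≤ v j} := by
    ext v
    simp [le_minCoord]
  rw [h]
  exact MeasurableSet.iInter fun j => measurableSet_le measurable_const (measurable_pi_apply j)

/-- The total benchmark that a bidder can face: the benchmark when he is the highest bidder,
multiplied by the probability of that under the equal revenue distribution. -/
noncomputable def topWeight {n : ℕ} (f : (Fin (n + 2) → ℝ≥0) → ℝ≥0) (v : Fin (n + 1) → ℝ) : ℝ≥0∞ :=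
  ENNReal.ofReal (minCoord v) * f (invBids (Fin.cons (minCoord v) v : Fin (n + 2) → ℝ))

variable {n : ℕ} {f : (Fin (n + 2) → ℝ≥0) → ℝ≥0}

lemma IsRegularBenchmark.topWeight_eq (hf : IsRegularBenchmark f) {v : Fin (n + 1) → ℝ}
    (hv : ∀ i, 0 < v i) : topWeight f v =
      f (Fin.cons 1 fun j => (minCoord v / v j).toNNReal : Fin (n + 2) → ℝ≥0) := by
  have hm := minCoord_pos hv
  rw [topWeight, ENNReal.ofReal, ← ENNReal.coe_mul, ← hf.smul]
  congr 2
  funext i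
  refine Fin.cases ?_ (fun j => ?_) i
  · simp only [Pi.smul_apply, invBids, Fin.cons_zero, smul_eq_mul]
    rw [← Real.toNNReal_mul hm.le, mul_inv_cancel₀ hm.ne', Real.toNNReal_one]
  · simp only [Pi.smul_apply, invBids, Fin.cons_succ, smul_eq_mul]
    rw [← Real.toNNReal_mul hm.le, div_eq_mul_inv]

lemma IsRegularBenchmark.topWeight_comp (hf : IsRegularBenchmark f) (v : Fin (n + 1) → ℝ)
    (σ : Equiv.Perm (Fin (n + 1))) : topWeight f (v ∘ σ) = topWeight f v := by
  rw [topWeight, topWeight, minCoord_comp, cons_comp_perm]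
  congr 2
  exact hf.symm (invBids _) _

lemma IsRegularBenchmark.ratioMonotone_topWeight (hf : IsRegularBenchmark f) :
    RatioMonotone (topWeight f) := by
  intro y y' hy hyy _ h
  have hy' : ∀ i, 0 < y' i := fun i => (hy i).trans_le (hyy i)
  rw [hf.topWeight_eq hy, hf.topWeight_eq hy', ENNReal.coe_le_coe]
  refine hf.mono fun i => ?_
  refine Fin.cases le_rfl (fun j => ?_) i
  simp only [Fin.cons_succ]
  obtain ⟨k, hk⟩ := exists_eq_minCoord y
  have hk' : y' k = minCoord y' := le_antisymm
    (le_minCoord.2 fun j => (h k j (hk ▸ minCoord_le y j)).1) (minCoord_le y' k)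
  refine Real.toNNReal_le_toNNReal ?_
  rw [← hk, ← hk', div_le_div_iff₀ (hy j) (hy' j)]
  have := (h k j (hk ▸ minCoord_le y j)).2
  linarith

lemma measurable_cons {n : ℕ} :
    Measurable fun z : ℝ × (Fin n → ℝ) => (Fin.cons z.1 z.2 : Fin (n + 1) → ℝ) := by
  simpa only [Fin.insertNth_zero'] using measurable_insertNth (0 : Fin (n + 1))

lemma IsRegularBenchmark.measurable_topWeight (hf : IsRegularBenchmark f) :
    Measurable (topWeight f) :=
  (measurable_minCoord _).ennreal_ofReal.mul (hf.meas.comp ((measurable_invBids _).comp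
    (measurable_cons.comp ((measurable_minCoord _).prodMk measurable_id)))).coe_nnreal_ennreal

lemma IsRegularBenchmark.insertNth_eq (hf : IsRegularBenchmark f) {v : Fin (n + 1) → ℝ}
    (i : Fin (n + 2)) {s : ℝ} (hs : 0 < s) (hsv : ∀ j, s ≤ v j) :
    f (invBids (i.insertNth s v)) =
      f (invBids (Fin.cons (minCoord v) v : Fin (n + 2) → ℝ)) := by
  have hv : ∀ i, 0 < v i := fun i => hs.trans_le (hsv i)
  have h1 : f (invBids (i.insertNth s v)) = f (invBids (Fin.cons s v : Fin (n + 2) → ℝ)) := by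
    rw [← Fin.cons_comp_cycleRange]
    exact hf.symm (invBids _) _
  have h2 : ∀ x : ℝ≥0, (Fin.cons x (invBids v) : Fin (n + 2) → ℝ≥0) =
      update (Fin.cons 0 (invBids v) : Fin (n + 2) → ℝ≥0) 0 x := fun x => by
    rw [Fin.update_cons_zero]
  rw [h1, invBids_cons, invBids_cons, h2, h2 (minCoord v)⁻¹.toNNReal]
  refine hf.top _ _ _ _ (fun j hj => ?_) fun j hj => ?_ <;>
  · obtain ⟨k, rfl⟩ := Fin.exists_succ_eq.2 hj
    simp only [Fin.cons_succ, invBids]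
    refine Real.toNNReal_le_toNNReal (inv_anti₀ ?_ ?_)
    · first | exact hs | exact minCoord_pos hv
    · first | exact hsv k | exact minCoord_le v k

lemma setOf_le_eq_Ioc {v : Fin (n + 1) → ℝ} (hv : v ∈ cube (n + 1) 1) :
    {s | s ∈ Ioc (0 : ℝ) 1 ∧ ∀ j, s ≤ v j} = Ioc 0 (minCoord v) := by
  ext s
  simp only [mem_ofPred_eq, ← le_minCoord, mem_Ioc]
  exact ⟨fun h => ⟨h.1.1, h.2⟩, fun h =>
    ⟨⟨h.1, (h.2.trans (minCoord_le v 0)).trans (mem_cube.1 hv 0).2⟩, h.2⟩⟩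

/-- The expected benchmark for equal revenue bids, in terms of the highest bidder. -/
lemma IsRegularBenchmark.lintegral_eq (hf : IsRegularBenchmark f) :
    ∫⁻ y in cube (n + 2) 1, f (invBids y) =
      (n + 2 : ℕ) * ∫⁻ v in cube (n + 1) 1, topWeight f v := by
  have hm : Measurable fun y : Fin (n + 2) → ℝ => (f (invBids y) : ℝ≥0∞) :=
    (hf.meas.comp (measurable_invBids _)).coe_nnreal_ennreal
  rw [lintegral_cube_min hm, Finset.sum_congr rfl fun i _ =>
    setLIntegral_congr_fun (g := topWeight f) (measurableSet_cube _ _) fun v hv => ?_]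
  · simp [add_assoc, one_add_one_eq_two]
  · rw [setOf_le_eq_Ioc hv, setLIntegral_congr_fun (g := fun _ =>
      (f (invBids (Fin.cons (minCoord v) v : Fin (n + 2) → ℝ)) : ℝ≥0∞)) measurableSet_Ioc
        fun s hs => ?_, setLIntegral_const, Real.volume_Ioc, sub_zero, mul_comm, topWeight]
    simp only
    rw [hf.insertNth_eq i hs.1 (le_minCoord.1 hs.2)]

lemma lintegral_cube_update_zero (i : Fin (n + 1)) {φ : (Fin (n + 1) → ℝ) → ℝ≥0∞}
    (hφ : Measurable φ) : ∫⁻ y in cube (n + 1) 1, φ (update y i 0) =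
      ∫⁻ v in cube n 1, φ (i.insertNth 0 v) := by
  have hu : Measurable fun y : Fin (n + 1) → ℝ => update y i 0 := measurable_update_left
  rw [← lintegral_indicator (measurableSet_cube _ _),
    lintegral_eq_insertNth i (F := (cube (n + 1) 1).indicator fun y => φ (update y i 0))
      ((hφ.comp hu).indicator (measurableSet_cube _ _))]
  have h1 : ∀ s : ℝ, ∫⁻ v : Fin n → ℝ, (cube (n + 1) 1).indicator (fun y => φ (update y i 0))
      (i.insertNth s v) = (Ioc (0 : ℝ) 1).indicator
        (fun _ => ∫⁻ v in cube n 1, φ (i.insertNth 0 v)) s := by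
    intro s
    by_cases hs : s ∈ Ioc (0 : ℝ) 1
    · rw [indicator_of_mem hs, ← lintegral_indicator (measurableSet_cube _ _)]
      refine lintegral_congr fun v => indicator_eq_indicator_of_iff ?_ ?_
      · simp [insertNth_mem_cube, hs]
      · rw [Fin.update_insertNth]
    · simp [insertNth_mem_cube, hs]
  simp only [h1]
  rw [lintegral_indicator measurableSet_Ioc]
  simp

/-- The equal revenue bound localized to lower sets of reciprocals. -/
theorem IsRegularBenchmark.lintegral_mul_le (hf : IsRegularBenchmark f)
    {φ : (Fin (n + 2) → ℝ) → ℝ≥0∞} (hφm : Measurable φ)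
    (hφ : ∀ y y' : Fin (n + 2) → ℝ, (∀ i, 0 ≤ y i) → y ≤ y' → φ y' ≤ φ y) :
    ∫⁻ y in cube (n + 2) 1, f (invBids y) * φ y ≤
      (∫⁻ v in cube (n + 1) 1, topWeight f v) *
        ∑ i, ∫⁻ y in cube (n + 2) 1, φ (update y i 0) := by
  have hm : Measurable fun y : Fin (n + 2) → ℝ => (f (invBids y) : ℝ≥0∞) :=
    (hf.meas.comp (measurable_invBids _)).coe_nnreal_ennreal
  rw [lintegral_cube_min (F := fun y => f (invBids y) * φ y) (hm.mul hφm), Finset.mul_sum]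
  refine Finset.sum_le_sum fun i _ => ?_
  rw [lintegral_cube_update_zero i hφm]
  calc ∫⁻ v in cube (n + 1) 1, ∫⁻ s in {s | s ∈ Ioc (0 : ℝ) 1 ∧ ∀ j, s ≤ v j},
        f (invBids (i.insertNth s v)) * φ (i.insertNth s v)
      ≤ ∫⁻ v in cube (n + 1) 1, topWeight f v * φ (i.insertNth 0 v) := by
        refine setLIntegral_mono' (measurableSet_cube _ _) fun v hv => ?_
        rw [setOf_le_eq_Ioc hv]
        calc ∫⁻ s in Ioc 0 (minCoord v), f (invBids (i.insertNth s v)) * φ (i.insertNth s v)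
            ≤ ∫⁻ _ in Ioc 0 (minCoord v),
                f (invBids (Fin.cons (minCoord v) v : Fin (n + 2) → ℝ)) *
                  φ (i.insertNth 0 v) := by
              refine setLIntegral_mono' measurableSet_Ioc fun s hs => ?_
              rw [hf.insertNth_eq i hs.1 (le_minCoord.1 hs.2)]
              refine mul_le_mul_right (hφ _ _ (fun j => ?_) fun j => ?_) _
              · refine Fin.succAboveCases i ?_ (fun k => ?_) j
                · simp
                · simpa using (mem_cube.1 hv k).1.le
              · refine Fin.succAboveCases i ?_ (fun k => ?_) j
                · simpa using hs.1.le
                · simp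
          _ = topWeight f v * φ (i.insertNth 0 v) := by
              rw [setLIntegral_const, Real.volume_Ioc, sub_zero, topWeight]
              ring
    _ ≤ _ := by
        refine lintegral_cube_mul_le hf.measurable_topWeight
          (hφm.comp ((measurable_insertNth i).comp measurable_prodMk_left))
          hf.topWeight_comp hf.ratioMonotone_topWeight fun v v' hv hvv => ?_
        refine hφ _ _ (fun j => ?_) fun j => ?_
        · refine Fin.succAboveCases i ?_ (fun k => ?_) j
          · simp
          · simpa using (hv k).le
        · refine Fin.succAboveCases i ?_ (fun k => ?_) j
          · simp
          · simpa using hvv k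

end Benchmark

section Grid

open Set Function
open scoped ENNReal

/-- The revenue from a bidder with bid `x` at the posted price `p`. -/
noncomputable def priceRevenue (x : ℝ≥0) (p : ℝ≥0∞) : ℝ≥0∞ := (Iic (x : ℝ≥0∞)).indicator id p

lemma priceRevenue_le (x : ℝ≥0) (p : ℝ≥0∞) : priceRevenue x p ≤ x := by
  by_cases h : p ≤ x <;> simp [priceRevenue, h]

lemma measurable_priceRevenue (x : ℝ≥0) : Measurable (priceRevenue x) :=
  measurable_id.indicator measurableSet_Iic

/-- The index of the largest grid point that does not exceed `x 0 / u`. -/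
noncomputable def gridIndex {N : ℕ} (x : Fin (N + 1) → ℝ≥0) (u : ℝ) : Fin (N + 1) :=
  (Finset.univ.filter fun j => u * x j ≤ x 0).sup id

variable {N : ℕ} {x : Fin (N + 1) → ℝ≥0}

lemma gridIndex_antitone (x : Fin (N + 1) → ℝ≥0) : Antitone (gridIndex x) := fun u u' h =>
  Finset.sup_mono fun j => by
    simp only [Finset.mem_filter, Finset.mem_univ, true_and]
    exact fun hj => (mul_le_mul_of_nonneg_right h (x j).coe_nonneg).trans hj

lemma le_gridIndex (hx : Monotone x) {u : ℝ} (hu : u ∈ Icc (0 : ℝ) 1) {j : Fin (N + 1)} :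
    j ≤ gridIndex x u ↔ u * x j ≤ x 0 := by
  have h0 : u * x 0 ≤ x 0 := by
    simpa using mul_le_mul_of_nonneg_right hu.2 (x 0).2
  constructor
  · intro h
    obtain ⟨k, hk, hk'⟩ := Finset.exists_mem_eq_sup
      (Finset.univ.filter fun j : Fin (N + 1) => u * x j ≤ x 0) ⟨0, by simpa using h0⟩ id
    rw [gridIndex, hk'] at h
    exact (mul_le_mul_of_nonneg_left (NNReal.coe_le_coe.2 (hx h)) hu.1).trans
      (by simpa using hk)
  · intro h
    exact Finset.le_sup (f := id) (by simpa using h)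

lemma gridIndex_zero (x : Fin (N + 1) → ℝ≥0) : gridIndex x 0 = Fin.last N :=
  le_antisymm (Fin.le_last _) (Finset.le_sup (f := id) (by simp))

lemma measurable_gridIndex (x : Fin (N + 1) → ℝ≥0) : Measurable (gridIndex x) :=
  (gridIndex_antitone x).measurable

/-- The probability of a cell of the grid under the equal revenue distribution. -/
noncomputable def cellWeight (x : Fin (N + 1) → ℝ≥0) (j : Fin (N + 1)) : ℝ :=
  (volume (Ioc (0 : ℝ) 1 ∩ gridIndex x ⁻¹' {j})).toReal

lemma volume_cell_ne_top (x : Fin (N + 1) → ℝ≥0) (j : Fin (N + 1)) :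
    volume (Ioc (0 : ℝ) 1 ∩ gridIndex x ⁻¹' {j}) ≠ ∞ :=
  ne_top_of_le_ne_top (by simp : volume (Ioc (0 : ℝ) 1) ≠ ∞) (measure_mono inter_subset_left)

lemma sum_cellWeight_ge (hx : StrictMono x) (h0 : 0 < x 0) (j : Fin (N + 1)) :
    ∑ k ∈ Finset.Ici j, cellWeight x k = x 0 / x j := by
  have hxj : ∀ j, (0 : ℝ) < x j := fun j => h0.trans_le (hx.monotone (Fin.zero_le j))
  have h1 : ∑ k ∈ Finset.Ici j, cellWeight x k =
      (volume (⋃ k ∈ Finset.Ici j, Ioc (0 : ℝ) 1 ∩ gridIndex x ⁻¹' {k})).toReal := by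
    rw [measure_biUnion_finset, ENNReal.toReal_sum fun k _ => volume_cell_ne_top x k]
    · rfl
    · intro k _ l _ hkl
      refine Disjoint.mono inter_subset_right inter_subset_right ?_
      exact Disjoint.preimage _ (by simpa using hkl)
    · exact fun k _ => measurableSet_Ioc.inter (measurable_gridIndex x (measurableSet_singleton k))
  have h2 : (⋃ k ∈ Finset.Ici j, Ioc (0 : ℝ) 1 ∩ gridIndex x ⁻¹' {k}) = Ioc 0 ((x 0 : ℝ) / x j) := by
    ext u
    simp only [Finset.mem_Ici, mem_iUnion, mem_inter_iff, mem_preimage, mem_singleton_iff,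
      exists_prop]
    have hle : (x 0 : ℝ) / x j ≤ 1 := by
      rw [div_le_one (hxj j)]
      exact_mod_cast hx.monotone (Fin.zero_le j)
    constructor
    · rintro ⟨k, hjk, hu, rfl⟩
      rw [le_gridIndex hx.monotone ⟨hu.1.le, hu.2⟩] at hjk
      exact ⟨hu.1, (le_div_iff₀ (hxj j)).2 hjk⟩
    · intro hu
      have hu1 : u ≤ 1 := hu.2.trans hle
      exact ⟨gridIndex x u, (le_gridIndex hx.monotone ⟨hu.1.le, hu1⟩).2
        ((le_div_iff₀ (hxj j)).1 hu.2), ⟨hu.1, hu1⟩, rfl⟩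
  rw [h1, h2, Real.volume_Ioc, sub_zero, ENNReal.toReal_ofReal (div_nonneg (x 0).coe_nonneg (x j).coe_nonneg)]

lemma cellWeight_pos (hx : StrictMono x) (h0 : 0 < x 0) (j : Fin (N + 1)) :
    0 < cellWeight x j := by
  have hxj : ∀ j, (0 : ℝ) < x j := fun j => h0.trans_le (hx.monotone (Fin.zero_le j))
  have h := sum_cellWeight_ge hx h0 j
  rw [Finset.Ici_eq_cons_Ioi, Finset.sum_cons] at h
  rcases eq_or_ne j (Fin.last N) with rfl | hj
  · have : Finset.Ioi (Fin.last N) = ∅ := by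
      ext k
      simp [Fin.le_last]
    rw [this, Finset.sum_empty, add_zero] at h
    rw [h]
    exact div_pos (hxj 0) (hxj _)
  · obtain ⟨k, rfl⟩ := Fin.exists_castSucc_eq.2 hj
    have h1 := sum_cellWeight_ge hx h0 k.succ
    have h2 : Finset.Ioi k.castSucc = Finset.Ici k.succ := by
      ext l
      simp [Fin.castSucc_lt_iff_succ_le]
    rw [h2, h1] at h
    have h3 : (x 0 : ℝ) / x k.succ < x 0 / x k.castSucc :=
      div_lt_div_of_pos_left (hxj 0) (hxj _) (NNReal.coe_lt_coe.2 (hx k.castSucc_lt_succ))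
    linarith

lemma sum_cellWeight (hx : StrictMono x) (h0 : 0 < x 0) : ∑ k, cellWeight x k = 1 := by
  have h := sum_cellWeight_ge hx h0 0
  have h1 : Finset.Ici (0 : Fin (N + 1)) = Finset.univ := by
    ext k
    simp
  rw [h1, div_self (NNReal.coe_ne_zero.2 h0.ne')] at h
  exact h

lemma lintegral_cube_gridIndex {n : ℕ} (x : Fin (N + 1) → ℝ≥0)
    (H : (Fin n → Fin (N + 1)) → ℝ≥0∞) :
    ∫⁻ y in cube n 1, H (fun i => gridIndex x (y i)) =
      ∑ c, H c * ENNReal.ofReal (∏ i, cellWeight x (c i)) := by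
  have hm : Measurable fun (y : Fin n → ℝ) i => gridIndex x (y i) :=
    measurable_pi_lambda _ fun i => (measurable_gridIndex x).comp (measurable_pi_apply i)
  have hH : Measurable H := measurable_of_finite H
  rw [← lintegral_map hH hm, lintegral_fintype]
  refine Finset.sum_congr rfl fun c _ => ?_
  congr 1
  rw [Measure.map_apply hm (measurableSet_singleton c),
    Measure.restrict_apply (hm (measurableSet_singleton c))]
  have h1 : (fun (y : Fin n → ℝ) i => gridIndex x (y i)) ⁻¹' {c} ∩ cube n 1 =
      Set.pi univ fun i => Ioc (0 : ℝ) 1 ∩ gridIndex x ⁻¹' {c i} := by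
    ext y
    simp only [mem_inter_iff, mem_preimage, mem_singleton_iff, mem_cube, mem_pi, mem_univ,
      forall_true_left, mem_Ioc, funext_iff]
    exact ⟨fun h i => ⟨h.2 i, h.1 i⟩, fun h => ⟨fun i => (h i).2, fun i => (h i).1⟩⟩
  rw [h1, volume_pi_pi, ENNReal.ofReal_prod_of_nonneg (f := fun i => cellWeight x (c i))
    fun i _ => ENNReal.toReal_nonneg]
  exact Finset.prod_congr rfl fun i _ => (ENNReal.ofReal_toReal (volume_cell_ne_top x _)).symm

lemma exists_increments {r : Fin (N + 1) → ℝ} (hr : Monotone r) (h0 : 0 ≤ r 0) :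
    ∃ d : Fin (N + 1) → ℝ, (∀ j, 0 ≤ d j) ∧ ∀ j, r j = ∑ k ∈ Finset.Iic j, d k := by
  refine ⟨Fin.cons (r 0) fun k => r k.succ - r k.castSucc, fun j => ?_, fun j => ?_⟩
  · refine Fin.cases ?_ (fun k => ?_) j
    · simpa using h0
    · simpa using hr k.castSucc_le_succ
  · induction j using Fin.induction with
    | zero =>
      have : Finset.Iic (0 : Fin (N + 1)) = {0} := by
        ext k
        simp
      simp [this]
    | succ k ih =>
      have : Finset.Iic k.succ = insert k.succ (Finset.Iic k.castSucc) := by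
        ext l
        simp only [Finset.mem_Iic, Finset.mem_insert, Fin.le_iff_val_le_val, Fin.ext_iff,
          Fin.val_succ, Fin.val_castSucc]
        omega
      rw [this, Finset.sum_insert (by simp), ← ih]
      simp

/-- A revenue curve on a grid is that of a random posted price. -/
lemma exists_price (hx : StrictMono x) (h0 : 0 < x 0) {r : Fin (N + 1) → ℝ} (hr : Monotone r)
    (hr0 : 0 ≤ r 0) (hsum : ∑ k, cellWeight x k * r k ≤ x 0) :
    ∃ G : ProbabilityMeasure ℝ≥0∞, ∀ j,
      ∫⁻ p, priceRevenue (x j) p ∂(G : Measure ℝ≥0∞) = ENNReal.ofReal (r j) := by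
  obtain ⟨d, hd, hrd⟩ := exists_increments hr hr0
  have hxj : ∀ j, (0 : ℝ) < x j := fun j => h0.trans_le (hx.monotone (Fin.zero_le j))
  have h1 : ∑ k, cellWeight x k * r k = x 0 * ∑ j, d j / x j := by
    simp_rw [hrd, Finset.mul_sum]
    rw [Finset.sum_comm' (t' := Finset.univ) (s' := fun j => Finset.Ici j) (by simp)]
    refine Finset.sum_congr rfl fun j _ => ?_
    rw [← Finset.sum_mul, sum_cellWeight_ge hx h0]
    ring
  have h2 : ∑ j, d j / x j ≤ 1 := by
    rw [h1] at hsum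
    exact le_of_mul_le_mul_left (by simpa using hsum) (hxj 0)
  have hnn : ∀ j, 0 ≤ d j / x j := fun j => div_nonneg (hd j) (hxj j).le
  let μ : Measure ℝ≥0∞ := ∑ j, ENNReal.ofReal (d j / x j) • Measure.dirac (x j : ℝ≥0∞) +
    ENNReal.ofReal (1 - ∑ j, d j / x j) • Measure.dirac ∞
  have hμ : IsProbabilityMeasure μ := ⟨by
    simp only [μ, Measure.add_apply, Measure.finsetSum_apply, Measure.smul_apply, measure_univ,
      smul_eq_mul, mul_one]
    rw [← ENNReal.ofReal_sum_of_nonneg fun j _ => hnn j,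
      ← ENNReal.ofReal_add (Finset.sum_nonneg fun j _ => hnn j) (by linarith)]
    simp⟩
  refine ⟨⟨μ, hμ⟩, fun j => ?_⟩
  have hm := measurable_priceRevenue (x j)
  simp only [ProbabilityMeasure.coe_mk, μ]
  rw [lintegral_add_measure, lintegral_finsetSum_measure, lintegral_smul_measure,
    lintegral_dirac' _ hm]
  simp only [lintegral_smul_measure, lintegral_dirac' _ hm, smul_eq_mul]
  rw [show priceRevenue (x j) ∞ = 0 by simp [priceRevenue], mul_zero, add_zero, hrd j,
    ENNReal.ofReal_sum_of_nonneg fun k _ => hd k,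
    ← Finset.sum_subset (Finset.subset_univ (Finset.Iic j))]
  · refine Finset.sum_congr rfl fun k hk => ?_
    have hk' : (x k : ℝ≥0∞) ≤ x j := ENNReal.coe_le_coe.2 (hx.monotone (by simpa using hk))
    rw [priceRevenue, indicator_of_mem (by simpa using hk'), id,
      ← ENNReal.ofReal_coe_nnreal, ← ENNReal.ofReal_mul (hnn k), div_mul_cancel₀ _ (hxj k).ne']
  · intro k _ hk
    have hk' : x j < x k := hx (by simpa using hk)
    rw [priceRevenue, indicator_of_notMem (by simpa using hk'), mul_zero]

/-- Prices on a grid that extract every multiple of the benchmark below the optimal one. -/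
theorem IsRegularBenchmark.exists_grid_prices {n : ℕ} {f : (Fin (n + 2) → ℝ≥0) → ℝ≥0}
    (hf : IsRegularBenchmark f) {ρ l : ℝ≥0}
    (hρ : ∫⁻ v in cube (n + 1) 1, topWeight f v = ρ) (hl : ρ < l) (hx : StrictMono x)
    (h0 : 0 < x 0) :
    ∃ G : Fin (n + 2) → (Fin (n + 2) → Fin (N + 1)) → ProbabilityMeasure ℝ≥0∞,
      (∀ i c j, G i (update c i j) = G i c) ∧
      ∀ c, (f (x ∘ c) : ℝ≥0∞) ≤
        l * ∑ i, ∫⁻ p, priceRevenue (x (c i)) p ∂(G i c : Measure ℝ≥0∞) := by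
  classical
  have hx0 : (0 : ℝ) < x 0 := h0
  have hl0 : (0 : ℝ) < l := (ρ.coe_nonneg.trans_lt (NNReal.coe_lt_coe.2 hl) : (0 : ℝ) < l)
  let F : (Fin (n + 2) → Fin (N + 1)) → ℝ := fun c => f (x ∘ c) / (l * x 0)
  have hF : ∀ c, 0 ≤ F c := fun c => by positivity
  have hFm : Monotone F := fun c d h => div_le_div_of_nonneg_right
    (NNReal.coe_le_coe.2 (hf.mono fun i => hx.monotone (h i))) (by positivity)
  have hq := cellWeight_pos hx h0
  obtain ⟨R, hR0, hRm, hRs, hRq⟩ := exists_monotone_decomposition hq hF hFm (by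
    intro D hD hne
    rw [sum_cellWeight hx h0, one_mul]
    let φ : (Fin (n + 2) → ℝ) → ℝ≥0∞ := fun y => D.indicator 1 fun i => gridIndex x (y i)
    have hφm : Measurable φ := (measurable_of_finite (D.indicator (1 : (Fin (n + 2) → Fin (N + 1)) → ℝ≥0∞))).comp
      (measurable_pi_lambda _ fun i => (measurable_gridIndex x).comp (measurable_pi_apply i))
    have hφ : ∀ y y' : Fin (n + 2) → ℝ, (∀ i, 0 ≤ y i) → y ≤ y' → φ y' ≤ φ y := by
      intro y y' _ hyy
      by_cases h : (fun i => gridIndex x (y' i)) ∈ D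
      · have h' : (fun i => gridIndex x (y i)) ∈ D :=
          hD (fun i => gridIndex_antitone x (hyy i)) h
        simp [φ, h, h']
      · simp [φ, h]
    have hmain := hf.lintegral_mul_le hφm hφ
    have hterm : ∀ i c, 0 ≤ (∏ k, cellWeight x (c k)) * D.indicator (1 : (Fin (n + 2) → Fin (N + 1)) → ℝ) (update c i ⊤) :=
      fun i c => mul_nonneg (Finset.prod_nonneg fun k _ => (hq _).le)
        (indicator_nonneg (fun _ _ => zero_le_one) _)
    have hright : ∀ i, ∫⁻ y in cube (n + 2) 1, φ (update y i 0) =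
        ENNReal.ofReal (∑ c, (∏ k, cellWeight x (c k)) * D.indicator 1 (update c i ⊤)) := by
      intro i
      have h1 : ∀ y : Fin (n + 2) → ℝ, φ (update y i 0) =
          D.indicator 1 (update (fun k => gridIndex x (y k)) i ⊤) := by
        intro y
        simp only [φ]
        congr 1
        funext k
        rcases eq_or_ne k i with rfl | hk
        · rw [update_self, update_self, gridIndex_zero]
          rfl
        · simp [hk]
      simp only [h1]
      rw [lintegral_cube_gridIndex x (fun c => D.indicator 1 (update c i ⊤)),
        ENNReal.ofReal_sum_of_nonneg fun c _ => hterm i c]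
      refine Finset.sum_congr rfl fun c _ => ?_
      by_cases h : update c i ⊤ ∈ D <;> simp [h]
    have hleft : ENNReal.ofReal (∑ c, (∏ k, cellWeight x (c k)) * D.indicator F c) * l ≤
        ∫⁻ y in cube (n + 2) 1, f (invBids y) * φ y := by
      rw [ENNReal.ofReal_sum_of_nonneg fun c _ => mul_nonneg
          (Finset.prod_nonneg fun k _ => (hq _).le) (indicator_nonneg (fun c _ => hF c) _)]
      have h1 : ∀ c, ENNReal.ofReal ((∏ k, cellWeight x (c k)) * D.indicator F c) * l =
          (((x 0)⁻¹ * f (x ∘ c) : ℝ≥0) : ℝ≥0∞) * D.indicator 1 c *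
            ENNReal.ofReal (∏ k, cellWeight x (c k)) := by
        intro c
        by_cases h : c ∈ D
        · simp only [h, indicator_of_mem, Pi.one_apply, mul_one, F]
          rw [← ENNReal.ofReal_coe_nnreal, ← ENNReal.ofReal_coe_nnreal,
            ← ENNReal.ofReal_mul (by
              exact mul_nonneg (Finset.prod_nonneg fun k _ => (hq _).le) (by positivity)),
            ← ENNReal.ofReal_mul (by positivity)]
          congr 1
          push_cast
          field_simp
        · simp [h]
      rw [Finset.sum_mul, Finset.sum_congr rfl fun c _ => h1 c, ← lintegral_cube_gridIndex x
        (fun c => (((x 0)⁻¹ * f (x ∘ c) : ℝ≥0) : ℝ≥0∞) * D.indicator 1 c)]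
      refine setLIntegral_mono' (measurableSet_cube _ _) fun y hy => ?_
      refine mul_le_mul_left (ENNReal.coe_le_coe.2 ?_) _
      rw [← hf.smul]
      refine hf.mono fun i => ?_
      have hyi := mem_cube.1 hy i
      have h2 := (le_gridIndex hx.monotone ⟨hyi.1.le, hyi.2⟩).1 (le_refl (gridIndex x (y i)))
      rw [← NNReal.coe_le_coe]
      simp only [Pi.smul_apply, comp_apply, smul_eq_mul, NNReal.coe_mul, NNReal.coe_inv, invBids]
      rw [Real.coe_toNNReal _ (inv_nonneg.2 hyi.1.le), inv_mul_le_iff₀ hx0,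
        ← div_eq_mul_inv, le_div_iff₀ hyi.1]
      linarith
    set L := ∑ c, (∏ k, cellWeight x (c k)) * D.indicator F c with hL
    set S := ∑ i, ∑ c, (∏ k, cellWeight x (c k)) * D.indicator 1 (update c i ⊤) with hS
    have hSpos : 0 < S := by
      obtain ⟨c, hc⟩ := hne
      refine Finset.sum_pos' (fun i _ => Finset.sum_nonneg fun c _ => hterm i c)
        ⟨0, Finset.mem_univ _, Finset.sum_pos' (fun c _ => hterm 0 c) ⟨c, Finset.mem_univ _, ?_⟩⟩
      have : update c 0 ⊤ ∈ D := hD (le_update_iff.2 ⟨le_top, fun _ _ => le_rfl⟩) hc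
      simp only [this, indicator_of_mem, Pi.one_apply, mul_one]
      exact Finset.prod_pos fun k _ => hq _
    have hfin : ENNReal.ofReal (L * l) ≤ ENNReal.ofReal (ρ * S) := by
      rw [ENNReal.ofReal_mul' l.coe_nonneg, ENNReal.ofReal_mul ρ.coe_nonneg, ENNReal.ofReal_coe_nnreal,
        ENNReal.ofReal_coe_nnreal]
      refine hleft.trans (hmain.trans (le_of_eq ?_))
      rw [hρ, Finset.sum_congr rfl fun i _ => hright i, hS,
        ENNReal.ofReal_sum_of_nonneg fun i _ => Finset.sum_nonneg fun c _ => hterm i c]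
    rw [ENNReal.ofReal_le_ofReal_iff (mul_nonneg ρ.coe_nonneg hSpos.le)] at hfin
    have hlt : (ρ : ℝ) * S < l * S := mul_lt_mul_of_pos_right (NNReal.coe_lt_coe.2 hl) hSpos
    have : (l : ℝ) * L < l * S := by linarith
    exact lt_of_mul_lt_mul_left this hl0.le)
  have hG : ∀ i c, ∃ G : ProbabilityMeasure ℝ≥0∞, ∀ j,
      ∫⁻ p, priceRevenue (x j) p ∂(G : Measure ℝ≥0∞) =
        ENNReal.ofReal (x 0 * R i (update c i j)) := by
    intro i c
    refine exists_price hx h0 (fun j k hjk => mul_le_mul_of_nonneg_left (hRm i c j k hjk) hx0.le)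
      (mul_nonneg hx0.le (hR0 _ _)) ?_
    calc ∑ k, cellWeight x k * (x 0 * R i (update c i k))
        = x 0 * ∑ k, cellWeight x k * R i (update c i k) := by
          rw [Finset.mul_sum]
          exact Finset.sum_congr rfl fun k _ => by ring
      _ ≤ x 0 * 1 := mul_le_mul_of_nonneg_left (hRq i c) hx0.le
      _ = x 0 := mul_one _
  choose G hG using hG
  refine ⟨fun i c => G i (update c i 0), fun i c j => by simp, fun c => ?_⟩
  have h1 : ∀ i, ∫⁻ p, priceRevenue (x (c i)) p ∂(G i (update c i 0) : Measure ℝ≥0∞) =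
      ENNReal.ofReal (x 0 * R i c) := by
    intro i
    rw [hG]
    simp
  simp only [h1]
  rw [← ENNReal.ofReal_sum_of_nonneg fun i _ => mul_nonneg hx0.le (hR0 _ _), ← Finset.mul_sum,
    hRs, ← ENNReal.ofReal_coe_nnreal, ← ENNReal.ofReal_coe_nnreal, ← ENNReal.ofReal_mul l.coe_nonneg]
  refine ENNReal.ofReal_le_ofReal (le_of_eq ?_)
  simp only [F]
  field_simp

end Grid

section Compactness

open Set Function Filter Topology
open scoped ENNReal

lemma lintegral_priceRevenue_le (x : ℝ≥0) (G : Measure ℝ≥0∞) [IsProbabilityMeasure G] :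
    ∫⁻ p, priceRevenue x p ∂G ≤ x :=
  (lintegral_mono fun p => priceRevenue_le x p).trans_eq (by simp)

/-- A continuous function of the price above the revenue `priceRevenue x`. -/
noncomputable def softRevenue (x : ℝ≥0) (k : ℕ) (p : ℝ≥0∞) : ℝ≥0∞ := min p (x - k * (p - x))

lemma softRevenue_le (x : ℝ≥0) (k : ℕ) (p : ℝ≥0∞) : softRevenue x k p ≤ x :=
  (min_le_right _ _).trans tsub_le_self

lemma priceRevenue_le_softRevenue (x : ℝ≥0) (k : ℕ) (p : ℝ≥0∞) :
    priceRevenue x p ≤ softRevenue x k p := by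
  by_cases h : p ≤ x <;> simp [priceRevenue, softRevenue, h, tsub_eq_zero_of_le]

lemma continuous_softRevenue (x : ℝ≥0) (k : ℕ) : Continuous (softRevenue x k) :=
  continuous_id.min ((ENNReal.continuous_sub_left ENNReal.coe_ne_top).comp
    ((ENNReal.continuous_const_mul (ENNReal.natCast_ne_top k)).comp
      (ENNReal.continuous_sub_right _)))

lemma tendsto_softRevenue (x : ℝ≥0) (p : ℝ≥0∞) :
    Tendsto (fun k => softRevenue x k p) atTop (𝓝 (priceRevenue x p)) := by
  by_cases h : p ≤ x
  · simp [priceRevenue, softRevenue, h, tsub_eq_zero_of_le]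
  · have h0 : p - x ≠ 0 := by simpa [tsub_eq_zero_iff_le] using h
    obtain ⟨K, hK⟩ := ENNReal.exists_nat_mul_gt h0 (ENNReal.coe_ne_top : (x : ℝ≥0∞) ≠ ∞)
    refine tendsto_const_nhds.congr' ?_
    filter_upwards [eventually_ge_atTop K] with k hk
    have : (x : ℝ≥0∞) ≤ k * (p - x) :=
      hK.le.trans (mul_le_mul_left (Nat.cast_le.2 hk) _)
    simp [priceRevenue, softRevenue, h, tsub_eq_zero_of_le this]

lemma continuous_lintegral_softRevenue (x : ℝ≥0) (k : ℕ) :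
    Continuous fun G : ProbabilityMeasure ℝ≥0∞ =>
      ∫⁻ p, softRevenue x k p ∂(G : Measure ℝ≥0∞) := by
  have hne : ∀ p, softRevenue x k p ≠ ∞ := fun p =>
    ne_top_of_le_ne_top ENNReal.coe_ne_top (softRevenue_le x k p)
  let g : C(ℝ≥0∞, ℝ≥0) := ⟨fun p => (softRevenue x k p).toNNReal,
    ENNReal.continuousOn_toNNReal.comp_continuous (continuous_softRevenue x k) hne⟩
  have h := ProbabilityMeasure.continuous_lintegral_continuousMap g
  refine h.congr fun G => lintegral_congr fun p => ?_
  simp [g, ENNReal.coe_toNNReal (hne p)]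

lemma tendsto_lintegral_softRevenue (x : ℝ≥0) (G : ProbabilityMeasure ℝ≥0∞) :
    Tendsto (fun k => ∫⁻ p, softRevenue x k p ∂(G : Measure ℝ≥0∞)) atTop
      (𝓝 (∫⁻ p, priceRevenue x p ∂(G : Measure ℝ≥0∞))) :=
  tendsto_lintegral_of_dominated_convergence (fun _ => (x : ℝ≥0∞))
    (fun k => (continuous_softRevenue x k).measurable)
    (fun k => Eventually.of_forall fun p => softRevenue_le x k p) (by simp)
    (Eventually.of_forall fun p => tendsto_softRevenue x p)

/-- Random prices exist as soon as they exist for every finite set of bid vectors, up to an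
arbitrarily small error. -/
theorem exists_prices_of_finite {n : ℕ} {c : (Fin n → ℝ≥0) → ℝ≥0}
    (h : ∀ (B : Finset (Fin n → ℝ≥0)) (ε : ℝ≥0), 0 < ε →
      ∃ G : Fin n → (Fin n → ℝ≥0) → ProbabilityMeasure ℝ≥0∞, ∀ b ∈ B, (c b : ℝ≥0∞) ≤
        ∑ i, ∫⁻ p, priceRevenue (b i) p ∂(G i (update b i 0) : Measure ℝ≥0∞) + ε) :
    ∃ G : Fin n → (Fin n → ℝ≥0) → ProbabilityMeasure ℝ≥0∞, ∀ b, (c b : ℝ≥0∞) ≤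
      ∑ i, ∫⁻ p, priceRevenue (b i) p ∂(G i (update b i 0) : Measure ℝ≥0∞) := by
  classical
  let K : (Fin n → ℝ≥0) × {ε : ℝ≥0 // 0 < ε} × ℕ →
      Set (Fin n → (Fin n → ℝ≥0) → ProbabilityMeasure ℝ≥0∞) := fun z =>
    {G | (c z.1 : ℝ≥0∞) ≤ ∑ i, ∫⁻ p, softRevenue (z.1 i) z.2.2 p
      ∂(G i (update z.1 i 0) : Measure ℝ≥0∞) + (z.2.1 : ℝ≥0)}
  obtain ⟨G, hG⟩ := CompactSpace.iInter_nonempty (t := K) (fun z => by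
    refine isClosed_le continuous_const ((continuous_finsetSum _ fun i _ => ?_).add
      continuous_const)
    exact (continuous_lintegral_softRevenue (z.1 i) z.2.2).comp
      ((continuous_apply (update z.1 i 0)).comp (continuous_apply i))) (fun s => by
    have hε : ∃ ε : ℝ≥0, 0 < ε ∧ ∀ z ∈ s, ε ≤ z.2.1 := by
      induction s using Finset.induction_on with
      | empty => exact ⟨1, one_pos, by simp⟩
      | insert z s _ ih =>
        obtain ⟨ε, hε, h⟩ := ih
        refine ⟨min ε z.2.1, lt_min hε z.2.1.2, fun w hw => ?_⟩
        rcases Finset.mem_insert.1 hw with rfl | hw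
        · exact min_le_right _ _
        · exact (min_le_left _ _).trans (h w hw)
    obtain ⟨ε, hε, hle⟩ := hε
    obtain ⟨G, hG⟩ := h (s.image Prod.fst) ε hε
    refine ⟨G, mem_iInter₂.2 fun z hz => ?_⟩
    refine (hG z.1 (Finset.mem_image_of_mem _ hz)).trans (add_le_add
      (Finset.sum_le_sum fun i _ => lintegral_mono fun p => priceRevenue_le_softRevenue _ _ p)
      (ENNReal.coe_le_coe.2 (hle z hz))))
  refine ⟨G, fun b => ENNReal.le_of_forall_pos_le_add fun ε hε _ => ?_⟩
  have hlim : Tendsto (fun k => ∑ i, ∫⁻ p, softRevenue (b i) k p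
      ∂(G i (update b i 0) : Measure ℝ≥0∞) + (ε : ℝ≥0∞)) atTop
      (𝓝 (∑ i, ∫⁻ p, priceRevenue (b i) p ∂(G i (update b i 0) : Measure ℝ≥0∞) + ε)) :=
    (tendsto_finsetSum _ fun i _ => tendsto_lintegral_softRevenue _ _).add tendsto_const_nhds
  exact ge_of_tendsto' hlim fun k => mem_iInter.1 hG (b, ⟨ε, hε⟩, k)

lemma priceRevenue_max_le (x δ : ℝ≥0) (p : ℝ≥0∞) :
    priceRevenue (max x δ) p ≤ priceRevenue x p + δ := by
  rcases le_total x δ with h | h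
  · rw [max_eq_right h]
    exact (priceRevenue_le δ p).trans le_add_self
  · rw [max_eq_left h]
    exact le_self_add

/-- Random prices that extract the benchmark, divided by its mean for one bidder. -/
theorem IsRegularBenchmark.exists_prices {n : ℕ} {f : (Fin (n + 2) → ℝ≥0) → ℝ≥0}
    (hf : IsRegularBenchmark f) {ρ : ℝ≥0} (hρ0 : 0 < ρ)
    (hρ : ∫⁻ v in cube (n + 1) 1, topWeight f v = ρ) :
    ∃ G : Fin (n + 2) → (Fin (n + 2) → ℝ≥0) → ProbabilityMeasure ℝ≥0∞,
      ∀ b, ((f b / ρ : ℝ≥0) : ℝ≥0∞) ≤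
        ∑ i, ∫⁻ p, priceRevenue (b i) p ∂(G i (update b i 0) : Measure ℝ≥0∞) := by
  classical
  refine exists_prices_of_finite fun B ε hε => ?_
  set δ : ℝ≥0 := ε / (2 * (n + 2)) with hδ
  have hδ0 : 0 < δ := by positivity
  let X : Finset ℝ≥0 :=
    insert δ ((B ×ˢ Finset.univ).image fun z : (Fin (n + 2) → ℝ≥0) × Fin (n + 2) => max (z.1 z.2) δ)
  have hXδ : ∀ x ∈ X, δ ≤ x := by
    intro x hx
    rcases Finset.mem_insert.1 hx with rfl | hx
    · exact le_rfl
    · obtain ⟨z, _, rfl⟩ := Finset.mem_image.1 hx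
      exact le_max_right _ _
  obtain ⟨N, hN⟩ : ∃ N, X.card = N + 1 :=
    Nat.exists_eq_succ_of_ne_zero (Finset.card_ne_zero_of_mem (Finset.mem_insert_self δ _))
  let x : Fin (N + 1) → ℝ≥0 := X.orderEmbOfFin hN
  have hx : StrictMono x := (X.orderEmbOfFin hN).strictMono
  have hx0 : 0 < x 0 := hδ0.trans_le (hXδ _ (X.orderEmbOfFin_mem hN 0))
  have hinv : ∀ y ∈ X, x (invFun x y) = y := fun y hy => by
    refine invFun_eq ?_
    have := X.range_orderEmbOfFin hN
    exact (this ▸ hy : y ∈ range (X.orderEmbOfFin hN))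
  set S : ℝ≥0 := ∑ b ∈ B, f b / ρ with hS
  set η : ℝ≥0 := ε / (2 * (S + 1)) with hη
  have hη0 : 0 < η := by positivity
  obtain ⟨G, hGu, hG⟩ := hf.exists_grid_prices hρ (l := ρ * (1 + η))
    (by rw [mul_add, mul_one]; exact lt_add_of_pos_right _ (by positivity)) hx hx0
  refine ⟨fun i b => G i fun k => invFun x (max (b k) δ), fun b hb => ?_⟩
  let c : Fin (n + 2) → Fin (N + 1) := fun k => invFun x (max (b k) δ)
  have hxc : ∀ k, x (c k) = max (b k) δ := fun k => hinv _ (Finset.mem_insert_of_mem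
    (Finset.mem_image.2 ⟨(b, k), by simp [hb], rfl⟩))
  have hGi : ∀ i, G i (fun k => invFun x (max (update b i 0 k) δ)) = G i c := by
    intro i
    rw [← hGu i c (invFun x (max 0 δ))]
    congr 1
    funext k
    rcases eq_or_ne k i with rfl | hk
    · simp
    · simp [hk, c]
  simp only [hGi]
  set T := ∑ i, ∫⁻ p, priceRevenue (b i) p ∂(G i c : Measure ℝ≥0∞) with hT
  have h1 : (f b : ℝ≥0∞) ≤ (ρ * (1 + η) : ℝ≥0) * (T + (ε / 2 : ℝ≥0)) := by
    have hmono : f b ≤ f (x ∘ c) := hf.mono fun k => by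
      simp only [comp_apply, hxc]
      exact le_max_left _ _
    refine (ENNReal.coe_le_coe.2 hmono).trans ((hG c).trans (mul_le_mul_right ?_ _))
    calc ∑ i, ∫⁻ p, priceRevenue (x (c i)) p ∂(G i c : Measure ℝ≥0∞)
        ≤ ∑ i, (∫⁻ p, priceRevenue (b i) p ∂(G i c : Measure ℝ≥0∞) + δ) := by
          refine Finset.sum_le_sum fun i _ => ?_
          rw [hxc]
          refine (lintegral_mono fun p => priceRevenue_max_le (b i) δ p).trans ?_
          rw [lintegral_add_right _ measurable_const]
          simp
      _ = T + (ε / 2 : ℝ≥0) := by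
          rw [Finset.sum_add_distrib, Finset.sum_const, Finset.card_univ, Fintype.card_fin,
            ← ENNReal.coe_nsmul]
          congr 2
          rw [hδ, nsmul_eq_mul]
          push_cast
          field_simp
  have hTtop : T ≠ ∞ := by
    exact ENNReal.sum_ne_top.2 fun i _ =>
      ne_top_of_le_ne_top ENNReal.coe_ne_top (lintegral_priceRevenue_le (b i) _)
  obtain ⟨t, ht⟩ : ∃ t : ℝ≥0, (t : ℝ≥0∞) = T := ⟨T.toNNReal, ENNReal.coe_toNNReal hTtop⟩
  rw [← ht] at h1 ⊢
  rw [← ENNReal.coe_add, ← ENNReal.coe_mul, ENNReal.coe_le_coe] at h1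
  rw [← ENNReal.coe_add, ENNReal.coe_le_coe]
  have h2 : f b / ρ ≤ S := Finset.single_le_sum (f := fun b => f b / ρ) (fun _ _ => bot_le) hb
  have h3 : f b / ρ ≤ (1 + η) * (t + ε / 2) := by
    rw [div_le_iff₀ hρ0]
    calc f b ≤ _ := h1
      _ = _ := by ring
  have hη1 : η * (2 * (S + 1)) = ε := by
    rw [hη, div_mul_cancel₀]
    positivity
  rw [← NNReal.coe_le_coe] at h2 h3 ⊢
  have hη2 : (η : ℝ) * (2 * (S + 1)) = ε := by exact_mod_cast hη1
  have hη3 : (0 : ℝ) < η := hη0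
  have hε' : (0 : ℝ) < ε := hε
  push_cast at h2 h3 ⊢
  set F : ℝ := (f b : ℝ) / ρ
  by_contra! hcon
  have h4 : (η : ℝ) * (t + ε / 2) ≤ η * S := mul_le_mul_of_nonneg_left (by linarith) hη3.le
  linarith

end Compactness

section PostedPrices

open Set Function
open scoped ENNReal

lemma priceRevenue_ne_top (x : ℝ≥0) (p : ℝ≥0∞) : priceRevenue x p ≠ ∞ :=
  ne_top_of_le_ne_top ENNReal.coe_ne_top (priceRevenue_le x p)

lemma toNNReal_priceRevenue_le (x : ℝ≥0) (p : ℝ≥0∞) : (priceRevenue x p).toNNReal ≤ x := by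
  rw [← ENNReal.coe_le_coe, ENNReal.coe_toNNReal (priceRevenue_ne_top x p)]
  exact priceRevenue_le x p

lemma priceRevenue_of_le {x : ℝ≥0} {p : ℝ≥0∞} (h : p ≤ x) : priceRevenue x p = p := by
  simp [priceRevenue, h]

lemma priceRevenue_of_not_le {x : ℝ≥0} {p : ℝ≥0∞} (h : ¬ p ≤ x) : priceRevenue x p = 0 := by
  simp [priceRevenue, h]

/-- Facing a posted price, it is optimal to bid the true value. -/
lemma posted_price_truthful {v x : ℝ≥0} {p : ℝ≥0∞} {S T : Prop} {_ : Decidable S} {_ : Decidable T}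
    (hS : S ↔ p ≤ x) (hT : T ↔ p ≤ v) :
    (if S then (v : ℝ) - (priceRevenue x p).toNNReal else 0) ≤
      if T then (v : ℝ) - (priceRevenue v p).toNNReal else 0 := by
  have h1 : p ≤ v → (p.toNNReal : ℝ) ≤ v := fun hv => by
    rw [NNReal.coe_le_coe, ← ENNReal.coe_le_coe, ENNReal.coe_toNNReal
      (ne_top_of_le_ne_top ENNReal.coe_ne_top hv)]
    exact hv
  have h2 : p ≤ x → ¬ p ≤ v → (v : ℝ) ≤ p.toNNReal := fun hx hv => by
    rw [NNReal.coe_le_coe, ← ENNReal.coe_le_coe, ENNReal.coe_toNNReal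
      (ne_top_of_le_ne_top ENNReal.coe_ne_top hx)]
    exact (not_le.1 hv).le
  by_cases hv : p ≤ v <;> by_cases hx : p ≤ x <;> simp only [hS, hT, hv, hx, if_true, if_false]
  · rw [priceRevenue_of_le hx, priceRevenue_of_le hv]
  · rw [priceRevenue_of_le hv]
    exact sub_nonneg.2 (h1 hv)
  · rw [priceRevenue_of_le hx]
    exact sub_nonpos.2 (h2 hx hv)
  · exact le_rfl

lemma integral_toNNReal_eq {Ω : Type*} [MeasurableSpace Ω] {μ : Measure Ω} {g : Ω → ℝ≥0∞}
    (hg : Measurable g) (hg' : ∀ ω, g ω ≠ ∞) :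
    ∫ ω, ((g ω).toNNReal : ℝ) ∂μ = (∫⁻ ω, g ω ∂μ).toReal := by
  rw [← integral_toReal hg.aemeasurable (Filter.Eventually.of_forall fun ω => (hg' ω).lt_top)]
  rfl

lemma integrable_priceRevenue {Ω : Type*} [MeasurableSpace Ω] {μ : Measure Ω} [IsFiniteMeasure μ]
    {p : Ω → ℝ≥0∞} (hp : Measurable p) (x : ℝ≥0) :
    Integrable (fun ω => ((priceRevenue x (p ω)).toNNReal : ℝ)) μ := by
  refine Integrable.of_bound (C := x)
    (((measurable_priceRevenue x).comp hp).ennreal_toNNReal.coe_nnreal_real.aestronglyMeasurable)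
    (Filter.Eventually.of_forall fun ω => ?_)
  rw [Real.norm_of_nonneg (NNReal.coe_nonneg _), NNReal.coe_le_coe]
  exact toNNReal_priceRevenue_le x (p ω)

/-- The auction that offers bidder `i` a price depending on the other bids. -/
noncomputable def postedPriceAuction {n : ℕ} (p : Fin n × (Fin n → ℝ≥0) → ℝ≥0∞) : DetAuction n where
  served b i := p (i, update b i 0) ≤ b i
  pay b i := (priceRevenue (b i) (p (i, update b i 0))).toNNReal
  pay_eq_zero b i h := by simp [priceRevenue_of_not_le h]
  pay_le_bid b i := toNNReal_priceRevenue_le _ _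

lemma postedPriceAuction_isTruthful {n : ℕ} (p : Fin n × (Fin n → ℝ≥0) → ℝ≥0∞) :
    (postedPriceAuction p).IsTruthful := fun i v b => by
  have h := update_self i v b
  have h' : update (update b i v) i 0 = update b i 0 := update_idem _ _ _
  simp only [DetAuction.utility, postedPriceAuction, h, h']
  exact posted_price_truthful Iff.rfl Iff.rfl

/-- Random posted prices form a truthful auction. -/
theorem exists_auction_of_prices {n : ℕ} (G : Fin n → (Fin n → ℝ≥0) → ProbabilityMeasure ℝ≥0∞) :
    ∃ A : TruthfulAuction n, ∀ b, A.expRevenue b =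
      ∑ i, (∫⁻ p, priceRevenue (b i) p ∂(G i (update b i 0) : Measure ℝ≥0∞)).toReal := by
  let μ : Measure (Fin n × (Fin n → ℝ≥0) → ℝ≥0∞) :=
    Measure.infinitePi fun z => (G z.1 z.2 : Measure ℝ≥0∞)
  have hmp : ∀ z, MeasurePreserving (Function.eval z) μ (G z.1 z.2 : Measure ℝ≥0∞) := fun z =>
    measurePreserving_eval_infinitePi (fun z : Fin n × (Fin n → ℝ≥0) => (G z.1 z.2 : Measure ℝ≥0∞)) z
  refine ⟨⟨_, inferInstance, μ, inferInstance, postedPriceAuction, postedPriceAuction_isTruthful,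
    fun b i => ((measurable_priceRevenue (b i)).comp (measurable_pi_apply _)).ennreal_toNNReal⟩,
    fun b => ?_⟩
  change ∫ ω, ∑ i, ((priceRevenue (b i) (ω (i, update b i 0))).toNNReal : ℝ) ∂μ = _
  rw [integral_finsetSum _ fun i _ => integrable_priceRevenue (measurable_pi_apply _) _]
  refine Finset.sum_congr rfl fun i _ => ?_
  rw [integral_toNNReal_eq (μ := μ) (g := fun ω => priceRevenue (b i) (ω (i, update b i 0)))
    ((measurable_priceRevenue (b i)).comp (measurable_pi_apply _))
    fun ω => priceRevenue_ne_top _ _, ← (hmp (i, update b i 0)).lintegral_comp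
      (measurable_priceRevenue (b i))]

/-- The online auction that offers a price depending on the earlier bids. -/
noncomputable def postedPriceOnlineAuction (p : List ℝ≥0 → ℝ≥0∞) : DetOnlineAuction where
  served h x := p h ≤ x
  pay h x := (priceRevenue x (p h)).toNNReal
  pay_eq_zero h x hs := by simp [priceRevenue_of_not_le hs]
  pay_le_bid h x := toNNReal_priceRevenue_le _ _

/-- Random posted prices form a truthful online auction. -/
theorem exists_onlineAuction_of_prices (G : List ℝ≥0 → ProbabilityMeasure ℝ≥0∞) :
    ∃ A : TruthfulOnlineAuction, ∀ (n : ℕ) (b : Fin n → ℝ≥0), A.expRevenue b =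
      (∑ σ : Equiv.Perm (Fin n), ∑ k : Fin n, (∫⁻ p, priceRevenue (b (σ k)) p
        ∂(G ((List.ofFn (b ∘ σ)).take k.val) : Measure ℝ≥0∞)).toReal) / (n.factorial : ℝ) := by
  let μ : Measure (List ℝ≥0 → ℝ≥0∞) := Measure.infinitePi fun z => (G z : Measure ℝ≥0∞)
  have hmp : ∀ z, MeasurePreserving (Function.eval z) μ (G z : Measure ℝ≥0∞) := fun z =>
    measurePreserving_eval_infinitePi (fun z : List ℝ≥0 => (G z : Measure ℝ≥0∞)) z
  refine ⟨⟨_, inferInstance, μ, inferInstance, postedPriceOnlineAuction, fun p h v x =>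
    posted_price_truthful (p := p h) Iff.rfl Iff.rfl,
    fun h x => ((measurable_priceRevenue x).comp (measurable_pi_apply _)).ennreal_toNNReal⟩,
    fun n b => ?_⟩
  change (∑ σ : Equiv.Perm (Fin n), ∫ ω, ∑ k : Fin n, ((priceRevenue (b (σ k))
    (ω ((List.ofFn (b ∘ σ)).take k.val))).toNNReal : ℝ) ∂μ) / (n.factorial : ℝ) = _
  congr 1
  refine Finset.sum_congr rfl fun σ _ => ?_
  rw [integral_finsetSum _ fun i _ => integrable_priceRevenue (measurable_pi_apply _) _]
  refine Finset.sum_congr rfl fun k _ => ?_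
  rw [integral_toNNReal_eq
    (μ := μ) (g := fun ω => priceRevenue (b (σ k)) (ω ((List.ofFn (b ∘ σ)).take k.val)))
    ((measurable_priceRevenue _).comp (measurable_pi_apply _)) fun ω => priceRevenue_ne_top _ _, ← (hmp _).lintegral_comp (measurable_priceRevenue _)]

end PostedPrices

section LowerBound

open Set Function
open scoped ENNReal

lemma map_inv_restrict_Ioc :
    (volume.restrict (Ioc (0 : ℝ) 1)).map (fun u => u⁻¹) =
      (volume.restrict (Ici (1 : ℝ))).withDensity fun x => ENNReal.ofReal (1 / x ^ 2) := by
  ext A hA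
  have himg : (fun u : ℝ => u⁻¹) '' Ici 1 = Ioc 0 1 := by
    ext u
    constructor
    · rintro ⟨x, hx, rfl⟩
      have hx' : (1 : ℝ) ≤ x := hx
      exact ⟨inv_pos.2 (one_pos.trans_le hx'), inv_le_one_of_one_le₀ hx'⟩
    · intro hu
      exact ⟨u⁻¹, (one_le_inv₀ hu.1).2 hu.2, inv_inv u⟩
  rw [Measure.map_apply measurable_inv hA, withDensity_apply _ hA, ← lintegral_indicator hA,
    ← lintegral_indicator_one (measurable_inv hA), ← himg,
    lintegral_image_eq_lintegral_abs_deriv_mul measurableSet_Ici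
      (f' := fun x => -(x ^ 2)⁻¹) (fun x hx => ?_) inv_injective.injOn]
  · refine setLIntegral_congr_fun measurableSet_Ici fun x _ => ?_
    rw [abs_neg, abs_of_nonneg (by positivity), ← one_div]
    by_cases h : x ∈ A
    · simp [h]
    · simp [h]
  · have hx' : (1 : ℝ) ≤ x := hx
    exact (hasDerivAt_inv (one_pos.trans_le hx').ne').hasDerivWithinAt

lemma equalRevenue_eq_map :
    equalRevenue = (volume.restrict (Ioc (0 : ℝ) 1)).map fun u => u⁻¹.toNNReal := by
  rw [equalRevenue, ← map_inv_restrict_Ioc, Measure.map_map measurable_real_toNNReal measurable_inv]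
  rfl

lemma equalRevenueBids_eq_map (n : ℕ) :
    equalRevenueBids n = (volume.restrict (cube n 1)).map invBids := by
  rw [equalRevenueBids, equalRevenue_eq_map, cube, volume_pi, Measure.restrict_pi_pi]
  have : IsFiniteMeasure (volume.restrict (Ioc (0 : ℝ) 1)) := ⟨by simp⟩
  exact (Measure.pi_map_pi (f := fun _ (u : ℝ) => u⁻¹.toNNReal)
    fun _ => measurable_inv.real_toNNReal.aemeasurable).symm

lemma lintegral_equalRevenueBids {n : ℕ} {F : (Fin n → ℝ≥0) → ℝ≥0∞} (hF : Measurable F) :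
    ∫⁻ b, F b ∂(equalRevenueBids n) = ∫⁻ y in cube n 1, F (invBids y) := by
  rw [equalRevenueBids_eq_map, lintegral_map hF (measurable_invBids n)]

/-- A bidder in a truthful auction faces a price that does not depend on his bid. -/
lemma DetAuction.IsTruthful.exists_price {n : ℕ} {A : DetAuction n} (hA : A.IsTruthful)
    (b : Fin n → ℝ≥0) (i : Fin n) :
    ∃ T : ℝ≥0, ∀ x, A.pay (update b i x) i ≤ if T ≤ x then T else 0 := by
  by_cases h : ∃ x, A.served (update b i x) i
  · obtain ⟨x₀, h₀⟩ := h
    refine ⟨A.pay (update b i x₀) i, fun x => ?_⟩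
    by_cases hx : A.served (update b i x) i
    · have h1 := hA i x (update b i x₀)
      have h2 := hA i x₀ (update b i x)
      simp only [update_idem, DetAuction.utility, hx, h₀, if_true] at h1 h2
      have h3 : A.pay (update b i x) i = A.pay (update b i x₀) i :=
        NNReal.coe_injective (by linarith)
      have h4 := A.pay_le_bid (update b i x) i
      rw [h3, update_self] at h4
      rw [if_pos h4, h3]
    · rw [A.pay_eq_zero _ _ hx]
      exact bot_le
  · refine ⟨0, fun x => ?_⟩
    rw [A.pay_eq_zero _ _ fun hx => h ⟨x, hx⟩]
    exact bot_le

lemma lintegral_price_le_one (T : ℝ≥0) :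
    ∫⁻ u in Ioc (0 : ℝ) 1, (if T ≤ u⁻¹.toNNReal then (T : ℝ≥0∞) else 0) ≤ 1 := by
  rcases eq_or_ne T 0 with rfl | hT
  · simp
  have hT' : (0 : ℝ) < T := NNReal.coe_pos.2 (pos_iff_ne_zero.2 hT)
  calc ∫⁻ u in Ioc (0 : ℝ) 1, (if T ≤ u⁻¹.toNNReal then (T : ℝ≥0∞) else 0)
      ≤ ∫⁻ u in Ioc (0 : ℝ) 1, (Ioc (0 : ℝ) (T : ℝ)⁻¹).indicator (fun _ => (T : ℝ≥0∞)) u := by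
        refine setLIntegral_mono' measurableSet_Ioc fun u hu => ?_
        split_ifs with h
        · have h1 : (T : ℝ) ≤ u⁻¹ := (Real.le_toNNReal_iff_coe_le (inv_nonneg.2 hu.1.le)).1 h
          rw [indicator_of_mem (mem_Ioc.2 ⟨hu.1, (le_inv_comm₀ hT' hu.1).1 h1⟩)]
        · exact bot_le
    _ ≤ ∫⁻ u, (Ioc (0 : ℝ) (T : ℝ)⁻¹).indicator (fun _ => (T : ℝ≥0∞)) u := setLIntegral_le_lintegral _ _
    _ = 1 := by
        rw [lintegral_indicator measurableSet_Ioc, setLIntegral_const, Real.volume_Ioc, sub_zero,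
          ENNReal.ofReal_inv_of_pos hT', ENNReal.ofReal_coe_nnreal,
          ENNReal.mul_inv_cancel (ENNReal.coe_ne_zero.2 hT) ENNReal.coe_ne_top]

/-- The expected payment of a bidder with an equal revenue bid, rounded down, is at most one. -/
lemma DetAuction.IsTruthful.lintegral_pay_le {n : ℕ} {A : DetAuction (n + 1)} (hA : A.IsTruthful)
    (i : Fin (n + 1)) {k : ℝ≥0 → ℕ} (hk : Measurable k) {g : ℕ → ℝ≥0} (hg : ∀ x, g (k x) ≤ x) :
    ∫⁻ y in cube (n + 1) 1, (A.pay (fun j => g (k (invBids y j))) i : ℝ≥0∞) ≤ 1 := by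
  have hm : Measurable fun y : Fin (n + 1) → ℝ =>
      (A.pay (fun j => g (k (invBids y j))) i : ℝ≥0∞) := by
    have h1 : Measurable fun c : Fin (n + 1) → ℕ => (A.pay (fun j => g (c j)) i : ℝ≥0∞) :=
      Measurable.of_discrete
    exact h1.comp (measurable_pi_lambda _ fun j =>
      hk.comp ((measurable_pi_apply j).comp (measurable_invBids _)))
  rw [← lintegral_indicator (measurableSet_cube _ _),
    lintegral_eq_insertNth i (hm.indicator (measurableSet_cube _ _)), lintegral_lintegral_swap]
  swap
  · exact ((hm.indicator (measurableSet_cube _ _)).comp (measurable_insertNth i)).aemeasurable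
  calc ∫⁻ v : Fin n → ℝ, ∫⁻ s : ℝ, (cube (n + 1) 1).indicator
        (fun y => (A.pay (fun j => g (k (invBids y j))) i : ℝ≥0∞)) (i.insertNth s v)
      ≤ ∫⁻ v : Fin n → ℝ, (cube n 1).indicator 1 v := by
        refine lintegral_mono fun v => ?_
        by_cases hv : v ∈ cube n 1
        · rw [indicator_of_mem hv]
          obtain ⟨T, hT⟩ := hA.exists_price
            (fun j => g (k (invBids (i.insertNth 0 v : Fin (n + 1) → ℝ) j))) i
          refine le_trans (le_of_eq_of_le ?_ (setLIntegral_mono' (f := fun s =>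
            (A.pay (fun j => g (k (invBids (i.insertNth s v : Fin (n + 1) → ℝ) j))) i : ℝ≥0∞))
            measurableSet_Ioc fun s _ => ?_)) (lintegral_price_le_one T)
          · rw [← lintegral_indicator measurableSet_Ioc]
            refine lintegral_congr fun s => indicator_eq_indicator_of_iff ?_ rfl
            simp [insertNth_mem_cube, hv]
          · have h1 : (fun j => g (k (invBids (i.insertNth s v : Fin (n + 1) → ℝ) j))) =
                update (fun j => g (k (invBids (i.insertNth 0 v : Fin (n + 1) → ℝ) j))) i
                  (g (k s⁻¹.toNNReal)) := by
              funext j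
              refine Fin.succAboveCases i ?_ (fun l => ?_) j
              · simp [invBids]
              · simp [invBids]
            rw [h1]
            have h2 := hT (g (k s⁻¹.toNNReal))
            by_cases h3 : T ≤ g (k s⁻¹.toNNReal)
            · rw [if_pos h3] at h2
              rw [if_pos (h3.trans (hg _))]
              exact ENNReal.coe_le_coe.2 h2
            · rw [if_neg h3] at h2
              rw [le_bot_iff.1 h2]
              exact bot_le
        · simp [hv, insertNth_mem_cube]
    _ = 1 := by
        rw [lintegral_indicator_one (measurableSet_cube _ _), volume_cube]
        simp

lemma TruthfulAuction.ofReal_expRevenue {n : ℕ} (A : TruthfulAuction n) (b : Fin n → ℝ≥0) :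
    letI := A.mΩ
    ENNReal.ofReal (A.expRevenue b) = ∑ i, ∫⁻ ω, ((A.det ω).pay b i : ℝ≥0∞) ∂A.μ := by
  let := A.mΩ
  have := A.isProb
  have hint : ∀ i, Integrable (fun ω => ((A.det ω).pay b i : ℝ)) A.μ := fun i => by
    refine Integrable.of_bound (C := b i) (A.measurable_pay b i).coe_nnreal_real.aestronglyMeasurable
      (Filter.Eventually.of_forall fun ω => ?_)
    rw [Real.norm_of_nonneg (NNReal.coe_nonneg _), NNReal.coe_le_coe]
    exact (A.det ω).pay_le_bid b i
  rw [TruthfulAuction.expRevenue, integral_finsetSum _ fun i _ => hint i,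
    ENNReal.ofReal_sum_of_nonneg fun i _ => integral_nonneg fun ω => NNReal.coe_nonneg _]
  refine Finset.sum_congr rfl fun i _ => ?_
  rw [ofReal_integral_eq_lintegral_ofReal (hint i)
    (Filter.Eventually.of_forall fun ω => NNReal.coe_nonneg _)]
  simp

lemma TruthfulAuction.lintegral_expRevenue_le {n : ℕ} (A : TruthfulAuction (n + 1)) {k : ℝ≥0 → ℕ}
    (hk : Measurable k) {g : ℕ → ℝ≥0} (hg : ∀ x, g (k x) ≤ x) :
    ∫⁻ y in cube (n + 1) 1, ENNReal.ofReal (A.expRevenue fun j => g (k (invBids y j))) ≤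
      (n + 1 : ℕ) := by
  let := A.mΩ
  have := A.isProb
  have hm : ∀ i, Measurable fun z : (Fin (n + 1) → ℝ) × A.Ω =>
      ((A.det z.2).pay (fun j => g (k (invBids z.1 j))) i : ℝ≥0∞) := by
    intro i
    have h1 : Measurable fun z : A.Ω × (Fin (n + 1) → ℕ) =>
        ((A.det z.1).pay (fun j => g (z.2 j)) i : ℝ≥0∞) :=
      measurable_from_prod_countable_left fun c =>
        (A.measurable_pay (fun j => g (c j)) i).coe_nnreal_ennreal
    have h2 : Measurable fun (y : Fin (n + 1) → ℝ) j => k (invBids y j) :=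
      measurable_pi_lambda _ fun j => hk.comp ((measurable_pi_apply j).comp (measurable_invBids _))
    exact h1.comp (measurable_snd.prodMk (h2.comp measurable_fst))
  simp only [A.ofReal_expRevenue]
  rw [lintegral_finsetSum _ fun i _ => (hm i).lintegral_prod_right']
  calc ∑ i, ∫⁻ y in cube (n + 1) 1, ∫⁻ ω, ((A.det ω).pay (fun j => g (k (invBids y j))) i : ℝ≥0∞) ∂A.μ
      ≤ ∑ _i : Fin (n + 1), 1 := by
        refine Finset.sum_le_sum fun i _ => ?_
        rw [lintegral_lintegral_swap (hm i).aemeasurable]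
        exact (lintegral_mono fun ω => (A.truthful ω).lintegral_pay_le i hk hg).trans_eq (by simp)
    _ = (n + 1 : ℕ) := by simp

/-- The equal revenue lower bound on the competitive ratio. -/
theorem IsRegularBenchmark.lintegral_le_of_isCompetitive {n : ℕ} {f : (Fin (n + 1) → ℝ≥0) → ℝ≥0}
    (hf : IsRegularBenchmark f) {A : TruthfulAuction (n + 1)} {r : ℝ} (hA : A.IsCompetitive f r) :
    ∫⁻ y in cube (n + 1) 1, f (invBids y) ≤ ENNReal.ofReal r * (n + 1 : ℕ) := by
  obtain ⟨hr, hA⟩ := hA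
  have hstep : ∀ N : ℕ, 0 < N → (1 - (N : ℝ≥0)⁻¹ : ℝ≥0) * ∫⁻ y in cube (n + 1) 1, f (invBids y) ≤
      ENNReal.ofReal r * (n + 1 : ℕ) := by
    intro N hN
    have hN' : (0 : ℝ≥0) < N := Nat.cast_pos.2 hN
    let k : ℝ≥0 → ℕ := fun x => ⌊(N : ℝ≥0) * x⌋₊
    let g : ℕ → ℝ≥0 := fun m => m / N
    have hk : Measurable k := Nat.measurable_floor.comp (measurable_const_mul _)
    have hg : ∀ x, g (k x) ≤ x := fun x => by
      rw [div_le_iff₀ hN', mul_comm]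
      exact Nat.floor_le bot_le
    have hlow : ∀ x, 1 ≤ x → (1 - (N : ℝ≥0)⁻¹) * x ≤ g (k x) := fun x hx => by
      rw [le_div_iff₀ hN', tsub_mul, one_mul, tsub_mul, tsub_le_iff_right]
      have h1 : (N : ℝ≥0) * x ≤ (⌊(N : ℝ≥0) * x⌋₊ : ℝ≥0) + 1 := (Nat.lt_floor_add_one _).le
      have h2 : (N : ℝ≥0)⁻¹ * x * N = x := by field_simp
      rw [h2, mul_comm x]
      exact h1.trans (add_le_add le_rfl hx)
    calc (1 - (N : ℝ≥0)⁻¹ : ℝ≥0) * ∫⁻ y in cube (n + 1) 1, f (invBids y)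
        = ∫⁻ y in cube (n + 1) 1, (1 - (N : ℝ≥0)⁻¹ : ℝ≥0) * f (invBids y) := by
          rw [lintegral_const_mul' _ _ ENNReal.coe_ne_top]
      _ ≤ ∫⁻ y in cube (n + 1) 1,
            ENNReal.ofReal r * ENNReal.ofReal (A.expRevenue fun j => g (k (invBids y j))) := by
          refine setLIntegral_mono' (measurableSet_cube _ _) fun y hy => ?_
          rw [mem_cube] at hy
          have h1 : (1 - (N : ℝ≥0)⁻¹) * f (invBids y) ≤ f fun j => g (k (invBids y j)) := by
            rw [← hf.smul]
            refine hf.mono fun j => hlow _ ?_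
            rw [invBids, Real.one_le_toNNReal]
            exact (one_le_inv₀ (hy j).1).2 (hy j).2
          have h2 := hA fun j => g (k (invBids y j))
          rw [div_le_iff₀' hr] at h2
          rw [← ENNReal.coe_mul, ← ENNReal.ofReal_mul hr.le, ← ENNReal.ofReal_coe_nnreal]
          exact ENNReal.ofReal_le_ofReal ((NNReal.coe_le_coe.2 h1).trans h2)
      _ = ENNReal.ofReal r *
            ∫⁻ y in cube (n + 1) 1, ENNReal.ofReal (A.expRevenue fun j => g (k (invBids y j))) :=
          lintegral_const_mul' _ _ ENNReal.ofReal_ne_top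
      _ ≤ _ := mul_le_mul_right (A.lintegral_expRevenue_le hk hg) _
  have hlim : Filter.Tendsto (fun N : ℕ => ((1 - (N : ℝ≥0)⁻¹ : ℝ≥0) : ℝ≥0∞) *
      ∫⁻ y in cube (n + 1) 1, (f (invBids y) : ℝ≥0∞)) Filter.atTop
      (nhds (((1 - 0 : ℝ≥0) : ℝ≥0∞) * ∫⁻ y in cube (n + 1) 1, f (invBids y))) := by
    refine ENNReal.Tendsto.mul_const (ENNReal.tendsto_coe.2 ?_) (Or.inl (by simp))
    exact tendsto_const_nhds.sub (tendsto_inv_atTop_zero.comp tendsto_natCast_atTop_atTop)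
  simp only [tsub_zero, ENNReal.coe_one, one_mul] at hlim
  refine le_of_tendsto hlim ?_
  filter_upwards [Filter.eventually_gt_atTop 0] with N hN using hstep N hN

/-- The optimal competitive ratio against a regular benchmark. -/
theorem IsRegularBenchmark.isOptimalRatio {n : ℕ} {f : (Fin (n + 2) → ℝ≥0) → ℝ≥0}
    (hf : IsRegularBenchmark f) {ρ : ℝ≥0} (hρ0 : 0 < ρ)
    (hρ : ∫⁻ y in cube (n + 2) 1, f (invBids y) = (n + 2 : ℕ) * ρ) : IsOptimalRatio f ρ := by
  have hρ0' : (0 : ℝ) < ρ := hρ0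
  constructor
  · rw [hf.lintegral_eq, ENNReal.mul_right_inj (by simp) (ENNReal.natCast_ne_top _)] at hρ
    obtain ⟨G, hG⟩ := hf.exists_prices hρ0 hρ
    obtain ⟨A, hA⟩ := exists_auction_of_prices G
    refine ⟨A, hρ0', fun b => ?_⟩
    have hne : ∀ i, ∫⁻ p, priceRevenue (b i) p ∂(G i (update b i 0) : Measure ℝ≥0∞) ≠ ∞ := fun i =>
      ne_top_of_le_ne_top ENNReal.coe_ne_top (lintegral_priceRevenue_le (b i) _)
    rw [hA, ← ENNReal.toReal_sum fun i _ => hne i]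
    have h := ENNReal.toReal_mono (ENNReal.sum_ne_top.2 fun i _ => hne i) (hG b)
    simpa using h
  · rintro r ⟨A, hA⟩
    have h := hf.lintegral_le_of_isCompetitive hA
    rw [hρ, mul_comm, ENNReal.mul_le_mul_iff_left (by simp) (ENNReal.natCast_ne_top _)] at h
    exact (ENNReal.ofReal_le_ofReal_iff hA.1.le).1 (by rwa [ENNReal.ofReal_coe_nnreal])

end LowerBound

section Sorting

open Function

variable {n : ℕ}

lemma card_filter_comp_perm {p : ℝ≥0 → Prop} [DecidablePred p] (b : Fin n → ℝ≥0)
    (σ : Equiv.Perm (Fin n)) :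
    (Finset.univ.filter fun i => p (b (σ i))).card = (Finset.univ.filter fun i => p (b i)).card :=
  Finset.card_bij (fun i _ => σ i) (by simp) (fun _ _ _ _ h => σ.injective h)
    fun j hj => ⟨σ.symm j, by simpa using hj, by simp⟩

lemma sortedBid_le_iff {b : Fin n → ℝ≥0} {k : Fin n} {u : ℝ≥0} :
    sortedBid b k ≤ u ↔ (Finset.univ.filter fun i => u < b i).card ≤ k.val := by
  have hmono : Monotone fun j => b (Tuple.sort b j) := Tuple.monotone_sort b
  rw [← card_filter_comp_perm b (Tuple.sort b)]
  constructor
  · intro h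
    refine (Finset.card_le_card (t := Finset.Ioi k.rev) fun j hj => ?_).trans ?_
    · rw [Finset.mem_Ioi]
      by_contra! hle
      exact absurd ((hmono hle).trans h) (not_le.2 (by simpa using hj))
    · rw [Fin.card_Ioi, Fin.val_rev]
      omega
  · intro h
    by_contra! hlt
    have h1 := Finset.card_le_card (s := Finset.Ici k.rev)
      (t := Finset.univ.filter fun i => u < b (Tuple.sort b i)) fun j hj => by
        simpa using hlt.trans_le (hmono (Finset.mem_Ici.1 hj))
    rw [Fin.card_Ici, Fin.val_rev] at h1
    omega

lemma lt_card_sortedBid_le (b : Fin n → ℝ≥0) (k : Fin n) :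
    k.val < (Finset.univ.filter fun i => sortedBid b k ≤ b i).card := by
  have hmono : Monotone fun j => b (Tuple.sort b j) := Tuple.monotone_sort b
  rw [← card_filter_comp_perm b (Tuple.sort b)]
  have h1 := Finset.card_le_card (s := Finset.Ici k.rev)
    (t := Finset.univ.filter fun i => sortedBid b k ≤ b (Tuple.sort b i)) fun j hj =>
      Finset.mem_filter.2 ⟨Finset.mem_univ _, hmono (Finset.mem_Ici.1 hj)⟩
  rw [Fin.card_Ici, Fin.val_rev] at h1
  omega

/-- The factor of the `k`-th bid, counted from zero, in `plusTwoBenchmark`. -/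
noncomputable def plusTwoFactor (k : ℕ) : ℝ≥0 := if k = 1 then 4 else (k : ℝ≥0) + 1

lemma plusTwoFactor_pos (k : ℕ) : 0 < plusTwoFactor k := by
  unfold plusTwoFactor
  split_ifs <;> positivity

lemma plusTwoBenchmark_le_iff {b : Fin n → ℝ≥0} {s : ℝ≥0} :
    plusTwoBenchmark b ≤ s ↔ ∀ k, 1 ≤ k → k < n →
      (Finset.univ.filter fun i => s < plusTwoFactor k * b i).card ≤ k := by
  have h1 : ∀ k : Fin n, plusTwoFactor k.val * sortedBid b k ≤ s ↔
      (Finset.univ.filter fun i => s < plusTwoFactor k.val * b i).card ≤ k.val := by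
    intro k
    rw [← le_div_iff₀' (plusTwoFactor_pos _), sortedBid_le_iff]
    simp only [div_lt_iff₀' (plusTwoFactor_pos k.val)]
  rw [plusTwoBenchmark, Finset.sup_le_iff]
  simp only [Finset.mem_filter, Finset.mem_univ, true_and]
  exact ⟨fun h k hk hkn => (h1 ⟨k, hkn⟩).1 (h ⟨k, hkn⟩ hk), fun h k hk => (h1 k).2 (h k hk k.2)⟩

lemma plusTwoBenchmark_mono : Monotone (plusTwoBenchmark (n := n)) := fun b b' h => by
  rw [plusTwoBenchmark_le_iff]
  intro k hk hkn
  refine (Finset.card_le_card fun i hi => ?_).trans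
    (plusTwoBenchmark_le_iff.1 (le_refl (plusTwoBenchmark b')) k hk hkn)
  simp only [Finset.mem_filter, Finset.mem_univ, true_and] at hi ⊢
  exact hi.trans_le (mul_le_mul_right (h i) _)

lemma plusTwoBenchmark_comp (b : Fin n → ℝ≥0) (σ : Equiv.Perm (Fin n)) :
    plusTwoBenchmark (b ∘ σ) = plusTwoBenchmark b := by
  refine eq_of_forall_ge_iff fun s => ?_
  rw [plusTwoBenchmark_le_iff, plusTwoBenchmark_le_iff]
  refine forall_congr' fun k => forall_congr' fun _ => forall_congr' fun _ => ?_
  rw [← card_filter_comp_perm (p := fun x => s < plusTwoFactor k * x) b σ]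
  rfl

lemma plusTwoBenchmark_smul (t : ℝ≥0) (b : Fin n → ℝ≥0) :
    plusTwoBenchmark (t • b) = t * plusTwoBenchmark b := by
  have hle : ∀ (t : ℝ≥0) (b : Fin n → ℝ≥0),
      plusTwoBenchmark (t • b) ≤ t * plusTwoBenchmark b := by
    intro t b
    rw [plusTwoBenchmark_le_iff]
    intro k hk hkn
    refine (Finset.card_le_card fun i hi => ?_).trans
      (plusTwoBenchmark_le_iff.1 (le_refl (plusTwoBenchmark b)) k hk hkn)
    simp only [Finset.mem_filter, Finset.mem_univ, true_and, Pi.smul_apply, smul_eq_mul] at hi ⊢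
    rw [mul_left_comm] at hi
    exact lt_of_mul_lt_mul_left' hi
  refine le_antisymm (hle t b) ?_
  rcases eq_or_ne t 0 with rfl | ht
  · simp
  · have h := hle t⁻¹ (t • b)
    rw [inv_smul_smul₀ ht] at h
    calc t * plusTwoBenchmark b ≤ t * (t⁻¹ * plusTwoBenchmark (t • b)) := mul_le_mul_right h _
      _ = plusTwoBenchmark (t • b) := mul_inv_cancel_left₀ ht _

lemma plusTwoBenchmark_update_le {b : Fin n → ℝ≥0} {i : Fin n} {x y : ℝ≥0}
    (hx : ∀ j, j ≠ i → b j ≤ x) :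
    plusTwoBenchmark (update b i y) ≤ plusTwoBenchmark (update b i x) := by
  rw [plusTwoBenchmark_le_iff]
  intro k hk hkn
  set s := plusTwoBenchmark (update b i x)
  by_cases h : ∃ j, j ≠ i ∧ s < plusTwoFactor k * b j
  · obtain ⟨j, hj, hs⟩ := h
    refine (Finset.card_le_card fun l hl => ?_).trans
      (plusTwoBenchmark_le_iff.1 (le_refl s) k hk hkn)
    simp only [Finset.mem_filter, Finset.mem_univ, true_and] at hl ⊢
    rcases eq_or_ne l i with rfl | hli
    · rw [update_self]
      exact hs.trans_le (mul_le_mul_right (hx j hj) _)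
    · rw [update_of_ne hli] at hl ⊢
      exact hl
  · push Not at h
    refine (Finset.card_le_card (t := {i}) fun l hl => ?_).trans (by simpa using hk)
    simp only [Finset.mem_filter, Finset.mem_univ, true_and] at hl
    rw [Finset.mem_singleton]
    by_contra hli
    rw [update_of_ne hli] at hl
    exact absurd hl (not_lt.2 (h l hli))

lemma measurable_plusTwoBenchmark : Measurable (plusTwoBenchmark (n := n)) := by
  refine measurable_of_Iic fun s => ?_
  have h : plusTwoBenchmark (n := n) ⁻¹' Set.Iic s = ⋂ k, ⋂ (_ : 1 ≤ k), ⋂ (_ : k < n),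
      {b | ∑ i, (if s < plusTwoFactor k * b i then 1 else 0) ≤ k} := by
    ext b
    simp only [Set.mem_preimage, Set.mem_Iic, plusTwoBenchmark_le_iff, Set.mem_iInter,
      Set.mem_ofPred_eq, Finset.card_filter]
  rw [h]
  refine MeasurableSet.iInter fun k => MeasurableSet.iInter fun _ => MeasurableSet.iInter fun _ =>
    measurableSet_le (Finset.measurable_sum _ fun i _ => ?_) measurable_const
  exact Measurable.ite (measurableSet_lt measurable_const
    ((measurable_pi_apply i).const_mul _)) measurable_const measurable_const

theorem isRegularBenchmark_plusTwo : IsRegularBenchmark (plusTwoBenchmark (n := n)) where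
  mono := plusTwoBenchmark_mono
  symm := plusTwoBenchmark_comp
  smul := plusTwoBenchmark_smul
  top _ _ _ _ hx hy := le_antisymm (plusTwoBenchmark_update_le hy) (plusTwoBenchmark_update_le hx)
  meas := measurable_plusTwoBenchmark

end Sorting

section OrderVolume

open Set Function
open scoped ENNReal

/-- The vectors with at most `k` coordinates below `a k`, for every `k < N`. -/
def orderSet (a : ℕ → ℝ) (N : ℕ) : Set (Fin N → ℝ) :=
  {y | ∀ k < N, (Finset.univ.filter fun i => y i < a k).card ≤ k}

lemma measurableSet_orderSet (a : ℕ → ℝ) (N : ℕ) : MeasurableSet (orderSet a N) := by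
  have h : orderSet a N = ⋂ k, ⋂ (_ : k < N),
      {y | ∑ i, (if y i < a k then 1 else 0) ≤ k} := by
    ext y
    simp only [orderSet, Set.mem_iInter, Set.mem_ofPred_eq, Finset.card_filter]
  rw [h]
  refine MeasurableSet.iInter fun k => MeasurableSet.iInter fun _ =>
    measurableSet_le (Finset.measurable_sum _ fun i _ => ?_) measurable_const
  exact Measurable.ite (measurableSet_lt (measurable_pi_apply i) measurable_const)
    measurable_const measurable_const

lemma card_filter_insertNth {N : ℕ} (i : Fin (N + 1)) (s u : ℝ) (v : Fin N → ℝ) :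
    (Finset.univ.filter fun j => (i.insertNth s v : Fin (N + 1) → ℝ) j < u).card =
      (if s < u then 1 else 0) + (Finset.univ.filter fun j => v j < u).card := by
  simp only [Finset.card_filter]
  rw [Fin.sum_univ_succAbove _ i]
  simp

lemma insertNth_mem_orderSet {a : ℕ → ℝ} (ha : Monotone a) {N : ℕ} (i : Fin (N + 1)) {s : ℝ}
    {v : Fin N → ℝ} (hv : ∀ j, v j ≤ s) :
    i.insertNth s v ∈ orderSet a (N + 1) ↔ a N ≤ s ∧ v ∈ orderSet a N := by
  simp only [orderSet, mem_ofPred_eq, card_filter_insertNth]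
  constructor
  · intro h
    refine ⟨?_, fun k hk => le_trans (Nat.le_add_left _ _) (h k (by omega))⟩
    by_contra! hs
    have h1 := h N (Nat.lt_succ_self N)
    rw [if_pos hs, Finset.filter_true_of_mem fun j _ => (hv j).trans_lt hs, Finset.card_univ,
      Fintype.card_fin] at h1
    omega
  · rintro ⟨hs, h⟩ k hk
    rw [if_neg (not_lt.2 ((ha (Nat.lt_succ_iff.1 hk)).trans hs)), zero_add]
    rcases (Nat.lt_succ_iff.1 hk).lt_or_eq with hk | rfl
    · exact h k hk
    · exact (Finset.card_le_univ _).trans (by simp)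

lemma volume_orderSet_succ {a : ℕ → ℝ} (ha : Monotone a) (N : ℕ) (x : ℝ) :
    volume (orderSet a (N + 1) ∩ cube (N + 1) x) =
      (N + 1 : ℕ) * ∫⁻ s in Ioc 0 x ∩ Ici (a N), volume (orderSet a N ∩ cube N s) := by
  have h : ∀ M y, volume (orderSet a M ∩ cube M y) =
      ∫⁻ z in cube M y, (orderSet a M).indicator 1 z := fun M y => by
    rw [lintegral_indicator_one (measurableSet_orderSet a M),
      Measure.restrict_apply (measurableSet_orderSet a M)]
  rw [h, lintegral_cube_max x (measurable_one.indicator (measurableSet_orderSet a _))]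
  have h2 : ∀ i : Fin (N + 1), ∫⁻ s in Ioc 0 x, ∫⁻ v in cube N s,
      (orderSet a (N + 1)).indicator 1 (i.insertNth s v : Fin (N + 1) → ℝ) =
      ∫⁻ s in Ioc 0 x ∩ Ici (a N), volume (orderSet a N ∩ cube N s) := by
    intro i
    rw [inter_comm, ← setLIntegral_indicator measurableSet_Ici]
    refine lintegral_congr fun s => ?_
    by_cases hs : a N ≤ s
    · rw [indicator_of_mem (mem_Ici.2 hs), h]
      refine setLIntegral_congr_fun (measurableSet_cube _ _) fun v hv => ?_
      refine indicator_eq_indicator_of_iff ?_ rfl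
      rw [insertNth_mem_orderSet ha i fun j => (mem_cube.1 hv j).2, and_iff_right hs]
    · rw [indicator_of_notMem (by simpa using hs), ← lintegral_zero (μ := volume.restrict (cube N s))]
      refine setLIntegral_congr_fun (measurableSet_cube _ _) fun v hv => ?_
      refine indicator_of_notMem ?_ _
      rw [insertNth_mem_orderSet ha i fun j => (mem_cube.1 hv j).2]
      exact fun h => hs h.1
  simp only [h2, Finset.sum_const, Finset.card_univ, Fintype.card_fin, nsmul_eq_mul]

/-- The volume of `orderSet a N ∩ cube N x` is an iterated primitive. -/
lemma volume_orderSet_eq {a : ℕ → ℝ} (ha : Monotone a) (ha0 : a 0 = 0) {P : ℕ → ℝ → ℝ}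
    (hP0 : ∀ x, P 0 x = 1) (hPa : ∀ N, P (N + 1) (a N) = 0)
    (hP : ∀ N x, HasDerivAt (P (N + 1)) ((N + 1 : ℕ) * P N x) x) (N : ℕ) :
    ∀ x, (∀ k < N, a k ≤ x) →
      0 ≤ P N x ∧ volume (orderSet a N ∩ cube N x) = ENNReal.ofReal (P N x) := by
  induction N with
  | zero =>
    intro x _
    have h1 : orderSet a 0 ∩ cube 0 x = univ := by
      ext y
      simp [orderSet, cube]
    rw [h1, hP0]
    simp [volume_pi]
  | succ N ih =>
    intro x hx
    have hxN : a N ≤ x := hx N (Nat.lt_succ_self N)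
    have haN : 0 ≤ a N := ha0 ▸ ha (Nat.zero_le N)
    have hcont : Continuous (P N) := by
      rcases N with _ | N
      · rw [show P 0 = fun _ => 1 from funext hP0]
        exact continuous_const
      · exact continuous_iff_continuousAt.2 fun x => (hP N x).continuousAt
    have ih' : ∀ s, a N ≤ s → 0 ≤ P N s ∧
        volume (orderSet a N ∩ cube N s) = ENNReal.ofReal (P N s) := fun s hs =>
      ih s fun k hk => (ha hk.le).trans hs
    have hint : ∫ s in a N..x, (N + 1 : ℕ) * P N s = P (N + 1) x := by
      rw [intervalIntegral.integral_eq_sub_of_hasDerivAt (fun s _ => hP N s)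
        ((hcont.const_mul _).intervalIntegrable _ _), hPa, sub_zero]
    have hpos : 0 ≤ P (N + 1) x := by
      rw [← hint]
      exact intervalIntegral.integral_nonneg hxN fun s hs =>
        mul_nonneg (Nat.cast_nonneg _) (ih' s hs.1).1
    refine ⟨hpos, ?_⟩
    rw [volume_orderSet_succ ha]
    have h2 : (Ioc 0 x ∩ Ici (a N) : Set ℝ) =ᵐ[volume] Ioc (a N) x := by
      have h3 : (Ici (a N) : Set ℝ) =ᵐ[volume] Ioi (a N) := Ioi_ae_eq_Ici.symm
      refine ((ae_eq_refl _).inter h3).trans (Filter.EventuallyEq.of_eq ?_)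
      change (Ioc 0 x ∩ Ioi (a N) : Set ℝ) = Ioc (a N) x
      ext s
      simp only [mem_inter_iff, mem_Ioc, mem_Ioi]
      exact ⟨fun h => ⟨h.2, h.1.2⟩, fun h => ⟨⟨haN.trans_lt h.1, h.2⟩, h.1⟩⟩
    rw [setLIntegral_congr h2, setLIntegral_congr_fun measurableSet_Ioc
      (g := fun s => ENNReal.ofReal (P N s)) fun s hs => (ih' s hs.1.le).2,
      ← hint, intervalIntegral.integral_of_le hxN, integral_const_mul,
      ENNReal.ofReal_mul (Nat.cast_nonneg _), ENNReal.ofReal_natCast,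
      ofReal_integral_eq_lintegral_ofReal]
    · exact (hcont.integrableOn_Icc).mono_set Ioc_subset_Icc_self
    · exact (ae_restrict_iff' measurableSet_Ioc).2 (ae_of_all _ fun s hs => (ih' s hs.1.le).1)

/-- The thresholds for the reciprocal bids given by a benchmark value of `1 / A`. -/
noncomputable def plusTwoThreshold (A : ℝ) (k : ℕ) : ℝ :=
  if k = 0 then 0 else if k = 1 then 4 * A else if k = 2 then 4 * A else (k + 1) * A

lemma monotone_plusTwoThreshold {A : ℝ} (hA : 0 ≤ A) : Monotone (plusTwoThreshold A) := by
  refine monotone_nat_of_le_succ fun k => ?_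
  match k with
  | 0 => simp [plusTwoThreshold, hA]
  | 1 => simp [plusTwoThreshold]
  | 2 => simp only [plusTwoThreshold]; norm_num
  | k + 3 => simp only [plusTwoThreshold]; push_cast; simp; nlinarith

/-- The volume of the vectors in `(0, x]ᴺ` that respect `plusTwoThreshold A`. -/
noncomputable def plusTwoVolume (A : ℝ) : ℕ → ℝ → ℝ
  | 0, _ => 1
  | 1, x => x
  | 2, x => x ^ 2 - 16 * A ^ 2
  | 3, x => x ^ 3 - 48 * A ^ 2 * x + 128 * A ^ 3
  | m + 4, x => (x - (m + 4) * A) * (x ^ (m + 3) + (m + 4) * A * (x - A) ^ (m + 2)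
      - 6 * (m + 4) * (m + 3) * A ^ 2 * (x - 2 * A) ^ (m + 1)
      + 11 / 6 * (m + 4) * (m + 3) * (m + 2) * A ^ 3 * (x - 3 * A) ^ m)

lemma plusTwoVolume_threshold (A : ℝ) (N : ℕ) :
    plusTwoVolume A (N + 1) (plusTwoThreshold A N) = 0 := by
  match N with
  | 0 => simp [plusTwoVolume, plusTwoThreshold]
  | 1 => simp [plusTwoVolume, plusTwoThreshold]; ring
  | 2 => simp [plusTwoVolume, plusTwoThreshold]; ring
  | m + 3 =>
    have h : plusTwoThreshold A (m + 3) = (m + 4) * A := by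
      simp only [plusTwoThreshold]; push_cast; simp; ring_nf; simp
    rw [h, plusTwoVolume, sub_self, zero_mul]

lemma hasDerivAt_sub_pow (c x : ℝ) (k : ℕ) :
    HasDerivAt (fun x => (x - c) ^ (k + 1)) ((k + 1) * (x - c) ^ k) x := by
  have h := ((hasDerivAt_id x).sub_const c).pow (k + 1)
  exact h.congr_deriv (by simp)

lemma hasDerivAt_plusTwoVolume (A : ℝ) (N : ℕ) (x : ℝ) :
    HasDerivAt (plusTwoVolume A (N + 1)) ((N + 1 : ℕ) * plusTwoVolume A N x) x := by
  match N with
  | 0 =>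
    exact (hasDerivAt_id x).congr_deriv (by simp [plusTwoVolume])
  | 1 =>
    exact ((hasDerivAt_pow 2 x).sub_const (16 * A ^ 2)).congr_deriv (by simp [plusTwoVolume])
  | 2 =>
    simp only [plusTwoVolume]
    refine HasDerivAt.congr_deriv (((hasDerivAt_pow 3 x).sub
      ((hasDerivAt_id x).const_mul (48 * A ^ 2))).add_const (128 * A ^ 3)) ?_
    push_cast
    ring
  | 3 =>
    have h := (((hasDerivAt_pow 4 x).sub ((hasDerivAt_pow 2 x).const_mul (96 * A ^ 2))).add
      ((hasDerivAt_id x).const_mul (512 * A ^ 3))).sub_const (768 * A ^ 4)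
    refine (HasDerivAt.congr_deriv h ?_).congr_of_eventuallyEq (.of_forall fun y => ?_)
    · simp only [plusTwoVolume]
      push_cast
      ring
    · simp only [plusTwoVolume, Pi.add_apply, Pi.sub_apply, id]
      push_cast
      ring
  | m + 4 =>
    have h0 := hasDerivAt_sub_pow 0 x (m + 3)
    have h1 := (hasDerivAt_sub_pow A x (m + 2)).const_mul ((m + 5) * A)
    have h2 := (hasDerivAt_sub_pow (2 * A) x (m + 1)).const_mul (6 * (m + 5) * (m + 4) * A ^ 2)
    have h3 := (hasDerivAt_sub_pow (3 * A) x m).const_mul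
      (11 / 6 * (m + 5) * (m + 4) * (m + 3) * A ^ 3)
    have h := (hasDerivAt_sub_pow ((m + 5) * A) x 0).mul (((h0.add h1).sub h2).add h3)
    refine (HasDerivAt.congr_deriv h ?_).congr_of_eventuallyEq (.of_forall fun y => ?_)
    · simp only [plusTwoVolume, Pi.add_apply, Pi.sub_apply]
      push_cast
      ring
    · simp only [plusTwoVolume, Pi.mul_apply, Pi.add_apply, Pi.sub_apply]
      push_cast
      ring

/-- The distribution function of the benchmark of equal revenue bids. -/
lemma volume_plusTwoBenchmark_le {N : ℕ} {s : ℝ≥0} (hs : 0 < s)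
    (hsN : ∀ k < N, plusTwoThreshold (s : ℝ)⁻¹ k ≤ 1) :
    0 ≤ plusTwoVolume (s : ℝ)⁻¹ N 1 ∧
      volume ({y | plusTwoBenchmark (invBids y) ≤ s} ∩ cube N 1) =
        ENNReal.ofReal (plusTwoVolume (s : ℝ)⁻¹ N 1) := by
  have hs' : (0 : ℝ) < s := hs
  have key := volume_orderSet_eq (monotone_plusTwoThreshold (inv_nonneg.2 hs'.le))
    (by simp [plusTwoThreshold]) (P := plusTwoVolume (s : ℝ)⁻¹) (fun _ => rfl)
    (plusTwoVolume_threshold _) (hasDerivAt_plusTwoVolume _) N 1 hsN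
  refine ⟨key.1, ?_⟩
  rw [← key.2]
  congr 1
  ext y
  simp only [mem_inter_iff, mem_ofPred_eq, and_congr_left_iff]
  intro hy
  rw [mem_cube] at hy
  have hlt : ∀ k i, s < plusTwoFactor k * invBids y i ↔ y i < plusTwoFactor k * (s : ℝ)⁻¹ := by
    intro k i
    rw [← NNReal.coe_lt_coe, NNReal.coe_mul, invBids,
      Real.coe_toNNReal _ (inv_nonneg.2 (hy i).1.le), ← div_eq_mul_inv, ← div_eq_mul_inv,
      lt_div_iff₀ (hy i).1, lt_div_iff₀ hs', mul_comm]
  rw [plusTwoBenchmark_le_iff]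
  simp only [hlt, orderSet, mem_ofPred_eq]
  constructor
  · intro h k hk
    match k with
    | 0 => simp [plusTwoThreshold, fun i => (hy i).1.le]
    | 1 => simpa [plusTwoThreshold, plusTwoFactor] using h 1 le_rfl hk
    | 2 =>
      refine le_trans ?_ ((h 1 le_rfl (by omega)).trans one_le_two)
      simp [plusTwoThreshold, plusTwoFactor]
    | k + 3 => simpa [plusTwoThreshold, plusTwoFactor] using h (k + 3) (by omega) hk
  · intro h k hk hkN
    match k with
    | 1 => simpa [plusTwoThreshold, plusTwoFactor] using h 1 hkN
    | 2 =>
      refine (Finset.card_le_card fun i hi => ?_).trans (h 2 hkN)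
      simp only [Finset.mem_filter, Finset.mem_univ, true_and] at hi ⊢
      refine hi.trans_le ?_
      simp only [plusTwoThreshold, plusTwoFactor]
      norm_num
      gcongr
      norm_num
    | k + 3 => simpa [plusTwoThreshold, plusTwoFactor] using h (k + 3) hkN

end OrderVolume

section ExpectedBenchmark

open Set Function
open scoped ENNReal Topology

lemma plusTwoFactor_le_plusTwoBenchmark {N k : ℕ} (hk : 1 ≤ k) (hkN : k < N) {y : Fin N → ℝ}
    (hy : y ∈ cube N 1) : plusTwoFactor k ≤ plusTwoBenchmark (invBids y) := by
  by_contra! h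
  have h1 := plusTwoBenchmark_le_iff.1 (le_refl (plusTwoBenchmark (invBids y))) k hk hkN
  rw [Finset.filter_true_of_mem fun i _ => ?_, Finset.card_univ, Fintype.card_fin] at h1
  · omega
  · refine h.trans_le (le_mul_of_one_le_right' ?_)
    rw [invBids, Real.one_le_toNNReal]
    exact (one_le_inv₀ (mem_cube.1 hy i).1).2 (mem_cube.1 hy i).2

lemma plusTwoThreshold_le_one {N : ℕ} {s : ℝ} (h4 : 4 ≤ s) (hN : N ≤ s) {k : ℕ} (hk : k < N) :
    plusTwoThreshold s⁻¹ k ≤ 1 := by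
  have hs : 0 < s := by linarith
  have hk' : (k : ℝ) + 1 ≤ s := le_trans (by exact_mod_cast hk) hN
  rw [plusTwoThreshold]
  split_ifs
  · exact zero_le_one
  all_goals
    rw [← div_eq_mul_inv, div_le_one hs]
    assumption

/-- The integral of the benchmark is computed from a primitive of its tail. -/
lemma lintegral_plusTwoBenchmark {N : ℕ} {c : ℝ} (h4 : 4 ≤ c) (hN : N ≤ c)
    (hlow : ∀ y ∈ cube N 1, c ≤ plusTwoBenchmark (invBids y)) {G G' : ℝ → ℝ} (hG0 : G 0 = 0)
    (hG : ∀ α, HasDerivAt G (G' α) α)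
    (hG' : ∀ α, α ^ 2 * G' α = 1 - plusTwoVolume α N 1) :
    ∫⁻ y in cube N 1, (plusTwoBenchmark (invBids y) : ℝ≥0∞) = ENNReal.ofReal (c + G c⁻¹) := by
  have hc : 0 < c := by linarith
  set μ : Measure (Fin N → ℝ) := volume.restrict (cube N 1)
  have hμ : IsProbabilityMeasure μ := ⟨by simp [μ, volume_cube]⟩
  have hm : Measurable fun y : Fin N → ℝ => plusTwoBenchmark (invBids y) :=
    measurable_plusTwoBenchmark.comp (measurable_invBids N)
  have h1 : ∫⁻ y, (plusTwoBenchmark (invBids y) : ℝ≥0∞) ∂μ =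
      ∫⁻ t in Ioi (0 : ℝ), μ {y | t < plusTwoBenchmark (invBids y)} := by
    rw [← lintegral_eq_lintegral_meas_lt μ (ae_of_all _ fun y => NNReal.coe_nonneg _)
      hm.coe_nnreal_real.aemeasurable]
    simp only [ENNReal.ofReal_coe_nnreal]
  have h2 : ∫⁻ t in Ioc 0 c, μ {y | t < plusTwoBenchmark (invBids y)} = ENNReal.ofReal c := by
    rw [setLIntegral_congr Ioo_ae_eq_Ioc.symm,
      setLIntegral_congr_fun measurableSet_Ioo (g := fun _ => 1) fun t ht => ?_]
    · simp
    · rw [← hμ.measure_univ]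
      refine measure_congr ?_
      rw [Filter.eventuallyEq_univ]
      exact (ae_restrict_iff' (measurableSet_cube N 1)).2
        (ae_of_all _ fun y hy => ht.2.trans_le (hlow y hy))
  have hkey : ∀ t ∈ Ioi c, 0 ≤ 1 - plusTwoVolume t⁻¹ N 1 ∧
      μ {y | t < plusTwoBenchmark (invBids y)} = ENNReal.ofReal (1 - plusTwoVolume t⁻¹ N 1) := by
    intro t ht
    have ht0 : 0 < t := hc.trans ht
    lift t to ℝ≥0 using ht0.le
    have h := volume_plusTwoBenchmark_le (N := N) (s := t) (by exact_mod_cast ht0) fun k hk =>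
      plusTwoThreshold_le_one (h4.trans (le_of_lt ht)) (hN.trans (le_of_lt ht)) hk
    have hms : MeasurableSet {y : Fin N → ℝ | plusTwoBenchmark (invBids y) ≤ t} :=
      measurableSet_le hm measurable_const
    have h3 : μ {y | plusTwoBenchmark (invBids y) ≤ t} =
        ENNReal.ofReal (plusTwoVolume (t : ℝ)⁻¹ N 1) := by
      rw [← h.2, Measure.restrict_apply hms]
    have h4 : plusTwoVolume (t : ℝ)⁻¹ N 1 ≤ 1 := by
      rw [← ENNReal.ofReal_le_one, ← h3]
      exact prob_le_one
    refine ⟨sub_nonneg.2 h4, ?_⟩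
    rw [ENNReal.ofReal_sub _ h.1, ENNReal.ofReal_one, ← h3, ← prob_compl_eq_one_sub hms]
    congr 1
    ext y
    simp
  have hderiv : ∀ t ∈ Ioi c, HasDerivAt (fun t => -G t⁻¹) (1 - plusTwoVolume t⁻¹ N 1) t := by
    intro t ht
    have ht0 : t ≠ 0 := (hc.trans ht).ne'
    refine ((hG t⁻¹).comp t (hasDerivAt_inv ht0)).neg.congr_deriv ?_
    rw [← hG', inv_pow]
    ring
  have hcont : ContinuousWithinAt (fun t => -G t⁻¹) (Ici c) c :=
    (((hG c⁻¹).continuousAt.comp (continuousAt_inv₀ hc.ne')).neg).continuousWithinAt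
  have hlim : Filter.Tendsto (fun t => -G t⁻¹) Filter.atTop (𝓝 0) := by
    have h := ((hG 0).continuousAt.tendsto.comp tendsto_inv_atTop_zero).neg
    rwa [hG0, neg_zero] at h
  have hpos : ∀ t ∈ Ioi c, 0 ≤ 1 - plusTwoVolume t⁻¹ N 1 := fun t ht => (hkey t ht).1
  have h3 := integral_Ioi_of_hasDerivAt_of_nonneg hcont hderiv hpos hlim
  have h5 := integrableOn_Ioi_deriv_of_nonneg hcont hderiv hpos hlim
  have h6 : ∫⁻ t in Ioi c, μ {y | t < plusTwoBenchmark (invBids y)} = ENNReal.ofReal (G c⁻¹) := by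
    rw [setLIntegral_congr_fun measurableSet_Ioi fun t ht => (hkey t ht).2,
      ← ofReal_integral_eq_lintegral_ofReal h5
        ((ae_restrict_iff' measurableSet_Ioi).2 (ae_of_all _ hpos)), h3]
    simp
  have h7 : 0 ≤ G c⁻¹ := by
    have h := setIntegral_nonneg (μ := volume) measurableSet_Ioi hpos
    rw [h3] at h
    simpa using h
  rw [h1, ← Ioc_union_Ioi_eq_Ioi hc.le, lintegral_union measurableSet_Ioi
    (Ioc_disjoint_Ioi le_rfl), h2, h6, ENNReal.ofReal_add hc.le h7]

lemma lintegral_plusTwoBenchmark_two :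
    ∫⁻ y in cube 2 1, (plusTwoBenchmark (invBids y) : ℝ≥0∞) = ENNReal.ofReal 8 := by
  rw [lintegral_plusTwoBenchmark (c := 4) le_rfl (by norm_num) (fun y hy => ?_)
    (G := fun α => 16 * α) (G' := fun _ => 16) (by simp)
    (fun α => ((hasDerivAt_id α).const_mul 16).congr_deriv (by simp))
    (fun α => by simp [plusTwoVolume]; ring)]
  · norm_num
  · simpa [plusTwoFactor] using
      NNReal.coe_le_coe.2 (plusTwoFactor_le_plusTwoBenchmark le_rfl (by norm_num) hy)

lemma lintegral_plusTwoBenchmark_three :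
    ∫⁻ y in cube 3 1, (plusTwoBenchmark (invBids y) : ℝ≥0∞) = ENNReal.ofReal 12 := by
  rw [lintegral_plusTwoBenchmark (c := 4) le_rfl (by norm_num) (fun y hy => ?_)
    (G := fun α => 48 * α - 64 * α ^ 2) (G' := fun α => 48 - 128 * α) (by simp)
    (fun α => (((hasDerivAt_id α).const_mul 48).sub
      ((hasDerivAt_pow 2 α).const_mul 64)).congr_deriv (by norm_num; ring))
    (fun α => by simp [plusTwoVolume]; ring)]
  · norm_num
  · simpa [plusTwoFactor] using
      NNReal.coe_le_coe.2 (plusTwoFactor_le_plusTwoBenchmark le_rfl (by norm_num) hy)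

lemma sum_choose_succ_mul (M : ℕ) (x : ℝ) :
    ∑ j ∈ Finset.range (M + 1), ((j : ℝ) + 2) * x ^ (j + 1) * ((M + 1).choose (j + 1) : ℝ) =
      (1 + x) ^ M * (1 + (M + 2) * x) - 1 := by
  have h1 : (1 + x) ^ (M + 1) = 1 +
      ∑ j ∈ Finset.range (M + 1), x ^ (j + 1) * ((M + 1).choose (j + 1) : ℝ) := by
    rw [add_comm 1 x, add_pow, Finset.sum_range_succ']
    simp [add_comm]
  have h2 : (1 + x) ^ M = ∑ j ∈ Finset.range (M + 1), x ^ j * (M.choose j : ℝ) := by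
    rw [add_comm 1 x, add_pow]
    simp
  have h3 : ∀ j : ℕ, ((j : ℝ) + 1) * ((M + 1).choose (j + 1) : ℝ) = (M + 1) * (M.choose j : ℝ) := by
    intro j
    rw [mul_comm]
    exact_mod_cast (Nat.add_one_mul_choose_eq M j).symm
  have h4 : ∑ j ∈ Finset.range (M + 1), ((j : ℝ) + 2) * x ^ (j + 1) * ((M + 1).choose (j + 1) : ℝ)
      = ((1 + x) ^ (M + 1) - 1) + (M + 1) * x * (1 + x) ^ M := by
    rw [h1, h2, add_sub_cancel_left, Finset.mul_sum, ← Finset.sum_add_distrib]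
    refine Finset.sum_congr rfl fun j _ => ?_
    linear_combination x ^ (j + 1) * h3 j
  rw [h4]
  ring

lemma hasDerivAt_one_sub_mul_pow (c : ℝ) (k : ℕ) (α : ℝ) :
    HasDerivAt (fun α => (1 - c * α) ^ (k + 1)) (-((k + 1) * c * (1 - c * α) ^ k)) α := by
  have h := (((hasDerivAt_id α).const_mul c).const_sub 1).pow (k + 1)
  refine h.congr_deriv ?_
  simp
  ring

lemma hasDerivAt_sum_choose (m : ℕ) (α : ℝ) :
    HasDerivAt (fun α : ℝ => ∑ j ∈ Finset.range (m + 3),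
      (-α) ^ (j + 1) * (((j : ℝ) + 2) / (j + 1)) * ((m + 3).choose (j + 1) : ℝ))
      (∑ j ∈ Finset.range (m + 3), -(((j : ℝ) + 2) * (-α) ^ j * ((m + 3).choose (j + 1) : ℝ)))
      α := by
  refine HasDerivAt.fun_sum fun j _ => ?_
  have h := ((((hasDerivAt_id α).neg).pow (j + 1)).mul_const (((j : ℝ) + 2) / (j + 1))).mul_const
    (((m + 3).choose (j + 1) : ℕ) : ℝ)
  refine h.congr_deriv ?_
  have : (j : ℝ) + 1 ≠ 0 := by positivity
  simp only [Pi.neg_apply, id, Nat.add_sub_cancel]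
  push_cast
  field_simp

lemma mul_sum_choose (m : ℕ) (α : ℝ) :
    α * ∑ j ∈ Finset.range (m + 3), ((j : ℝ) + 2) * (-α) ^ j * ((m + 3).choose (j + 1) : ℝ) =
      1 - (1 - α) ^ (m + 2) * (1 - (m + 4) * α) := by
  have h1 := sum_choose_succ_mul (m + 2) (-α)
  have h2 : ∑ j ∈ Finset.range (m + 2 + 1),
      ((j : ℝ) + 2) * (-α) ^ (j + 1) * ((m + 2 + 1).choose (j + 1) : ℝ) =
      -(α * ∑ j ∈ Finset.range (m + 3),
        ((j : ℝ) + 2) * (-α) ^ j * ((m + 3).choose (j + 1) : ℝ)) := by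
    rw [← neg_mul, Finset.mul_sum]
    exact Finset.sum_congr rfl fun j _ => by ring
  rw [h2] at h1
  push_cast at h1
  linear_combination -h1

/-- The primitive behind the expected benchmark for `m + 4` bidders. -/
noncomputable def plusTwoPrimitive (m : ℕ) (α : ℝ) : ℝ :=
  (m + 4) * (3 / 2 * ((m + 3) * (1 - 2 * α) ^ (m + 2) - (m + 4) * (1 - 2 * α) ^ (m + 3) + 1)
    - 11 / 162 * ((m + 3) * (m + 2) * (1 - 3 * α) ^ (m + 1)
      - (2 * m + 5) * (m + 3) * (1 - 3 * α) ^ (m + 2)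
      + (m + 4) * (m + 2) * (1 - 3 * α) ^ (m + 3) + 1)
    - ∑ j ∈ Finset.range (m + 3),
      (-α) ^ (j + 1) * (((j : ℝ) + 2) / (j + 1)) * ((m + 3).choose (j + 1) : ℝ))

lemma hasDerivAt_plusTwoPrimitive (m : ℕ) (α : ℝ) :
    HasDerivAt (plusTwoPrimitive m) ((m + 4) *
      (6 * (m + 3) * (1 - (m + 4) * α) * (1 - 2 * α) ^ (m + 1)
      - 11 / 6 * (m + 3) * (m + 2) * α * (1 - (m + 4) * α) * (1 - 3 * α) ^ m
      + ∑ j ∈ Finset.range (m + 3),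
        ((j : ℝ) + 2) * (-α) ^ j * ((m + 3).choose (j + 1) : ℝ))) α := by
  have h1 := hasDerivAt_sum_choose m α
  have h2 := ((((hasDerivAt_one_sub_mul_pow 2 (m + 1) α).const_mul ((m : ℝ) + 3)).sub
    ((hasDerivAt_one_sub_mul_pow 2 (m + 2) α).const_mul ((m : ℝ) + 4))).add_const 1).const_mul
    (3 / 2)
  have h3 := (((((hasDerivAt_one_sub_mul_pow 3 m α).const_mul (((m : ℝ) + 3) * (m + 2))).sub
    ((hasDerivAt_one_sub_mul_pow 3 (m + 1) α).const_mul ((2 * (m : ℝ) + 5) * (m + 3)))).add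
    ((hasDerivAt_one_sub_mul_pow 3 (m + 2) α).const_mul (((m : ℝ) + 4) * (m + 2)))).add_const
    1).const_mul (11 / 162)
  refine (((h2.sub h3).sub h1).const_mul ((m : ℝ) + 4)).congr_deriv ?_
  rw [Finset.sum_neg_distrib]
  push_cast
  ring

lemma sq_mul_deriv_plusTwoPrimitive (m : ℕ) (α : ℝ) :
    α ^ 2 * ((m + 4) *
      (6 * (m + 3) * (1 - (m + 4) * α) * (1 - 2 * α) ^ (m + 1)
      - 11 / 6 * (m + 3) * (m + 2) * α * (1 - (m + 4) * α) * (1 - 3 * α) ^ m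
      + ∑ j ∈ Finset.range (m + 3),
        ((j : ℝ) + 2) * (-α) ^ j * ((m + 3).choose (j + 1) : ℝ))) =
      1 - plusTwoVolume α (m + 4) 1 := by
  have h := mul_sum_choose m α
  simp only [plusTwoVolume, one_pow]
  linear_combination (m + 4) * α * h

/-- The ratio attained by equal revenue bids of `n ≥ 4` bidders. -/
noncomputable def plusTwoRatio (n : ℕ) : ℝ :=
  1 - ∑ i ∈ Finset.Icc 2 n,
      (-1 / (n : ℝ)) ^ (i - 1) * ((i : ℝ) / ((i : ℝ) - 1)) * ((n - 1).choose (i - 1) : ℝ)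
    + 3 * (n : ℝ) / (2 * ((n : ℝ) - 2)) * ((1 - 2 / (n : ℝ)) ^ (n - 1) + 1 - 2 / (n : ℝ))
    - 11 / 162 * (1 + (5 - 9 / (n : ℝ)) * (1 - 3 / (n : ℝ)) ^ (n - 3))

lemma sum_Icc_two_eq_sum_range (m : ℕ) (x : ℝ) :
    ∑ i ∈ Finset.Icc 2 (m + 4), x ^ (i - 1) * ((i : ℝ) / ((i : ℝ) - 1)) *
      ((m + 4 - 1).choose (i - 1) : ℝ) = ∑ j ∈ Finset.range (m + 3),
      x ^ (j + 1) * (((j : ℝ) + 2) / (j + 1)) * ((m + 3).choose (j + 1) : ℝ) := by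
  rw [Finset.range_eq_Ico, ← Finset.Ico_succ_right_eq_Icc,
    show Order.succ (m + 4) = m + 3 + 2 from rfl, ← Finset.sum_Ico_add' _ 0 (m + 3) 2]
  refine Finset.sum_congr rfl fun j _ => ?_
  push_cast
  rw [show (j : ℝ) + 2 - 1 = j + 1 by ring]

lemma plusTwoPrimitive_inv (m : ℕ) :
    (m + 4 : ℕ) + plusTwoPrimitive m (m + 4 : ℕ)⁻¹ = (m + 4 : ℕ) * plusTwoRatio (m + 4) := by
  rw [plusTwoRatio, sum_Icc_two_eq_sum_range, plusTwoPrimitive, neg_div, one_div,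
    show m + 4 - 1 = m + 3 from rfl, show m + 4 - 3 = m + 1 from rfl, ← div_eq_mul_inv,
    ← div_eq_mul_inv]
  push_cast
  have h2 : (m : ℝ) + 4 - 2 ≠ 0 := by
    have := m.cast_nonneg (α := ℝ)
    linarith
  have h4 : (m : ℝ) + 4 ≠ 0 := by positivity
  have e3 : ∀ x : ℝ, x ^ (m + 3) = x ^ (m + 2) * x := fun x => pow_succ x _
  have e2 : ∀ x : ℝ, x ^ (m + 2) = x ^ (m + 1) * x := fun x => pow_succ x _
  generalize ∑ j ∈ Finset.range (m + 3), (-((m : ℝ) + 4)⁻¹) ^ (j + 1) *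
    (((j : ℝ) + 2) / (j + 1)) * ((m + 3).choose (j + 1) : ℝ) = S
  rw [e3, e3, e2 (1 - 3 / _)]
  generalize (1 - 2 / ((m : ℝ) + 4)) ^ (m + 2) = p
  generalize (1 - 3 / ((m : ℝ) + 4)) ^ (m + 1) = q
  field_simp
  ring

lemma lintegral_plusTwoBenchmark_add_four (m : ℕ) :
    ∫⁻ y in cube (m + 4) 1, (plusTwoBenchmark (invBids y) : ℝ≥0∞) =
      ENNReal.ofReal ((m + 4 : ℕ) * plusTwoRatio (m + 4)) := by
  have hlow : ∀ y ∈ cube (m + 4) 1, ((m + 4 : ℕ) : ℝ) ≤ plusTwoBenchmark (invBids y) := by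
    intro y hy
    have h := plusTwoFactor_le_plusTwoBenchmark (k := m + 3) (by omega) (by omega) hy
    rw [← NNReal.coe_le_coe] at h
    refine le_trans (le_of_eq ?_) h
    simp [plusTwoFactor]
    ring
  have h0 : plusTwoPrimitive m 0 = 0 := by
    rw [plusTwoPrimitive, Finset.sum_eq_zero fun j _ => by simp]
    simp only [mul_zero, sub_zero, one_pow]
    ring
  rw [lintegral_plusTwoBenchmark (by push_cast; linarith [m.cast_nonneg (α := ℝ)]) le_rfl hlow h0
    (hasDerivAt_plusTwoPrimitive m) (sq_mul_deriv_plusTwoPrimitive m), plusTwoPrimitive_inv]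

end ExpectedBenchmark

section RatioBound

open Set

lemma cubic_le_exp_neg {x : ℝ} (h0 : 0 ≤ x) (h1 : x ≤ 1) :
    1 - x + x ^ 2 / 2 - x ^ 3 / 6 ≤ Real.exp (-x) := by
  have h := Real.exp_bound (x := -x) (by rwa [abs_neg, abs_of_nonneg h0]) (n := 5) (by norm_num)
  rw [abs_neg, abs_of_nonneg h0] at h
  have h2 := (abs_le.1 h).1
  simp only [Finset.sum_range_succ, Finset.sum_range_zero, Nat.factorial] at h2
  norm_num at h2
  nlinarith [mul_nonneg (pow_nonneg h0 4) (sub_nonneg.2 h1)]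

lemma exp_neg_le_one_sub_div_pow (m : ℕ) {x : ℝ} (h0 : 0 ≤ x) (h1 : x ≤ 1) :
    Real.exp (-x) ≤ (1 - x / (m + 4)) ^ (m + 2) := by
  have hm : (0 : ℝ) ≤ m := m.cast_nonneg
  have hN : 0 < (m : ℝ) + 4 - x := by linarith
  have h2 : Real.exp (-(x / (m + 4 - x))) ≤ 1 - x / (m + 4) := by
    rw [Real.exp_neg]
    refine inv_le_of_inv_le₀ ?_ ?_
    · rw [sub_pos, div_lt_one (by positivity)]
      linarith
    · refine le_trans (le_of_eq ?_) (Real.add_one_le_exp _)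
      have : (m : ℝ) + 4 ≠ 0 := by positivity
      rw [one_sub_div this, inv_div]
      field_simp
      ring
  calc Real.exp (-x) ≤ Real.exp (-(x / (m + 4 - x))) ^ (m + 2) := by
        rw [← Real.exp_nat_mul, Real.exp_le_exp]
        push_cast
        rw [mul_neg, neg_le_neg_iff, mul_div_assoc', div_le_iff₀ hN]
        nlinarith
    _ ≤ _ := pow_le_pow_left₀ (Real.exp_pos _).le h2 _

lemma neg_sum_choose_le (m : ℕ) :
    -∑ j ∈ Finset.range (m + 3), (-1 / ((m + 4 : ℕ) : ℝ)) ^ (j + 1) * (((j : ℝ) + 2) / (j + 1)) *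
      ((m + 3).choose (j + 1) : ℝ) ≤ 103 / 72 := by
  set E : ℝ → ℝ := fun α => ∑ j ∈ Finset.range (m + 3),
      (-α) ^ (j + 1) * (((j : ℝ) + 2) / (j + 1)) * ((m + 3).choose (j + 1) : ℝ) with hE
  set D : ℝ → ℝ := fun α => ∑ j ∈ Finset.range (m + 3),
      -(((j : ℝ) + 2) * (-α) ^ j * ((m + 3).choose (j + 1) : ℝ)) with hD
  have hN : (0 : ℝ) < m + 4 := by positivity
  have hK : ∀ x : ℝ, HasDerivAt
      (fun x => 2 * x - 3 / 4 * x ^ 2 + 2 / 9 * x ^ 3 - 1 / 24 * x ^ 4 + E (x / (m + 4)))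
      (2 - 3 / 2 * x + 2 / 3 * x ^ 2 - 1 / 6 * x ^ 3 + D (x / (m + 4)) * (1 / (m + 4))) x := by
    intro x
    have h1 : HasDerivAt _ (D (x / (m + 4)) * (1 / (m + 4))) x :=
      (hasDerivAt_sum_choose m (x / (m + 4))).comp x
        ((hasDerivAt_id x).div_const ((m : ℝ) + 4))
    have h2 := ((((hasDerivAt_id x).const_mul 2).sub ((hasDerivAt_pow 2 x).const_mul (3 / 4))).add
      ((hasDerivAt_pow 3 x).const_mul (2 / 9))).sub ((hasDerivAt_pow 4 x).const_mul (1 / 24))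
    refine (h2.add h1).congr_deriv ?_
    generalize D (x / (m + 4)) = d
    norm_num
    ring
  have hmono : MonotoneOn
      (fun x => 2 * x - 3 / 4 * x ^ 2 + 2 / 9 * x ^ 3 - 1 / 24 * x ^ 4 + E (x / (m + 4)))
      (Icc 0 1) := by
    refine monotoneOn_of_deriv_nonneg (convex_Icc 0 1)
      (fun x _ => (hK x).continuousAt.continuousWithinAt)
      (fun x _ => (hK x).differentiableAt.differentiableWithinAt) fun x hx => ?_
    rw [interior_Icc] at hx
    rw [(hK x).deriv]
    have h1 := mul_sum_choose m (x / (m + 4))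
    have h2 := (cubic_le_exp_neg hx.1.le hx.2.le).trans
      (exp_neg_le_one_sub_div_pow m hx.1.le hx.2.le)
    have h3 : x * (D (x / (m + 4)) * (1 / (m + 4))) =
        (1 - x / (m + 4)) ^ (m + 2) * (1 - x) - 1 := by
      rw [hD]
      simp only [Finset.sum_neg_distrib]
      rw [mul_div_cancel₀ _ hN.ne'] at h1
      linear_combination -h1
    have h4 := mul_le_mul_of_nonneg_right h2 (sub_nonneg.2 hx.2.le)
    refine nonneg_of_mul_nonneg_right ?_ hx.1
    rw [mul_add, h3]
    nlinarith
  have h := hmono (left_mem_Icc.2 zero_le_one) (right_mem_Icc.2 zero_le_one) zero_le_one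
  have h0 : E 0 = 0 := Finset.sum_eq_zero fun j _ => by simp
  simp only [zero_div, h0] at h
  have h1 : E (1 / (m + 4)) = ∑ j ∈ Finset.range (m + 3), (-1 / ((m + 4 : ℕ) : ℝ)) ^ (j + 1) *
      (((j : ℝ) + 2) / (j + 1)) * ((m + 3).choose (j + 1) : ℝ) := by
    simp only [hE, neg_div]
    push_cast
    rfl
  rw [← h1]
  norm_num at h ⊢
  linarith

lemma one_sub_two_div_pow_le {m : ℕ} (hm : 6 ≤ m) :
    (1 - 2 / ((m + 4 : ℕ) : ℝ)) ^ (m + 2) ≤ (4 / 5) ^ 8 := by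
  have hm' : (6 : ℝ) ≤ m := by exact_mod_cast hm
  have h2 : (0 : ℝ) < m + 2 := by linarith
  have h := one_add_mul_self_le_rpow_one_add (s := 2 / ((m : ℝ) + 2)) (p := (m + 2) / 8)
    (by linarith [div_pos two_pos h2]) (by linarith)
  have h3 : 1 + ((m : ℝ) + 2) / 8 * (2 / (m + 2)) = 5 / 4 := by
    field_simp
    norm_num
  rw [h3] at h
  have h4 := pow_le_pow_left₀ (by norm_num) h 8
  have h5 : (0 : ℝ) < 1 + 2 / (m + 2) := by positivity
  rw [← Real.rpow_natCast (_ ^ _), ← Real.rpow_mul h5.le,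
    show ((m : ℝ) + 2) / 8 * (8 : ℕ) = (m + 2 : ℕ) by push_cast; ring, Real.rpow_natCast] at h4
  have h6 : 1 - 2 / ((m + 4 : ℕ) : ℝ) = (1 + 2 / ((m : ℝ) + 2))⁻¹ := by
    have : (m : ℝ) + 4 ≠ 0 := by positivity
    have : (m : ℝ) + 2 + 2 ≠ 0 := by positivity
    push_cast
    field_simp
    ring
  rw [h6, inv_pow, show (4 / 5 : ℝ) = (5 / 4)⁻¹ by norm_num, inv_pow]
  exact inv_anti₀ (by positivity) h4

theorem plusTwoRatio_le (m : ℕ) : plusTwoRatio (m + 4) ≤ 4.12 := by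
  by_cases hm : 6 ≤ m
  · have h1 := neg_sum_choose_le m
    have h2 := one_sub_two_div_pow_le hm
    have hm0 : (0 : ℝ) ≤ m := m.cast_nonneg
    have hN : (0 : ℝ) < ((m + 4 : ℕ) : ℝ) := by positivity
    have h3 : 0 ≤ (5 - 9 / ((m + 4 : ℕ) : ℝ)) * (1 - 3 / ((m + 4 : ℕ) : ℝ)) ^ (m + 4 - 3) := by
      refine mul_nonneg ?_ (pow_nonneg ?_ _)
      · rw [sub_nonneg, div_le_iff₀ hN]
        push_cast
        linarith
      · rw [sub_nonneg, div_le_iff₀ hN]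
        push_cast
        linarith
    have h4 : 3 * ((m + 4 : ℕ) : ℝ) / (2 * (((m + 4 : ℕ) : ℝ) - 2)) *
        ((1 - 2 / ((m + 4 : ℕ) : ℝ)) ^ (m + 4 - 1) + 1 - 2 / ((m + 4 : ℕ) : ℝ)) =
        3 / 2 * ((1 - 2 / ((m + 4 : ℕ) : ℝ)) ^ (m + 2) + 1) := by
      rw [show m + 4 - 1 = m + 2 + 1 from rfl, pow_succ]
      have h5 : ((m + 4 : ℕ) : ℝ) - 2 ≠ 0 := by
        push_cast
        linarith
      generalize (1 - 2 / ((m + 4 : ℕ) : ℝ)) ^ (m + 2) = p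
      field_simp
      ring
    rw [plusTwoRatio, sum_Icc_two_eq_sum_range, h4]
    norm_num at h2 ⊢
    norm_num at h1 h3
    linarith
  · have h : m < 6 := by omega
    interval_cases m <;>
      norm_num [plusTwoRatio, Finset.sum_Icc_succ_top, Nat.choose]

end RatioBound

section RandomOrder

open Function
open scoped ENNReal

lemma sum_card_filter_le {ι M : Type*} [LinearOrder ι] [AddCommMonoid M] (g : ℕ → M)
    (U : Finset ι) :
    ∑ k ∈ U, g (U.filter (· ≤ k)).card = ∑ j ∈ Finset.range U.card, g (j + 1) := by
  induction U using Finset.induction_on_max with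
  | empty => simp
  | insert a U hlt ih =>
    have ha : a ∉ U := fun h => lt_irrefl a (hlt a h)
    rw [Finset.sum_insert ha, Finset.card_insert_of_notMem ha, Finset.sum_range_succ, ← ih, add_comm]
    congr 1
    · refine Finset.sum_congr rfl fun k hk => ?_
      rw [Finset.filter_insert, if_neg (not_le.2 (hlt k hk))]
    · rw [Finset.filter_insert, if_pos le_rfl,
        Finset.filter_true_of_mem fun k hk => (hlt k hk).le, Finset.card_insert_of_notMem ha]

/-- Among the first `k + 1` positions of a random order, each is as likely as the last to hold an
element of `T`. -/
lemma sum_perm_card_mul {n : ℕ} (T : Finset (Fin n)) (k : Fin n) (g : ℕ → ℝ≥0) :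
    ∑ σ : Equiv.Perm (Fin n), ((Finset.univ.filter fun i => i ≤ k ∧ σ i ∈ T).card : ℝ≥0) *
        g (Finset.univ.filter fun i => i ≤ k ∧ σ i ∈ T).card =
      (k.val + 1) * ∑ σ : Equiv.Perm (Fin n), if σ k ∈ T then
        g (Finset.univ.filter fun i => i ≤ k ∧ σ i ∈ T).card else 0 := by
  have hswap : ∀ i ≤ k, ∑ σ : Equiv.Perm (Fin n), (if σ i ∈ T then
        g (Finset.univ.filter fun i => i ≤ k ∧ σ i ∈ T).card else 0) =
      ∑ σ : Equiv.Perm (Fin n), if σ k ∈ T then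
        g (Finset.univ.filter fun i => i ≤ k ∧ σ i ∈ T).card else 0 := by
    intro i hi
    rw [← Equiv.sum_comp (Equiv.mulRight (Equiv.swap i k))]
    refine Finset.sum_congr rfl fun σ _ => ?_
    have hle : ∀ j, Equiv.swap i k j ≤ k ↔ j ≤ k := by
      intro j
      rw [Equiv.swap_apply_def]
      split_ifs with h1 h2
      · simp [h1, hi]
      · simp [h2, hi]
      · rfl
    have hcard : (Finset.univ.filter fun j => j ≤ k ∧ (σ * Equiv.swap i k) j ∈ T).card =
        (Finset.univ.filter fun j => j ≤ k ∧ σ j ∈ T).card :=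
      Finset.card_bij (fun j _ => Equiv.swap i k j)
        (fun j hj => Finset.mem_filter.2
          ⟨Finset.mem_univ _, by simpa [hle] using (Finset.mem_filter.1 hj).2⟩)
        (fun _ _ _ _ h => (Equiv.swap i k).injective h)
        fun j hj => ⟨Equiv.swap i k j, Finset.mem_filter.2
          ⟨Finset.mem_univ _, by simpa [hle] using (Finset.mem_filter.1 hj).2⟩, by simp⟩
    refine if_congr ?_ (congrArg g hcard) rfl
    rw [Equiv.coe_mulRight, Equiv.Perm.mul_apply, Equiv.swap_apply_left]
  calc _ = ∑ σ : Equiv.Perm (Fin n), ∑ i ∈ Finset.Iic k, (if σ i ∈ T then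
        g (Finset.univ.filter fun i => i ≤ k ∧ σ i ∈ T).card else 0) := by
        refine Finset.sum_congr rfl fun σ _ => ?_
        rw [← Finset.sum_filter, Finset.sum_const, nsmul_eq_mul]
        congr 3
        ext i
        simp
    _ = _ := by
        rw [Finset.sum_comm, Finset.sum_congr rfl fun i hi => hswap i (Finset.mem_Iic.1 hi),
          Finset.sum_const, Fin.card_Iic, nsmul_eq_mul]
        push_cast
        rfl

/-- The guarantee of `plusTwoBenchmark`, for a unit price, when `j` bids are at least one. -/
noncomputable def unitGuarantee (j : ℕ) : ℝ≥0 := if 2 ≤ j then plusTwoFactor (j - 1) else 0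

lemma unitGuarantee_mul_le {N j : ℕ} {c : Fin N → ℝ≥0} {v : ℝ≥0}
    (hj : j ≤ (Finset.univ.filter fun i => v ≤ c i).card) :
    unitGuarantee j * v ≤ plusTwoBenchmark c := by
  rw [unitGuarantee]
  split_ifs with h2
  · have hN : j ≤ N := hj.trans ((Finset.card_le_univ _).trans (by simp))
    by_contra! hlt
    have h := plusTwoBenchmark_le_iff.1 (le_refl (plusTwoBenchmark c)) (j - 1) (by omega) (by omega)
    have h3 : (Finset.univ.filter fun i => v ≤ c i).card ≤ j - 1 :=
      (Finset.card_le_card fun i hi => by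
        simp only [Finset.mem_filter, Finset.mem_univ, true_and] at hi ⊢
        exact hlt.trans_le (mul_le_mul_right hi _)).trans h
    omega
  · simp

lemma sum_unitGuarantee_div (r : ℕ) :
    ∑ j ∈ Finset.range (r + 2), unitGuarantee (j + 1) / ((j + 1 : ℕ) : ℝ≥0) = r + 2 := by
  induction r with
  | zero =>
    rw [Finset.sum_range_succ, Finset.sum_range_one]
    simp only [unitGuarantee, plusTwoFactor]
    rw [← NNReal.coe_inj]
    norm_num
  | succ r ih =>
    rw [Finset.sum_range_succ, ih]
    have h : unitGuarantee (r + 2 + 1) = ((r + 2 + 1 : ℕ) : ℝ≥0) := by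
      rw [unitGuarantee, if_pos (by omega), plusTwoFactor, if_neg (by omega)]
      push_cast
      rfl
    rw [h, div_self (by positivity)]
    push_cast
    ring

/-- The bids of the first `k + 1` bidders. -/
def firstBids {n : ℕ} (a : Fin n → ℝ≥0) (k : Fin n) : Fin (k.val + 1) → ℝ≥0 :=
  fun i => a (i.castLE k.isLt)

lemma unitGuarantee_mul_le_firstBids {n : ℕ} {b : Fin n → ℝ≥0} {T : Finset (Fin n)} {v : ℝ≥0}
    (hT : ∀ i ∈ T, v ≤ b i) (σ : Equiv.Perm (Fin n)) (k : Fin n) :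
    unitGuarantee (Finset.univ.filter fun i => i ≤ k ∧ σ i ∈ T).card * v ≤
      plusTwoBenchmark (firstBids (b ∘ σ) k) := by
  refine unitGuarantee_mul_le ?_
  refine Finset.card_le_card_of_injOn (fun i => Fin.ofNat (k.val + 1) i.val) (fun i hi => ?_)
    fun i hi j hj h => ?_
  · simp only [Finset.coe_filter, Finset.mem_univ, true_and, Set.mem_ofPred_eq] at hi ⊢
    have h : (Fin.ofNat (k.val + 1) i.val).castLE k.isLt = i :=
      Fin.ext (Nat.mod_eq_of_lt (Nat.lt_succ_iff.2 hi.1))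
    rw [firstBids, h]
    exact hT _ hi.2
  · simp only [Finset.coe_filter, Finset.mem_univ, true_and, Set.mem_ofPred_eq] at hi hj
    have h1 := congrArg Fin.val h
    simp only [Fin.val_ofNat] at h1
    rw [Nat.mod_eq_of_lt (Nat.lt_succ_iff.2 hi.1), Nat.mod_eq_of_lt (Nat.lt_succ_iff.2 hj.1)] at h1
    exact Fin.ext h1

lemma factorial_mul_fixedPriceBenchmark_le {n : ℕ} (b : Fin n → ℝ≥0) :
    n.factorial * fixedPriceBenchmark b ≤ ∑ k : Fin n, ∑ σ : Equiv.Perm (Fin n),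
      plusTwoBenchmark (firstBids (b ∘ σ) k) / (k.val + 1) := by
  rcases eq_or_ne (n.factorial : ℝ≥0) 0 with h0 | h0
  · simp [h0]
  rw [← le_div_iff₀' (pos_of_ne_zero h0), fixedPriceBenchmark, Finset.sup_le_iff]
  intro l hl
  have hl1 : 1 ≤ l.val := by simpa using hl
  rw [le_div_iff₀' (pos_of_ne_zero h0)]
  set v := sortedBid b l
  obtain ⟨T, hTs, hTc⟩ := Finset.exists_subset_card_eq (Nat.succ_le_iff.2 (lt_card_sortedBid_le b l))
  have hT : ∀ i ∈ T, v ≤ b i := fun i hi => by simpa using hTs hi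
  set J : Equiv.Perm (Fin n) → Fin n → ℕ :=
    fun σ k => (Finset.univ.filter fun i => i ≤ k ∧ σ i ∈ T).card with hJ
  set g : ℕ → ℝ≥0 := fun j => unitGuarantee j / (j : ℝ≥0) with hg
  have hgj : ∀ j : ℕ, (j : ℝ≥0) * g j = unitGuarantee j := by
    intro j
    rcases j.eq_zero_or_pos with rfl | hj
    · simp [unitGuarantee]
    · exact mul_div_cancel₀ _ (by positivity)
  have hper : ∀ σ : Equiv.Perm (Fin n), ∑ k, (if σ k ∈ T then g (J σ k) else 0) = l.val + 1 := by
    intro σ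
    set U := Finset.univ.filter fun k => σ k ∈ T with hU
    have hUc : U.card = l.val - 1 + 2 := by
      have h := Finset.card_bij (s := U) (t := T) (fun k _ => σ k)
        (fun k hk => by simpa [hU] using hk) (fun _ _ _ _ h => σ.injective h)
        fun j hj => ⟨σ.symm j, by simpa [hU] using hj, by simp⟩
      omega
    have h1 : ∀ k, J σ k = (U.filter (· ≤ k)).card := fun k => by
      simp only [hJ, hU, Finset.filter_filter]
      congr 1
      ext i
      simp [and_comm]
    rw [← Finset.sum_filter, Finset.sum_congr rfl fun k _ => congrArg g (h1 k),
      sum_card_filter_le g U, hUc]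
    simp only [hg]
    rw [sum_unitGuarantee_div]
    have : ((l.val - 1 : ℕ) : ℝ≥0) + 2 = ((l.val - 1 + 2 : ℕ) : ℝ≥0) := by push_cast; rfl
    rw [this, show l.val - 1 + 2 = l.val + 1 by omega]
    push_cast
    rfl
  calc (n.factorial : ℝ≥0) * ((l.val + 1) * v)
      = (∑ σ : Equiv.Perm (Fin n), ∑ k, if σ k ∈ T then g (J σ k) else 0) * v := by
        rw [Finset.sum_congr rfl fun σ _ => hper σ, Finset.sum_const, Finset.card_univ,
          Fintype.card_perm, Fintype.card_fin, nsmul_eq_mul, mul_assoc]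
    _ = ∑ k : Fin n, (∑ σ : Equiv.Perm (Fin n), unitGuarantee (J σ k)) / (k.val + 1) * v := by
        rw [Finset.sum_comm, Finset.sum_mul]
        refine Finset.sum_congr rfl fun k _ => ?_
        rw [← Finset.sum_congr rfl fun σ _ => hgj (J σ k), sum_perm_card_mul,
          mul_div_cancel_left₀ _ (by positivity)]
    _ ≤ _ := by
        refine Finset.sum_le_sum fun k _ => ?_
        rw [div_mul_eq_mul_div, Finset.sum_mul, Finset.sum_div]
        exact Finset.sum_le_sum fun σ _ => by
          gcongr
          exact unitGuarantee_mul_le_firstBids hT σ k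

end RandomOrder

section Main

open Function
open scoped ENNReal

lemma exists_plusTwo_ratio (n : ℕ) : ∃ ρ : ℝ≥0, 0 < ρ ∧ (ρ : ℝ) ≤ 4.12 ∧
    ∫⁻ y in cube (n + 2) 1, (plusTwoBenchmark (invBids y) : ℝ≥0∞) = (n + 2 : ℕ) * ρ ∧
    (n + 2 ≤ 3 → (ρ : ℝ) = 4) ∧ (4 ≤ n + 2 → (ρ : ℝ) = plusTwoRatio (n + 2)) := by
  match n with
  | 0 =>
    refine ⟨4, by norm_num, by norm_num, ?_, fun _ => by norm_num, fun h => by omega⟩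
    rw [lintegral_plusTwoBenchmark_two]
    norm_num
  | 1 =>
    refine ⟨4, by norm_num, by norm_num, ?_, fun _ => by norm_num, fun h => by omega⟩
    rw [lintegral_plusTwoBenchmark_three]
    norm_num
  | m + 2 =>
    have h := lintegral_plusTwoBenchmark_add_four m
    have hpos : 0 < plusTwoRatio (m + 4) := by
      have h1 : (4 : ℝ≥0∞) ≤ ∫⁻ y in cube (m + 4) 1, (plusTwoBenchmark (invBids y) : ℝ≥0∞) := by
        calc (4 : ℝ≥0∞) = ∫⁻ _ in cube (m + 4) 1, 4 := by simp [volume_cube]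
          _ ≤ _ := setLIntegral_mono' (measurableSet_cube _ _) fun y hy => by
            have h2 := plusTwoFactor_le_plusTwoBenchmark le_rfl (by omega) hy
            rw [plusTwoFactor, if_pos rfl] at h2
            exact_mod_cast h2
      rw [h] at h1
      by_contra! hle
      rw [ENNReal.ofReal_of_nonpos (mul_nonpos_of_nonneg_of_nonpos (Nat.cast_nonneg _) hle)] at h1
      norm_num at h1
    refine ⟨(plusTwoRatio (m + 4)).toNNReal, Real.toNNReal_pos.2 hpos, ?_, ?_, fun h => by omega,
      fun _ => Real.coe_toNNReal _ hpos.le⟩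
    · rw [Real.coe_toNNReal _ hpos.le]
      exact plusTwoRatio_le m
    · rw [h, ENNReal.ofReal_mul (Nat.cast_nonneg _), ENNReal.ofReal_natCast]
      rfl

/-- Prices for a fixed number of bidders that guarantee the ratio `l`. -/
lemma exists_prices_plusTwo {l : ℝ≥0} (hl : (l : ℝ) = 4.12) (n : ℕ) :
    ∃ G : Fin (n + 2) → (Fin (n + 2) → ℝ≥0) → ProbabilityMeasure ℝ≥0∞,
      ∀ b, ((plusTwoBenchmark b / l : ℝ≥0) : ℝ≥0∞) ≤
        ∑ i, ∫⁻ p, priceRevenue (b i) p ∂(G i (update b i 0) : Measure ℝ≥0∞) := by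
  obtain ⟨ρ, hρ0, hρl, hρ, -⟩ := exists_plusTwo_ratio n
  rw [isRegularBenchmark_plusTwo.lintegral_eq,
    ENNReal.mul_right_inj (by simp) (ENNReal.natCast_ne_top _)] at hρ
  obtain ⟨G, hG⟩ := isRegularBenchmark_plusTwo.exists_prices hρ0 hρ
  refine ⟨G, fun b => le_trans (ENNReal.coe_le_coe.2 ?_) (hG b)⟩
  exact div_le_div_of_nonneg_left bot_le hρ0 (NNReal.coe_le_coe.1 (hρl.trans hl.ge))

/-- The uniform mixture of finitely many probability measures. -/
lemma exists_mixture {X : Type*} [MeasurableSpace X] {n : ℕ} (G : Fin (n + 1) → ProbabilityMeasure X) :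
    ∃ H : ProbabilityMeasure X, ∀ F : X → ℝ≥0∞, ∫⁻ p, F p ∂(H : Measure X) =
      ((n + 1 : ℕ) : ℝ≥0∞)⁻¹ * ∑ j, ∫⁻ p, F p ∂(G j : Measure X) := by
  refine ⟨⟨((n + 1 : ℕ) : ℝ≥0∞)⁻¹ • ∑ j, (G j : Measure X), ⟨?_⟩⟩, fun F => ?_⟩
  · simp only [Measure.smul_apply, Measure.finsetSum_apply, measure_univ, Finset.sum_const,
      Finset.card_univ, Fintype.card_fin, nsmul_eq_mul, mul_one, smul_eq_mul]
    exact ENNReal.inv_mul_cancel (by simp) (ENNReal.natCast_ne_top _)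
  · rw [ProbabilityMeasure.coe_mk, lintegral_smul_measure, lintegral_finsetSum_measure, smul_eq_mul]

/-- Prices for an arriving bidder, given the earlier bids, whose revenue from the `k`-th arrival is
on average the `k`-th part of that of an auction for `k` bidders. -/
lemma exists_online_prices {l : ℝ≥0} (hl : (l : ℝ) = 4.12) :
    ∃ H : List ℝ≥0 → ProbabilityMeasure ℝ≥0∞, ∀ (n : ℕ) (b : Fin n → ℝ≥0) (k : Fin n),
      ((∑ σ : Equiv.Perm (Fin n), plusTwoBenchmark (firstBids (b ∘ σ) k) / (k.val + 1) / l : ℝ≥0) :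
        ℝ≥0∞) ≤ ∑ σ : Equiv.Perm (Fin n), ∫⁻ p, priceRevenue (b (σ k)) p
          ∂(H ((List.ofFn (b ∘ σ)).take k.val) : Measure ℝ≥0∞) := by
  choose G hG using exists_prices_plusTwo hl
  choose K hK using fun (m : ℕ) (g : ℕ → ℝ≥0) => exists_mixture fun j : Fin (m + 1 + 1) =>
    G m j ((fun i : Fin (m + 2) => g i) ∘ Equiv.swap j (Fin.last (m + 1)))
  refine ⟨fun h => K (h.length - 1) fun i => h.getD i 0, fun n b k => ?_⟩
  obtain ⟨k, hk⟩ := k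
  match k with
  | 0 =>
    have h0 : ∀ c : Fin (0 + 1) → ℝ≥0, plusTwoBenchmark c = 0 := fun c =>
      le_antisymm (plusTwoBenchmark_le_iff.2 fun k h1 h2 => by omega) bot_le
    simp [h0]
  | m + 1 =>
    set rev : Fin (m + 2) → (Fin (m + 2) → ℝ≥0) → ℝ≥0∞ := fun j c =>
      ∫⁻ p, priceRevenue (c j) p ∂(G m j (update c j 0) : Measure ℝ≥0∞)
    set κ : Fin n := ⟨m + 1, hk⟩
    have hstep : ∀ σ : Equiv.Perm (Fin n), ∫⁻ p, priceRevenue (b (σ κ)) p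
        ∂(K (((List.ofFn (b ∘ σ)).take (m + 1)).length - 1)
          (fun i => ((List.ofFn (b ∘ σ)).take (m + 1)).getD i 0) : Measure ℝ≥0∞) =
        ((m + 1 + 1 : ℕ) : ℝ≥0∞)⁻¹ * ∑ j : Fin (m + 2),
          rev j (firstBids (b ∘ (σ * Equiv.swap (j.castLE hk) κ)) κ) := by
      intro σ
      have hlen : ((List.ofFn (b ∘ σ)).take (m + 1)).length - 1 = m := by
        simp
        omega
      rw [hlen, hK]
      congr 1
      refine Finset.sum_congr rfl fun j _ => ?_
      have hfirst : firstBids (b ∘ (σ * Equiv.swap (j.castLE hk) κ)) κ =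
          firstBids (b ∘ σ) κ ∘ Equiv.swap j (Fin.last (m + 1)) := by
        funext i
        simp only [firstBids, comp_apply, Equiv.Perm.mul_apply]
        rw [(Fin.castLE_injective hk).map_swap]
        rfl
      have hlist : (fun i : Fin (m + 2) => ((List.ofFn (b ∘ σ)).take (m + 1)).getD i 0) =
          update (firstBids (b ∘ σ) κ) (Fin.last (m + 1)) 0 := by
        funext i
        refine Fin.lastCases ?_ (fun i => ?_) i
        · rw [update_self]
          exact List.getD_eq_default _ _ (by simp)
        · rw [update_of_ne (Fin.castSucc_lt_last i).ne, List.getD_eq_getElem _ _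
            (by simp only [List.length_take, List.length_ofFn, Fin.val_castSucc]; omega),
            List.getElem_take, List.getElem_ofFn]
          rfl
      have hup : update (firstBids (b ∘ σ) κ) (Fin.last (m + 1)) 0 ∘
          Equiv.swap j (Fin.last (m + 1)) =
          update (firstBids (b ∘ σ) κ ∘ Equiv.swap j (Fin.last (m + 1))) j 0 := by
        rw [update_comp_equiv]
        simp
      simp only [rev, hfirst, hlist, hup, comp_apply, Equiv.swap_apply_left]
      rfl
    have hsum : ∑ σ : Equiv.Perm (Fin n), ∑ j : Fin (m + 2),
        rev j (firstBids (b ∘ (σ * Equiv.swap (j.castLE hk) κ)) κ) =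
        ∑ σ : Equiv.Perm (Fin n), ∑ j : Fin (m + 2), rev j (firstBids (b ∘ σ) κ) := by
      rw [Finset.sum_comm, Finset.sum_comm (s := Finset.univ (α := Equiv.Perm (Fin n)))]
      refine Finset.sum_congr rfl fun j _ => ?_
      exact Equiv.sum_comp (Equiv.mulRight (Equiv.swap (j.castLE hk) κ))
        fun σ => rev j (firstBids (b ∘ σ) κ)
    have hdiv : (∑ σ : Equiv.Perm (Fin n),
        plusTwoBenchmark (firstBids (b ∘ σ) κ) / ((m + 1 : ℕ) + 1) / l : ℝ≥0) =
        ((m + 1 + 1 : ℕ) : ℝ≥0)⁻¹ *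
          ∑ σ : Equiv.Perm (Fin n), plusTwoBenchmark (firstBids (b ∘ σ) κ) / l := by
      rw [Finset.mul_sum]
      refine Finset.sum_congr rfl fun σ _ => ?_
      push_cast
      rw [div_right_comm, div_eq_inv_mul]
    change (((∑ σ : Equiv.Perm (Fin n),
      plusTwoBenchmark (firstBids (b ∘ σ) κ) / ((m + 1 : ℕ) + 1) / l : ℝ≥0)) : ℝ≥0∞) ≤ _
    rw [hdiv, Finset.sum_congr rfl fun σ _ => hstep σ, ← Finset.mul_sum, hsum, ENNReal.coe_mul,
      ENNReal.coe_inv (by positivity), ENNReal.coe_natCast, ENNReal.ofNNReal_finsetSum]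
    gcongr with σ
    exact hG m _

lemma exists_competitive_onlineAuction : ∃ A : TruthfulOnlineAuction, A.IsCompetitive 4.12 := by
  have hl : ((4.12 : ℝ≥0) : ℝ) = 4.12 := by norm_num
  obtain ⟨H, hH⟩ := exists_online_prices hl
  obtain ⟨A, hA⟩ := exists_onlineAuction_of_prices H
  refine ⟨A, by norm_num, fun n b => ?_⟩
  have hfin : ∀ (σ : Equiv.Perm (Fin n)) (k : Fin n), ∫⁻ p, priceRevenue (b (σ k)) p
      ∂(H ((List.ofFn (b ∘ σ)).take k.val) : Measure ℝ≥0∞) ≠ ∞ := fun σ k =>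
    ((lintegral_priceRevenue_le _ _).trans_lt ENNReal.coe_lt_top).ne
  rw [hA, le_div_iff₀ (by positivity), ← hl,
    Finset.sum_congr rfl fun σ _ => (ENNReal.toReal_sum fun k _ => hfin σ k).symm,
    ← ENNReal.toReal_sum fun σ _ => ENNReal.sum_ne_top.2 fun k _ => hfin σ k, Finset.sum_comm]
  have h1 : ((fixedPriceBenchmark b / 4.12 * n.factorial : ℝ≥0) : ℝ≥0∞) ≤
      ∑ k : Fin n, ∑ σ : Equiv.Perm (Fin n), ∫⁻ p, priceRevenue (b (σ k)) p
        ∂(H ((List.ofFn (b ∘ σ)).take k.val) : Measure ℝ≥0∞) := by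
    refine le_trans ?_ (Finset.sum_le_sum fun k _ => hH n b k)
    rw [← ENNReal.ofNNReal_finsetSum, ENNReal.coe_le_coe]
    calc fixedPriceBenchmark b / 4.12 * n.factorial = n.factorial * fixedPriceBenchmark b / 4.12 := by
          rw [div_mul_eq_mul_div, mul_comm]
      _ ≤ (∑ k : Fin n, ∑ σ : Equiv.Perm (Fin n),
          plusTwoBenchmark (firstBids (b ∘ σ) k) / (k.val + 1)) / 4.12 := by
          gcongr
          exact factorial_mul_fixedPriceBenchmark_le b
      _ = _ := by simp only [Finset.sum_div]
  have h2 := ENNReal.toReal_mono (ENNReal.sum_ne_top.2 fun k _ => ENNReal.sum_ne_top.2 fun σ _ =>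
    hfin σ k) h1
  simpa using h2

end Main

theorem mainTheorem1 :
    (∀ n : ℕ, 2 ≤ n → ∃ ρ : ℝ,
      IsOptimalRatio (plusTwoBenchmark (n := n)) ρ ∧
      ρ ≤ 4.12 ∧
      Integrable (fun b => (plusTwoBenchmark b : ℝ)) (equalRevenueBids n) ∧
      ρ = (∫ b, (plusTwoBenchmark b : ℝ) ∂(equalRevenueBids n)) / (n : ℝ) ∧
      (n ≤ 3 → ρ = 4) ∧
      (4 ≤ n → ρ =
        1 - ∑ i ∈ Finset.Icc 2 n,
            (-1 / (n : ℝ)) ^ (i - 1) * ((i : ℝ) / ((i : ℝ) - 1)) * ((n - 1).choose (i - 1) : ℝ)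
          + 3 * (n : ℝ) / (2 * ((n : ℝ) - 2)) *
            ((1 - 2 / (n : ℝ)) ^ (n - 1) + 1 - 2 / (n : ℝ))
          - 11 / 162 * (1 + (5 - 9 / (n : ℝ)) * (1 - 3 / (n : ℝ)) ^ (n - 3)))) ∧
    ∃ A : TruthfulOnlineAuction, A.IsCompetitive 4.12 := by
  refine ⟨fun n hn => ?_, exists_competitive_onlineAuction⟩
  obtain ⟨n, rfl⟩ := Nat.exists_eq_add_of_le' hn
  obtain ⟨ρ, hρ0, hρl, hρ, h3, h4⟩ := exists_plusTwo_ratio n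
  have hm : Measurable (plusTwoBenchmark (n := n + 2)) := measurable_plusTwoBenchmark
  have hint : ∫⁻ b, (plusTwoBenchmark b : ENNReal) ∂equalRevenueBids (n + 2) = (n + 2 : ℕ) * ρ := by
    rw [lintegral_equalRevenueBids hm.coe_nnreal_ennreal, hρ]
  have hnorm : ∫⁻ b, ENNReal.ofReal (plusTwoBenchmark b) ∂equalRevenueBids (n + 2) =
      (n + 2 : ℕ) * ρ := by
    simpa only [ENNReal.ofReal_coe_nnreal] using hint
  have hnn : 0 ≤ᵐ[equalRevenueBids (n + 2)] fun b => (plusTwoBenchmark b : ℝ) :=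
    ae_of_all _ fun b => NNReal.coe_nonneg _
  refine ⟨ρ, isRegularBenchmark_plusTwo.isOptimalRatio hρ0 hρ, hρl,
    ⟨hm.coe_nnreal_real.aestronglyMeasurable, ?_⟩, ?_, h3, h4⟩
  · rw [hasFiniteIntegral_iff_ofReal hnn, hnorm]
    exact ENNReal.mul_lt_top (ENNReal.natCast_lt_top _) ENNReal.coe_lt_top
  · rw [integral_eq_lintegral_of_nonneg_ae hnn hm.coe_nnreal_real.aestronglyMeasurable, hnorm,
      ENNReal.toReal_mul, ENNReal.toReal_natCast, ENNReal.coe_toReal]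
    exact (mul_div_cancel_left₀ _ (by positivity)).symm
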